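/- **Setting.** Let $d,p\ge 1$, let $\Omega\subset\mathbb R^d$ be a polyhedral Lipschitz domain with conforming simplicial triangulation $\mathcal T_0$, let $\boldsymbol K\in[L^\infty(\Omega)]^{d\times d}$ be symmetric and uniformly positive definite, $\boldsymbol b\in[L^\infty(\Omega)]^d$ and $c,\operatorname{div}\boldsymbol b\in L^\infty(\Omega)$ with $-\operatorname{div}\boldsymbol b+2c\ge 0$ a.e., $f\in L^2(\Omega)$, $\boldsymbol f\in[L^2(\Omega)]^d$, and $\boldsymbol K|_T\in[W^{1,\infty}(T)]^{d\times d}$, $\boldsymbol f|_T\in[H^1(T)]^d$ for all $T\in\mathcal T_0$. On $\mathcal X=H^1_0(\Omega)$ put $a(v,w)=\langle\boldsymbol K\nabla v,\nabla w\rangle_{L^2(\Omega)}$, $|\!|\!|v|\!|\!|=a(v,v)^{1/2}$, $b(v,w)=a(v,w)+\langle\boldsymbol b\cdot\nabla v,w\rangle_{L^2(\Omega)}+\langle cv,w\rangle_{L^2(\Omega)}$, $F(v)=\langle f,v\rangle_{L^2(\Omega)}+\langle\boldsymbol f,\nabla v\rangle_{L^2(\Omega)}$, and let $u^\star\in\mathcal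 X$ satisfy $b(u^\star,v)=F(v)$ for all $v\in\mathcal X$. Let $\mathbb T(\mathcal T_H)$ be the set of conforming meshes obtained from $\mathcal T_H$ by finitely many newest vertex bisections (bisection of tagged simplices with some fixed choice of vertex orders and tags on $\mathcal T_0$; for $d=1$ one additionally requires of each mesh that the maximal ratio of the lengths of neighbouring elements is at most twice that of $\mathcal T_0$). Let $\mathtt{refine}(\mathcal T_H,\mathcal M)$ be the coarsest mesh in $\mathbb T(\mathcal T_H)$ in which all elements of $\mathcal M\subseteq\mathcal T_H$ are refined. Let $\mathcal X_H$ be the space of $v\in\mathcal X$ that are continuous and on each $T\in\mathcal T_H$ a polynomial of degree at most $p$, and let $u_H^\star\in\mathcal X_H$ be the Galerkin solution, $b(u_H^\star,v)=F(v)$ for all $v\in\mathcal X_H$. The residual estimator is $\eta_H(\mathcal U,v)=(\sum_{T\in\mathcal U}\eta_H(T,v)^2)^{1/2}$ for $\mathcal U\subseteq\mathcal T_H$, $\eta_H(v)=\eta_H(\mathcal T_H,v)$, with $$\eta_H(T,v)^2=|T|^{2/d}\|\operatorname{div}(\boldsymbol K\nabla v-\boldsymbol f)-\boldsymbol b\cdot\nabla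 v-cv+f\|_{L^2(T)}^2+|T|^{1/d}\|[\![(\boldsymbol K\nabla v-\boldsymbol f)\cdot n]\!]\|_{L^2(\partial T\cap\Omega)}^2 .$$ **Assumptions.** There are $C_{\rm stab},C_{\rm rel}>0$ and $0<q_{\rm red}<1$ such that for all $\mathcal T_H\in\mathbb T(\mathcal T_0)$, $\mathcal T_h\in\mathbb T(\mathcal T_H)$, $v_H\in\mathcal X_H$, $v_h\in\mathcal X_h$: (A1) $|\eta_h(\mathcal T_h\cap\mathcal T_H,v_h)-\eta_H(\mathcal T_h\cap\mathcal T_H,v_H)|\le C_{\rm stab}|\!|\!|v_h-v_H|\!|\!|$; (A2) $\eta_h(\mathcal T_h\setminus\mathcal T_H,v_H)\le q_{\rm red}\,\eta_H(\mathcal T_H\setminus\mathcal T_h,v_H)$; (A3) $|\!|\!|u^\star-u_H^\star|\!|\!|\le C_{\rm rel}\,\eta_H(u_H^\star)$. **Algorithm.** Input: $0<\theta\le1$, $C_{\rm mark}\ge1$, $u_0^0\in\mathcal X_0$, $C_{\rm alg},\lambda_{\rm alg}>0$, $k_{\max}\in\mathbb N=\{1,2,\dots\}$, and a formal tolerance $\tau<0$;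 set $\mathsf S:=0$. On each level $\ell=0,1,2,\dots$ fix a basis $(\varphi_{\ell,j})_{j=1}^{N_\ell}$ of $\mathcal X_\ell$ and an SPD matrix $\boldsymbol P_\ell\in\mathbb R^{N_\ell\times N_\ell}$, and let $(\boldsymbol B_\ell)_{jk}=b(\varphi_{\ell,k},\varphi_{\ell,j})$, $(\boldsymbol d_\ell)_j=F(\varphi_{\ell,j})$, $\|\boldsymbol x\|_{\boldsymbol P_\ell^{-1}}=(\boldsymbol P_\ell^{-1}\boldsymbol x,\boldsymbol x)_2^{1/2}$. An iterate $u_\ell^k=\sum_j(\boldsymbol x_\ell^k)_j\varphi_{\ell,j}$ has preconditioned residual $\boldsymbol s_\ell^k=\boldsymbol P_\ell(\boldsymbol d_\ell-\boldsymbol B_\ell\boldsymbol x_\ell^k)$ and computable quasi-error $\mathsf H_\ell^k=\eta_\ell(u_\ell^k)+\|\boldsymbol s_\ell^k\|_{\boldsymbol P_\ell^{-1}}$. (i) Starting from $\boldsymbol x_\ell^0$, compute $\boldsymbol x_\ell^1,\boldsymbol x_\ell^2,\dots$ by GMRES for $\boldsymbol P_\ell\boldsymbol B_\ell\boldsymbol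 x=\boldsymbol P_\ell\boldsymbol d_\ell$ in the inner product $(\boldsymbol P_\ell^{-1}\cdot,\cdot)_2$ (modified Gram–Schmidt Arnoldi process and least-squares problem), restarted from the current iterate after every $k_{\max}$ steps, until for the first time $k\ge1$ and $\|\boldsymbol s_\ell^k\|_{\boldsymbol P_\ell^{-1}}\le\lambda_{\rm alg}\,\eta_\ell(u_\ell^k)$; this $k$ is $\underline k[\ell]$ (and $\underline k[\ell]=\infty$ if it does not exist, in which case $\ell$ is the last level). (ii) Write $\mathsf H_\ell^{\underline k}:=\mathsf H_\ell^{\underline k[\ell]}$, $u_\ell^{\underline k}:=u_\ell^{\underline k[\ell]}$. Stop if $\mathsf H_\ell^{\underline k}\le\tau$ (which cannot occur for $\tau<0$). Otherwise, if $\ell\ge1$ and $\mathsf S>C_{\rm alg}(\mathsf H_\ell^{\underline k})^{-1}$, replace $C_{\rm alg}$ by $2C_{\rm alg}$ and $\lambda_{\rm alg}$ by $\lambda_{\rm alg}/2$; then always replace $\mathsf S$ by $\mathsf S+(\mathsf H_\ell^{\underline k})^{-1}$ (with the convention $0^{-1}=0$). (iii) Choose $\mathcal M_\ell\subseteq\mathcal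 T_\ell$ with $\theta\,\eta_\ell(u_\ell^{\underline k})^2\le\eta_\ell(\mathcal M_\ell,u_\ell^{\underline k})^2$ and $\#\mathcal M_\ell\le C_{\rm mark}\,\#\mathcal U$ for every $\mathcal U\subseteq\mathcal T_\ell$ with $\theta\,\eta_\ell(u_\ell^{\underline k})^2\le\eta_\ell(\mathcal U,u_\ell^{\underline k})^2$. (iv) Put $\mathcal T_{\ell+1}=\mathtt{refine}(\mathcal T_\ell,\mathcal M_\ell)$ and $u_{\ell+1}^0=u_\ell^{\underline k}$. Let $\mathcal Q$ be the set of all $(\ell,k)\in\mathbb N_0^2$ for which $u_\ell^k$ is computed, ordered lexicographically, and let $|\ell,k|=\#\{(\ell',k')\in\mathcal Q:(\ell',k')\le(\ell,k)\}$. **Theorem.** Suppose (A1)–(A3), and suppose that there is $C_{\rm pre}\ge1$ such that for all levels $\ell$ and all $v=\sum_j\boldsymbol x_j\varphi_{\ell,j}\in\mathcal X_\ell$ $$C_{\rm pre}^{-1}|\!|\!|v|\!|\!|\le\|\boldsymbol x\|_{\boldsymbol P_\ell^{-1}}\le C_{\rm pre}|\!|\!|v|\!|\!|.$$ Then, for arbitrary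 $0<\theta\le1$, $C_{\rm mark}\ge1$, $u_0^0\in\mathcal X_0$, $\lambda_{\rm alg}>0$, $C_{\rm alg}>0$ and $k_{\max}\in\mathbb N$, and for every run of the algorithm, there are constants $0<q_{\rm lin}<1$ and $C_{\rm lin}>0$ such that $$\mathsf H_\ell^k\le C_{\rm lin}\,q_{\rm lin}^{|\ell,k|-|\ell',k'|}\,\mathsf H_{\ell'}^{k'}\qquad\text{for all }(\ell',k'),(\ell,k)\in\mathcal Q\text{ with }|\ell',k'|\le|\ell,k| .$$ -/

import Mathlib

open MeasureTheory Filter Topology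
open scoped ENNReal ContDiff RealInnerProductSpace Matrix

noncomputable section

namespace AFEM

/-- The Euclidean space `ℝᵈ`. -/
abbrev Pt (d : ℕ) := EuclideanSpace ℝ (Fin d)

variable {d : ℕ}

/-! ### Weak derivatives and the Hilbert space `H¹₀(Ω)` -/

/-- `φ ∈ C_c^∞(U)`. -/
def IsTestFn (U : Set (Pt d)) (φ : Pt d → ℝ) : Prop :=
  ContDiff ℝ ∞ φ ∧ HasCompactSupport φ ∧ tsupport φ ⊆ U

/-- `G` is the weak gradient of `g` on the open set `U`. -/
def HasWeakGrad (U : Set (Pt d)) (g : Pt d → ℝ) (G : Pt d → Pt d) : Prop :=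
  ∀ φ, IsTestFn U φ → ∫ x in U, g x • gradient φ x = -∫ x in U, φ x • G x

/-- `g` is the weak divergence of the vector field `F` on the open set `U`. -/
def HasWeakDiv (U : Set (Pt d)) (F : Pt d → Pt d) (g : Pt d → ℝ) : Prop :=
  ∀ φ, IsTestFn U φ → ∫ x in U, ⟪F x, gradient φ x⟫ = -∫ x in U, g x * φ x

/-- `g ∈ W^{1,q}(U)`. -/
def MemW1 (U : Set (Pt d)) (q : ℝ≥0∞) (g : Pt d → ℝ) : Prop :=
  MemLp g q (volume.restrict U) ∧
    ∃ G : Pt d → Pt d, MemLp G q (volume.restrict U) ∧ HasWeakGrad U g G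

/-- The Hilbert space `L²(Ω) × L²(Ω)ᵈ`, in which a function of `H¹₀(Ω)` is stored together with
its weak gradient. -/
abbrev L2Pair (Ω : Set (Pt d)) : Type :=
  WithLp 2 (Lp ℝ 2 (volume.restrict Ω) × Lp (Pt d) 2 (volume.restrict Ω))

lemma IsTestFn.add {U : Set (Pt d)} {φ ψ : Pt d → ℝ} (hφ : IsTestFn U φ) (hψ : IsTestFn U ψ) :
    IsTestFn U (φ + ψ) :=
  ⟨hφ.1.add hψ.1, hφ.2.1.add hψ.2.1,
    (tsupport_add φ ψ).trans (Set.union_subset hφ.2.2 hψ.2.2)⟩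

lemma IsTestFn.const_smul {U : Set (Pt d)} {φ : Pt d → ℝ} (c : ℝ) (hφ : IsTestFn U φ) :
    IsTestFn U (c • φ) := by
  have hs : tsupport (c • φ) ⊆ tsupport φ :=
    closure_mono (Function.support_const_smul_subset c φ)
  exact ⟨hφ.1.const_smul c, hφ.2.1.mono' ((subset_tsupport _).trans hs), hs.trans hφ.2.2⟩

lemma gradient_add' {φ ψ : Pt d → ℝ} (hφ : ContDiff ℝ ∞ φ) (hψ : ContDiff ℝ ∞ ψ) (x : Pt d) :
    gradient (φ + ψ) x = gradient φ x + gradient ψ x := by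
  have h1 := (hφ.differentiable (by simp)).differentiableAt (x := x)
  have h2 := (hψ.differentiable (by simp)).differentiableAt (x := x)
  simp [gradient, fderiv_add h1 h2]

lemma gradient_const_smul' {φ : Pt d → ℝ} (c : ℝ) (hφ : ContDiff ℝ ∞ φ) (x : Pt d) :
    gradient (c • φ) x = c • gradient φ x := by
  have h1 := (hφ.differentiable (by simp)).differentiableAt (x := x)
  simp [gradient, fderiv_const_smul h1 c]

/-- The pairs `(φ, ∇φ)` with `φ ∈ C_c^∞(Ω)`. -/
def testPairs (Ω : Set (Pt d)) : Submodule ℝ (L2Pair Ω) where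
  carrier := {v | ∃ φ, IsTestFn Ω φ ∧ (v.fst : Pt d → ℝ) =ᵐ[volume.restrict Ω] φ ∧
    (v.snd : Pt d → Pt d) =ᵐ[volume.restrict Ω] gradient φ}
  zero_mem' := by
    refine ⟨0, ⟨contDiff_const, HasCompactSupport.zero, by simp [tsupport]⟩, ?_, ?_⟩
    · exact Lp.coeFn_zero ℝ 2 (volume.restrict Ω)
    · have h0 : gradient (0 : Pt d → ℝ) = 0 := by ext1 x; simp [gradient]
      rw [h0]
      exact Lp.coeFn_zero (Pt d) 2 (volume.restrict Ω)
  add_mem' := by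
    rintro v w ⟨φ, hφ, hv1, hv2⟩ ⟨ψ, hψ, hw1, hw2⟩
    refine ⟨φ + ψ, hφ.add hψ, ?_, ?_⟩
    · exact (Lp.coeFn_add v.fst w.fst).trans (hv1.add hw1)
    · filter_upwards [Lp.coeFn_add v.snd w.snd, hv2, hw2] with x h1 h2 h3
      rw [gradient_add' hφ.1 hψ.1, ← h2, ← h3]
      exact h1
  smul_mem' := by
    rintro c v ⟨φ, hφ, hv1, hv2⟩
    refine ⟨c • φ, hφ.const_smul c, ?_, ?_⟩
    · exact (Lp.coeFn_smul c v.fst).trans (hv1.const_smul c)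
    · filter_upwards [Lp.coeFn_smul c v.snd, hv2] with x h1 h2
      rw [gradient_const_smul' c hφ.1, ← h2]
      exact h1

/-- `H¹₀(Ω)`: the closure of `C_c^∞(Ω)` with respect to the `H¹`-norm, each function being
represented by the pair `(v, ∇v)`. -/
def H01 (Ω : Set (Pt d)) : Submodule ℝ (L2Pair Ω) := (testPairs Ω).topologicalClosure

/-- The function underlying an element of `H¹₀(Ω)`. -/
def val {Ω : Set (Pt d)} (v : H01 Ω) : Pt d → ℝ := (v : L2Pair Ω).fst

/-- The weak gradient of an element of `H¹₀(Ω)`. -/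
def grad {Ω : Set (Pt d)} (v : H01 Ω) : Pt d → Pt d := (v : L2Pair Ω).snd

/-! ### The model problem -/

/-- The boundary of `Ω` is Lipschitz: near each boundary point, in coordinates given by some unit
vector `n` and its orthogonal complement, `Ω` is the set above the graph of a Lipschitz function. -/
def HasLipschitzBoundary (Ω : Set (Pt d)) : Prop :=
  ∀ x ∈ frontier Ω, ∃ (n : Pt d) (r : ℝ) (φ : Pt d → ℝ), ‖n‖ = 1 ∧ 0 < r ∧
    (∃ L, LipschitzWith L φ) ∧ (∀ (y : Pt d) (t : ℝ), φ (y + t • n) = φ y) ∧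
    ∀ y ∈ Metric.ball x r, y ∈ Ω ↔ φ y < ⟪y, n⟫

variable (d) in
/-- The data of the diffusion-convection-reaction problem
`-div (K ∇u) + b · ∇u + c u = f - div 𝐟` in `Ω`, `u = 0` on `∂Ω`, with the standing assumptions. -/
structure ModelProblem where
  /-- the domain -/
  Ω : Set (Pt d)
  /-- the diffusion matrix -/
  K : Pt d → Matrix (Fin d) (Fin d) ℝ
  /-- the convection field -/
  b : Pt d → Pt d
  /-- the reaction coefficient -/
  c : Pt d → ℝ
  /-- the scalar part `f` of the right-hand side -/
  f : Pt d → ℝ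
  /-- the vector part `𝐟` of the right-hand side -/
  fvec : Pt d → Pt d
  isOpen : IsOpen Ω
  lipschitz : HasLipschitzBoundary Ω
  K_bdd : ∀ i j, MemLp (fun x => K x i j) ∞ (volume.restrict Ω)
  K_symm : ∀ᵐ x ∂(volume.restrict Ω), (K x).IsSymm
  K_elliptic : ∃ α > 0, ∀ᵐ x ∂(volume.restrict Ω), ∀ ξ : Fin d → ℝ, α * (ξ ⬝ᵥ ξ) ≤ ξ ⬝ᵥ (K x *ᵥ ξ)
  b_bdd : MemLp b ∞ (volume.restrict Ω)
  c_bdd : MemLp c ∞ (volume.restrict Ω)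
  div_b : ∃ g : Pt d → ℝ, MemLp g ∞ (volume.restrict Ω) ∧ HasWeakDiv Ω b g ∧
    ∀ᵐ x ∂(volume.restrict Ω), 0 ≤ -g x + 2 * c x
  f_mem : MemLp f 2 (volume.restrict Ω)
  fvec_mem : MemLp fvec 2 (volume.restrict Ω)

namespace ModelProblem

variable (M : ModelProblem d)

/-- The field `K ∇v`. -/
def flux (v : H01 M.Ω) (x : Pt d) : Pt d := (M.K x).toEuclideanLin (grad v x)

/-- The principal part `a(v, w)`. -/
def a (v w : H01 M.Ω) : ℝ := ∫ x in M.Ω, ⟪M.flux v x, grad w x⟫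

/-- The bilinear form `b(v, w)`. -/
def bil (v w : H01 M.Ω) : ℝ :=
  M.a v w + (∫ x in M.Ω, ⟪M.b x, grad v x⟫ * val w x) + ∫ x in M.Ω, M.c x * val v x * val w x

/-- The right-hand side functional `F(v)`. -/
def load (v : H01 M.Ω) : ℝ :=
  (∫ x in M.Ω, M.f x * val v x) + ∫ x in M.Ω, ⟪M.fvec x, grad v x⟫

/-- The energy norm. -/
def energyNorm (v : H01 M.Ω) : ℝ := √(M.a v v)

/-- `u` is the weak solution `u⋆`. -/
def IsWeakSol (u : H01 M.Ω) : Prop := ∀ v, M.bil u v = M.load v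

/-- `u` is the Galerkin solution in the subspace `X`. -/
def IsGalerkinSol (X : Submodule ℝ (H01 M.Ω)) (u : H01 M.Ω) : Prop :=
  u ∈ X ∧ ∀ v ∈ X, M.bil u v = M.load v

end ModelProblem

/-! ### Simplicial meshes and newest vertex bisection -/

variable (d) in
/-- A `d`-simplex in `ℝᵈ` with ordered vertices `v₀, …, v_d` and a tag `γ ∈ {1, …, d}`; its
refinement edge is `v₀ v_γ`. -/
structure TSimplex where
  /-- the simplex with its ordered vertices -/
  simplex : Affine.Simplex ℝ (Pt d) d
  /-- the tag -/
  tag : Fin (d + 1)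
  tag_ne : tag ≠ 0

namespace TSimplex

/-- The set of vertices. -/
def verts (T : TSimplex d) : Set (Pt d) := Set.range T.simplex.points

/-- The compact simplex as a set. -/
def carrier (T : TSimplex d) : Set (Pt d) := convexHull ℝ T.verts

/-- The volume `|T|`. -/
def vol (T : TSimplex d) : ℝ := volume.real T.carrier

/-- The facet opposite to the `i`-th vertex. -/
def facet (T : TSimplex d) (i : Fin (d + 1)) : Set (Pt d) :=
  convexHull ℝ (T.simplex.points '' {i}ᶜ)

/-- The outer unit normal on the facet opposite to the `i`-th vertex. -/
def normal [NeZero d] (T : TSimplex d) (i : Fin (d + 1)) : Pt d :=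
  (T.simplex.height i)⁻¹ • (T.simplex.altitudeFoot i - T.simplex.points i)

/-- `T₁` and `T₂` are the two children of `T`: with `z` the midpoint of `v₀` and `v_γ`, they are
`[v₀, …, v_{γ-1}, z, v_{γ+1}, …, v_d]` and `[v₁, …, v_γ, z, v_{γ+1}, …, v_d]`, both with tag `γ - 1`
if `γ ≥ 2` and tag `d` if `γ = 1`. -/
def IsBisection (T T₁ T₂ : TSimplex d) : Prop :=
  let z := midpoint ℝ (T.simplex.points 0) (T.simplex.points T.tag)
  let γ' := if (T.tag : ℕ) = 1 then d else (T.tag : ℕ) - 1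
  (T₁.tag : ℕ) = γ' ∧ (T₂.tag : ℕ) = γ' ∧
  (∀ i, T₁.simplex.points i = if i = T.tag then z else T.simplex.points i) ∧
  (∀ i, T₂.simplex.points i =
    if i < T.tag then T.simplex.points (i + 1) else if i = T.tag then z else T.simplex.points i)

end TSimplex

open Classical in
/-- One element of the mesh is replaced by its two children. -/
def BisectStep (𝒯 𝒯' : Finset (TSimplex d)) : Prop :=
  ∃ T ∈ 𝒯, ∃ T₁ T₂, T.IsBisection T₁ T₂ ∧ 𝒯' = 𝒯.erase T ∪ {T₁, T₂}

/-- Conforming mesh: different elements have different vertex sets, and any two elements intersect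
in the convex hull of their common vertices. -/
def Conforming (𝒯 : Finset (TSimplex d)) : Prop :=
  ∀ T ∈ 𝒯, ∀ T' ∈ 𝒯, (T ≠ T' → T.verts ≠ T'.verts) ∧
    T.carrier ∩ T'.carrier = convexHull ℝ (T.verts ∩ T'.verts)

/-- The ratio of the sizes of neighbouring elements of `𝒯` is at most twice the maximal ratio of the
sizes of neighbouring elements of `𝒯₀`. -/
def Graded (𝒯₀ 𝒯 : Finset (TSimplex d)) : Prop :=
  ∀ T ∈ 𝒯, ∀ T' ∈ 𝒯, (T.carrier ∩ T'.carrier).Nonempty →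
    ∃ S ∈ 𝒯₀, ∃ S' ∈ 𝒯₀, (S.carrier ∩ S'.carrier).Nonempty ∧ T.vol / T'.vol ≤ 2 * (S.vol / S'.vol)

/-- `𝒯₀` is a conforming triangulation of `Ω`. -/
def IsTriangulation (Ω : Set (Pt d)) (𝒯₀ : Finset (TSimplex d)) : Prop :=
  Conforming 𝒯₀ ∧ ⋃ T ∈ 𝒯₀, T.carrier = closure Ω

/-- `𝒯' ∈ 𝕋(𝒯)`: the triangulation `𝒯'` is obtained from `𝒯` by finitely many bisections.
In one dimension, where conformity is void, newest vertex bisection in addition keeps the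
sizes of neighbouring elements comparable; the initial mesh `𝒯₀` enters only there. -/
def IsRefinement (𝒯₀ 𝒯 𝒯' : Finset (TSimplex d)) : Prop :=
  Relation.ReflTransGen BisectStep 𝒯 𝒯' ∧ Conforming 𝒯' ∧ (d = 1 → Graded 𝒯₀ 𝒯')

open Classical in
/-- `𝒯' = refine(𝒯, ℳ)`: the coarsest refinement of `𝒯` in which all elements of `ℳ` are refined. -/
def IsRefine (𝒯₀ 𝒯 ℳ 𝒯' : Finset (TSimplex d)) : Prop :=
  (IsRefinement 𝒯₀ 𝒯 𝒯' ∧ ℳ ⊆ 𝒯 \ 𝒯') ∧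
    ∀ 𝒯'', IsRefinement 𝒯₀ 𝒯 𝒯'' → ℳ ⊆ 𝒯 \ 𝒯'' → IsRefinement 𝒯₀ 𝒯' 𝒯''

/-- The finite element space `S^p_0(𝒯)` of globally continuous functions in `H¹₀(Ω)` that are
polynomials of degree at most `p` on each element. -/
def feSpace (Ω : Set (Pt d)) (p : ℕ) (𝒯 : Finset (TSimplex d)) : Submodule ℝ (H01 Ω) where
  carrier := {v | ∃ g : Pt d → ℝ, ContinuousOn g (closure Ω) ∧
    (∀ T ∈ 𝒯, ∃ q : MvPolynomial (Fin d) ℝ, q.totalDegree ≤ p ∧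
      ∀ x ∈ T.carrier, g x = MvPolynomial.eval (fun i => x i) q) ∧
    val v =ᵐ[volume.restrict Ω] g}
  zero_mem' := ⟨0, continuousOn_const, fun T _ => ⟨0, by simp, by simp⟩,
    Lp.coeFn_zero ℝ 2 (volume.restrict Ω)⟩
  add_mem' := by
    rintro v w ⟨g, hg, hgp, hv⟩ ⟨h, hh, hhp, hw⟩
    refine ⟨g + h, hg.add hh, fun T hT => ?_, ?_⟩
    · obtain ⟨q, hq, hqe⟩ := hgp T hT
      obtain ⟨r, hr, hre⟩ := hhp T hT
      refine ⟨q + r, (MvPolynomial.totalDegree_add q r).trans (max_le hq hr), fun x hx => ?_⟩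
      simp [hqe x hx, hre x hx]
    · exact (Lp.coeFn_add (v : L2Pair Ω).fst (w : L2Pair Ω).fst).trans (hv.add hw)
  smul_mem' := by
    rintro c v ⟨g, hg, hgp, hv⟩
    refine ⟨c • g, hg.const_smul c, fun T hT => ?_, ?_⟩
    · obtain ⟨q, hq, hqe⟩ := hgp T hT
      refine ⟨c • q, (MvPolynomial.totalDegree_smul_le c q).trans hq, fun x hx => ?_⟩
      simp [hqe x hx, MvPolynomial.smul_eval]
    · exact (Lp.coeFn_smul c (v : L2Pair Ω).fst).trans (hv.const_smul c)

/-! ### The residual error estimator -/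

/-- The additional regularity `𝐟|_T ∈ [H¹(T)]ᵈ`, `K|_T ∈ [W^{1,∞}(T)]^{d×d}` for all `T ∈ 𝒯₀`. -/
def PiecewiseRegular (M : ModelProblem d) (𝒯₀ : Finset (TSimplex d)) : Prop :=
  ∀ T ∈ 𝒯₀, (∀ i, MemW1 (interior T.carrier) 2 (fun x => M.fvec x i)) ∧
    ∀ i j, MemW1 (interior T.carrier) ∞ (fun x => M.K x i j)

open Classical in
/-- The weak divergence of `F` on `U` in `L²(U)` (unique almost everywhere if it exists). -/
def weakDiv (U : Set (Pt d)) (F : Pt d → Pt d) : Pt d → ℝ :=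
  if h : ∃ g, MemLp g 2 (volume.restrict U) ∧ HasWeakDiv U F g then h.choose else 0

/-- `t` is the trace on `∂T` of the field `F ∈ H¹(T)ᵈ`: some smooth fields converge to `F` in
`H¹(T)` while their restrictions to `∂T` converge to `t` in `L²(∂T)`. -/
def IsTrace (T : TSimplex d) (F t : Pt d → Pt d) : Prop :=
  MemLp F 2 (volume.restrict T.carrier) ∧ MemLp t 2 (μHE[d - 1].restrict (frontier T.carrier)) ∧
  ∃ (φ : ℕ → Pt d → Pt d) (G : Pt d → Pt d →L[ℝ] Pt d), (∀ n, ContDiff ℝ ∞ (φ n)) ∧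
    MemLp G 2 (volume.restrict T.carrier) ∧
    Tendsto (fun n => eLpNorm (φ n - F) 2 (volume.restrict T.carrier)) atTop (𝓝 0) ∧
    Tendsto (fun n => eLpNorm (fderiv ℝ (φ n) - G) 2 (volume.restrict T.carrier)) atTop (𝓝 0) ∧
    Tendsto (fun n => eLpNorm (φ n - t) 2 (μHE[d - 1].restrict (frontier T.carrier))) atTop (𝓝 0)

open Classical in
/-- The trace of `F|_T` on `∂T` (unique almost everywhere if it exists). -/
def trace (T : TSimplex d) (F : Pt d → Pt d) : Pt d → Pt d :=
  if h : ∃ t, IsTrace T F t then h.choose else 0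

/-- The jump `⟦F · n⟧`: the sum of the outer normal traces of `F` from all the elements that have
the given point on one of their facets, that is from the two neighbouring elements at almost every
point of an interior facet. -/
def normalJump [NeZero d] (𝒯 : Finset (TSimplex d)) (F : Pt d → Pt d) (x : Pt d) : ℝ :=
  ∑ T ∈ 𝒯, ∑ i, (T.facet i).indicator (fun y => ⟪trace T F y, T.normal i⟫) x

namespace ModelProblem

variable (M : ModelProblem d)

/-- The field `K ∇v - 𝐟`. -/
def residualFlux (v : H01 M.Ω) (x : Pt d) : Pt d := M.flux v x - M.fvec x

/-- The squared local contribution `η_𝒯(T, v)²`; the facets of `T` make up `∂T`. -/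
def etaSq [NeZero d] (𝒯 : Finset (TSimplex d)) (T : TSimplex d) (v : H01 M.Ω) : ℝ :=
  T.vol ^ (2 / d : ℝ) * (∫ x in T.carrier,
      (weakDiv (interior T.carrier) (M.residualFlux v) x
        - ⟪M.b x, grad v x⟫ - M.c x * val v x + M.f x) ^ 2) +
    T.vol ^ (1 / d : ℝ) * ∑ i, ∫ x in T.facet i ∩ M.Ω,
      (normalJump 𝒯 (M.residualFlux v) x) ^ 2 ∂μHE[d - 1]

/-- `η_𝒯(𝒰, v)` for a subset `𝒰` of the mesh `𝒯`. -/
def etaOn [NeZero d] (𝒯 𝒰 : Finset (TSimplex d)) (v : H01 M.Ω) : ℝ :=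
  √(∑ T ∈ 𝒰, M.etaSq 𝒯 T v)

/-- The global residual error estimator `η_𝒯(v)`. -/
def eta [NeZero d] (𝒯 : Finset (TSimplex d)) (v : H01 M.Ω) : ℝ := M.etaOn 𝒯 𝒯 v

open Classical in
/-- Stability of the estimator on non-refined elements. -/
def Stability [NeZero d] (p : ℕ) (𝒯₀ : Finset (TSimplex d)) : Prop :=
  ∃ Cstab > 0, ∀ 𝒯 𝒯', IsRefinement 𝒯₀ 𝒯₀ 𝒯 → IsRefinement 𝒯₀ 𝒯 𝒯' →
    ∀ v ∈ feSpace M.Ω p 𝒯, ∀ v' ∈ feSpace M.Ω p 𝒯',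
      |M.etaOn 𝒯' (𝒯' ∩ 𝒯) v' - M.etaOn 𝒯 (𝒯' ∩ 𝒯) v| ≤ Cstab * M.energyNorm (v' - v)

open Classical in
/-- Reduction of the estimator on refined elements. -/
def Reduction [NeZero d] (p : ℕ) (𝒯₀ : Finset (TSimplex d)) : Prop :=
  ∃ qred : ℝ, 0 < qred ∧ qred < 1 ∧ ∀ 𝒯 𝒯', IsRefinement 𝒯₀ 𝒯₀ 𝒯 → IsRefinement 𝒯₀ 𝒯 𝒯' →
    ∀ v ∈ feSpace M.Ω p 𝒯, M.etaOn 𝒯' (𝒯' \ 𝒯) v ≤ qred * M.etaOn 𝒯 (𝒯 \ 𝒯') v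

/-- Reliability of the estimator. -/
def Reliability [NeZero d] (p : ℕ) (𝒯₀ : Finset (TSimplex d)) : Prop :=
  ∃ Crel > 0, ∀ 𝒯, IsRefinement 𝒯₀ 𝒯₀ 𝒯 → ∀ u uH, M.IsWeakSol u →
    M.IsGalerkinSol (feSpace M.Ω p 𝒯) uH → M.energyNorm (u - uH) ≤ Crel * M.eta 𝒯 uH

/-- `𝒰 ∈ 𝕄[θ, v]`: the set `𝒰 ⊆ 𝒯` satisfies `θ η(v)² ≤ η(𝒰, v)²`. -/
def IsDoerfler [NeZero d] (𝒯 : Finset (TSimplex d)) (θ : ℝ) (v : H01 M.Ω)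
    (𝒰 : Finset (TSimplex d)) : Prop :=
  𝒰 ⊆ 𝒯 ∧ θ * M.eta 𝒯 v ^ 2 ≤ M.etaOn 𝒯 𝒰 v ^ 2

end ModelProblem

/-! ### Preconditioned GMRES with restart -/

/-- The norm `‖x‖_{P⁻¹} = (P⁻¹ x, x)₂^{1/2}`. -/
def precNorm {N : ℕ} (P : Matrix (Fin N) (Fin N) ℝ) (x : Fin N → ℝ) : ℝ := √((P⁻¹ *ᵥ x) ⬝ᵥ x)

/-- The numbers computed by preconditioned GMRES besides the iterates: the (unpreconditioned)
Arnoldi vectors `v k`, `vt k`, the vectors `w k j`, `wt k j` of step `k` after `j` orthogonalizations,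
the entries `h k j` of the column of the Hessenberg matrix computed in step `k`, and the coefficients
`y k`. Vectors and matrices are indexed from 1. -/
structure GMRESInternals (N : ℕ) where
  /-- Arnoldi vectors -/
  v : ℕ → Fin N → ℝ
  /-- unpreconditioned Arnoldi vectors -/
  vt : ℕ → Fin N → ℝ
  /-- candidate for the next Arnoldi vector -/
  w : ℕ → ℕ → Fin N → ℝ
  /-- candidate for the next unpreconditioned Arnoldi vector -/
  wt : ℕ → ℕ → Fin N → ℝ
  /-- Hessenberg entries -/
  h : ℕ → ℕ → ℝ
  /-- least-squares coefficients -/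
  y : ℕ → ℕ → ℝ

/-- The number `K = mod(k - 1, kmax) + 1` of steps since the last restart. -/
def cycleLen (kmax k : ℕ) : ℕ := (k - 1) % kmax + 1

/-- The index of the iterate from which the current run was (re)started. -/
def cycleStart (kmax k : ℕ) : ℕ := (k - 1) / kmax * kmax

/-- The squared functional `‖β e¹ - H_{[1:K+1,1:K]} z‖₂²` minimized in step `k`. The `m`-th column of
`H` was computed in step `k - K + m` and vanishes below its `(m+1)`-st entry. -/
def lsFunctional {N : ℕ} (I : GMRESInternals N) (kmax : ℕ) (β : ℝ) (k : ℕ) (z : ℕ → ℝ) : ℝ :=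
  let K := cycleLen kmax k
  ∑ i ∈ Finset.Icc 1 (K + 1), ((if i = 1 then β else 0) -
    ∑ m ∈ Finset.Icc 1 K, (if i ≤ m + 1 then I.h (k - K + m) i else 0) * z m) ^ 2

/-- One step `k ≥ 1` of restarted preconditioned GMRES (division by zero, which can only occur after
the exact solution has been reached, returns zero). -/
structure IsGMRESStep {N : ℕ} (B P : Matrix (Fin N) (Fin N) ℝ) (rhs : Fin N → ℝ) (kmax : ℕ)
    (x : ℕ → Fin N → ℝ) (I : GMRESInternals N) (k : ℕ) : Prop where
  wt_zero : I.wt k 0 = B *ᵥ I.v k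
  w_zero : I.w k 0 = P *ᵥ I.wt k 0
  h_eq : ∀ j, 1 ≤ j → j ≤ cycleLen kmax k →
    I.h k j = I.wt k (j - 1) ⬝ᵥ I.v (k + j - cycleLen kmax k)
  wt_succ : ∀ j, 1 ≤ j → j ≤ cycleLen kmax k →
    I.wt k j = I.wt k (j - 1) - I.h k j • I.vt (k + j - cycleLen kmax k)
  w_succ : ∀ j, 1 ≤ j → j ≤ cycleLen kmax k →
    I.w k j = I.w k (j - 1) - I.h k j • I.v (k + j - cycleLen kmax k)
  h_last : I.h k (cycleLen kmax k + 1) = √(I.wt k (cycleLen kmax k) ⬝ᵥ I.w k (cycleLen kmax k))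
  y_min : ∀ z : ℕ → ℝ,
    lsFunctional I kmax (precNorm P (P *ᵥ (rhs - B *ᵥ x (cycleStart kmax k)))) k (I.y k) ≤
    lsFunctional I kmax (precNorm P (P *ᵥ (rhs - B *ᵥ x (cycleStart kmax k)))) k z
  x_eq : x k = x (cycleStart kmax k) +
    ∑ j ∈ Finset.Icc 1 (cycleLen kmax k), I.y k j • I.v (k + j - cycleLen kmax k)
  restart : k % kmax = 0 →
    I.vt (k + 1) = (precNorm P (P *ᵥ (rhs - B *ᵥ x k)))⁻¹ • (rhs - B *ᵥ x k) ∧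
    I.v (k + 1) = (precNorm P (P *ᵥ (rhs - B *ᵥ x k)))⁻¹ • (P *ᵥ (rhs - B *ᵥ x k))
  continue_ : k % kmax ≠ 0 →
    I.vt (k + 1) = (I.h k (cycleLen kmax k + 1))⁻¹ • I.wt k (cycleLen kmax k) ∧
    I.v (k + 1) = (I.h k (cycleLen kmax k + 1))⁻¹ • I.w k (cycleLen kmax k)

/-- `x 0, x 1, …, x kbar` are the iterates of preconditioned GMRES with restart length `kmax` and
tolerance function `Λ`, where `kbar ≥ 1` is the first index at which the stopping criterion holds;
`kbar = ∞` if the iteration does not stop. -/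
def IsPGMRES {N : ℕ} (B P : Matrix (Fin N) (Fin N) ℝ) (rhs : Fin N → ℝ) (Λ : (Fin N → ℝ) → ℝ)
    (kmax : ℕ) (kbar : ℕ∞) (x : ℕ → Fin N → ℝ) : Prop :=
  1 ≤ kbar ∧
  (∀ k : ℕ, 1 ≤ k → (k : ℕ∞) ≤ kbar →
    (precNorm P (P *ᵥ (rhs - B *ᵥ x k)) ≤ Λ (x k) ↔ (k : ℕ∞) = kbar)) ∧
  ∃ I : GMRESInternals N,
    I.vt 1 = (precNorm P (P *ᵥ (rhs - B *ᵥ x 0)))⁻¹ • (rhs - B *ᵥ x 0) ∧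
    I.v 1 = P *ᵥ I.vt 1 ∧
    ∀ k : ℕ, 1 ≤ k → (k : ℕ∞) ≤ kbar → IsGMRESStep B P rhs kmax x I k

/-! ### The adaptive algorithm -/

/-- The quantities produced by a run of the adaptive algorithm. Values beyond the last level `lbar`
or, on level `ℓ`, beyond the last GMRES step `kbar ℓ` are irrelevant. -/
structure AFEMHistory (M : ModelProblem d) (p : ℕ) where
  /-- the last level, `∞` if there is none -/
  lbar : ℕ∞
  /-- the number of GMRES steps on each level -/
  kbar : ℕ → ℕ∞
  /-- the meshes -/
  mesh : ℕ → Finset (TSimplex d)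
  /-- the dimensions of the finite element spaces -/
  N : ℕ → ℕ
  /-- the bases of the finite element spaces -/
  basis : ∀ ℓ, Module.Basis (Fin (N ℓ)) ℝ (feSpace M.Ω p (mesh ℓ))
  /-- the preconditioners -/
  P : ∀ ℓ, Matrix (Fin (N ℓ)) (Fin (N ℓ)) ℝ
  /-- the coefficient vectors of the iterates -/
  x : ∀ ℓ, ℕ → Fin (N ℓ) → ℝ
  /-- the marked elements -/
  marked : ℕ → Finset (TSimplex d)
  /-- the value of `λ_alg` when level `ℓ` is entered -/
  lam : ℕ → ℝ
  /-- the value of `C_alg` when level `ℓ` is entered -/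
  C : ℕ → ℝ
  /-- the value of `S` when level `ℓ` is entered -/
  S : ℕ → ℝ

namespace AFEMHistory

variable {M : ModelProblem d} {p : ℕ} (R : AFEMHistory M p)

/-- The function with given coefficients with respect to the basis on level `ℓ`. -/
def toFn (ℓ : ℕ) (y : Fin (R.N ℓ) → ℝ) : H01 M.Ω := ∑ j, y j • (R.basis ℓ j : H01 M.Ω)

/-- The Galerkin matrix on level `ℓ`. -/
def galerkinMatrix (ℓ : ℕ) : Matrix (Fin (R.N ℓ)) (Fin (R.N ℓ)) ℝ :=
  Matrix.of fun j k => M.bil (R.basis ℓ k) (R.basis ℓ j)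

/-- The right-hand side vector on level `ℓ`. -/
def loadVector (ℓ : ℕ) (j : Fin (R.N ℓ)) : ℝ := M.load (R.basis ℓ j)

/-- The iterate `u_ℓ^k`. -/
def u (ℓ k : ℕ) : H01 M.Ω := R.toFn ℓ (R.x ℓ k)

/-- The preconditioned residual `s_ℓ^k`. -/
def s (ℓ k : ℕ) : Fin (R.N ℓ) → ℝ :=
  R.P ℓ *ᵥ (R.loadVector ℓ - R.galerkinMatrix ℓ *ᵥ R.x ℓ k)

/-- The computable quasi-error `H_ℓ^k`. -/
def quasiError [NeZero d] (ℓ k : ℕ) : ℝ :=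
  M.eta (R.mesh ℓ) (R.u ℓ k) + precNorm (R.P ℓ) (R.s ℓ k)

/-- The final iterate on level `ℓ`. -/
def uFinal (ℓ : ℕ) : H01 M.Ω := R.u ℓ (R.kbar ℓ).toNat

/-- The quasi-error of the final iterate on level `ℓ`. -/
def finalError [NeZero d] (ℓ : ℕ) : ℝ := R.quasiError ℓ (R.kbar ℓ).toNat

/-- The index set of all iterates. -/
def Q : Set (ℕ × ℕ) := {n | (n.1 : ℕ∞) ≤ R.lbar ∧ (n.2 : ℕ∞) ≤ R.kbar n.1}

/-- The total step counter `|ℓ, k|`: the number of iterates that come not later than `u_ℓ^k`. -/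
def counter (n : ℕ × ℕ) : ℕ :=
  {m | m ∈ R.Q ∧ (m.1 < n.1 ∨ m.1 = n.1 ∧ m.2 ≤ n.2)}.ncard

/-- The preconditioners are SPD and induce norms equivalent to the energy norm, uniformly in the
levels. -/
def OptimalPreconditioner : Prop :=
  ∃ Cpre ≥ 1, ∀ ℓ : ℕ, (ℓ : ℕ∞) ≤ R.lbar → (R.P ℓ).PosDef ∧ ∀ y : Fin (R.N ℓ) → ℝ,
    Cpre⁻¹ * M.energyNorm (R.toFn ℓ y) ≤ precNorm (R.P ℓ) y ∧
    precNorm (R.P ℓ) y ≤ Cpre * M.energyNorm (R.toFn ℓ y)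

/-- `R` is a run of the adaptive algorithm with the given input. In the parameter control the
reciprocal of zero is zero. -/
structure IsRun [NeZero d] (𝒯₀ : Finset (TSimplex d)) (θ Cmark : ℝ) (u₀ : H01 M.Ω)
    (Calg lamAlg : ℝ) (kmax : ℕ) (τ : ℝ) : Prop where
  mesh_zero : R.mesh 0 = 𝒯₀
  u_zero : R.u 0 0 = u₀
  lam_zero : R.lam 0 = lamAlg
  C_zero : R.C 0 = Calg
  S_zero : R.S 0 = 0
  solve : ∀ ℓ : ℕ, (ℓ : ℕ∞) ≤ R.lbar →
    IsPGMRES (R.galerkinMatrix ℓ) (R.P ℓ) (R.loadVector ℓ)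
      (fun y => R.lam ℓ * M.eta (R.mesh ℓ) (R.toFn ℓ y)) kmax (R.kbar ℓ) (R.x ℓ)
  terminate : ∀ ℓ : ℕ, (ℓ : ℕ∞) ≤ R.lbar →
    ((ℓ : ℕ∞) < R.lbar ↔ R.kbar ℓ ≠ ⊤ ∧ ¬ R.finalError ℓ ≤ τ)
  update : ∀ ℓ : ℕ, (ℓ : ℕ∞) < R.lbar →
    1 ≤ ℓ ∧ R.S ℓ > R.C ℓ * (R.finalError ℓ)⁻¹ →
      R.C (ℓ + 1) = 2 * R.C ℓ ∧ R.lam (ℓ + 1) = R.lam ℓ / 2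
  no_update : ∀ ℓ : ℕ, (ℓ : ℕ∞) < R.lbar →
    ¬ (1 ≤ ℓ ∧ R.S ℓ > R.C ℓ * (R.finalError ℓ)⁻¹) →
      R.C (ℓ + 1) = R.C ℓ ∧ R.lam (ℓ + 1) = R.lam ℓ
  S_succ : ∀ ℓ : ℕ, (ℓ : ℕ∞) < R.lbar → R.S (ℓ + 1) = R.S ℓ + (R.finalError ℓ)⁻¹
  mark : ∀ ℓ : ℕ, (ℓ : ℕ∞) < R.lbar →
    M.IsDoerfler (R.mesh ℓ) θ (R.uFinal ℓ) (R.marked ℓ) ∧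
    ∀ 𝒰, M.IsDoerfler (R.mesh ℓ) θ (R.uFinal ℓ) 𝒰 →
      ((R.marked ℓ).card : ℝ) ≤ Cmark * (𝒰.card : ℝ)
  refine_ : ∀ ℓ : ℕ, (ℓ : ℕ∞) < R.lbar →
    IsRefine 𝒯₀ (R.mesh ℓ) (R.marked ℓ) (R.mesh (ℓ + 1))
  nested : ∀ ℓ : ℕ, (ℓ : ℕ∞) < R.lbar → R.u (ℓ + 1) 0 = R.uFinal ℓ

end AFEMHistory

end AFEM

end

open AFEM

noncomputable section

namespace AFEM

variable {d : ℕ}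

/-! ### The bilinear forms as continuous bilinear forms on `H¹₀(Ω)` -/

/-! List all quasi-errors in the order of computation as one sequence h. If the sum of the
reciprocals of h up to n is at most a constant times 1/h_n for every n, these sums grow
geometrically, and hence h decays geometrically (`linear_convergence_of_sum_inv_le`). A quasi-error
that vanishes stays zero, which settles the degenerate case. Splitting the sum into levels
(`LevelsTerminate.linear_convergence`) leaves three tasks: uniform linear decay on each level,
stability in the passage to the next level, and control of the reciprocals of the final
quasi-errors.

On one level, restarted GMRES minimizes the residual in the P⁻¹-norm over a Krylov space, so it does
at least as well as a damped Richardson iteration. Norm equivalence and ellipticity make the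
contraction factor of the latter independent of the level (`IsGMRES.precNorm_le`). As long as the
stopping test fails, the estimator is at most 1/λ times the residual, so the quasi-error decays as
well, provided that λ stays bounded from below (`RunData.exists_quasiError_le`). The passage to the
next level uses nestedness, Céa's lemma, reliability and monotonicity of the estimator
(`RunData.quasiError_succ_le`).

The final quasi-errors are governed by the parameter control. Suppose that C and λ are updated
infinitely often. Then λ tends to zero, and C tends to infinity because C·λ is constant. For small λ
the final iterates are close enough to the Galerkin solutions for the usual contraction of a
weighted sum of squared estimator and squared error, which bounds S by a fixed D/h
(`RunData.exists_sum_inv_le`). Once C exceeds D the test for an update must fail, a contradiction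
(`eventually_no_update`). After the last update, λ is constant and the failed test is itself the
wanted bound on S.

The contraction needs quasi-orthogonality although b is not symmetric. By Galerkin orthogonality the
mixed term in the principal part equals a lower order term, which sees the increment of the Galerkin
solutions only in L². Normalized increments tend weakly to zero (`tendsto_of_galerkin_orthogonal`),
hence strongly in L² by Rellich's theorem, so this term is eventually negligible
(`eventually_abs_a_le`). -/

instance (Ω : Set (Pt d)) : CompleteSpace (H01 Ω) :=
  (testPairs Ω).isClosed_topologicalClosure.completeSpace_coe

/-- The embedding of `H¹₀(Ω)` into `L²(Ω)`. -/
def valL (Ω : Set (Pt d)) : H01 Ω →L[ℝ] Lp ℝ 2 (volume.restrict Ω) :=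
  (WithLp.fstL 2 ℝ _ _).comp (H01 Ω).subtypeL

/-- The weak gradient as a continuous linear map. -/
def gradL (Ω : Set (Pt d)) : H01 Ω →L[ℝ] Lp (Pt d) 2 (volume.restrict Ω) :=
  (WithLp.sndL 2 ℝ _ _).comp (H01 Ω).subtypeL

lemma coe_valL {Ω : Set (Pt d)} (v : H01 Ω) : (valL Ω v : Pt d → ℝ) = val v := rfl

lemma coe_gradL {Ω : Set (Pt d)} (v : H01 Ω) : (gradL Ω v : Pt d → Pt d) = grad v := rfl

lemma norm_sq_eq_valL_gradL {Ω : Set (Pt d)} (v : H01 Ω) :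
    ‖v‖ ^ 2 = ‖valL Ω v‖ ^ 2 + ‖gradL Ω v‖ ^ 2 :=
  WithLp.prod_norm_sq_eq_of_L2 (v : L2Pair Ω)

/-- The coefficient K is bounded and measurable only entry by entry. The expansion into matrix units
carries this over to the operator-valued field. -/
lemma toEuclideanCLM_eq_sum (A : Matrix (Fin d) (Fin d) ℝ) :
    (Matrix.toEuclideanCLM (𝕜 := ℝ) A : Pt d →L[ℝ] Pt d) =
      ∑ i, ∑ j, A i j • Matrix.toEuclideanCLM (𝕜 := ℝ) (Matrix.single i j 1) := by
  conv_lhs => rw [Matrix.matrix_eq_sum_single A]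
  simp only [map_sum, ← map_smul, Matrix.smul_single, smul_eq_mul, mul_one]

lemma memLp_smul_const_of_entries {E : Type*} [NormedAddCommGroup E] [NormedSpace ℝ E]
    (k : Pt d → Fin d → Fin d → ℝ) (F : Fin d → Fin d → E) (μ : Measure (Pt d))
    (h : ∀ i j, MemLp (fun x => k x i j) ∞ μ) (i j : Fin d) :
    MemLp (fun x => k x i j • F i j) ∞ μ :=
  (ContinuousLinearMap.toSpanSingleton ℝ (F i j)).comp_memLp' (h i j)

lemma memLp_sum_sum {E : Type*} [NormedAddCommGroup E] (k : Pt d → Fin d → Fin d → E)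
    (μ : Measure (Pt d)) (h : ∀ i j, MemLp (fun x => k x i j) ∞ μ) :
    MemLp (fun x => ∑ i, ∑ j, k x i j) ∞ μ :=
  memLp_finsetSum Finset.univ fun i _ => memLp_finsetSum Finset.univ fun j _ => h i j

namespace ModelProblem

variable (M : ModelProblem d)

/-- The diffusion matrix as an operator. -/
def KOp (x : Pt d) : Pt d →L[ℝ] Pt d := Matrix.toEuclideanCLM (𝕜 := ℝ) (M.K x)

lemma memLp_KOp : MemLp M.KOp ∞ (volume.restrict M.Ω) := by
  have h : M.KOp = fun x => ∑ i, ∑ j,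
      M.K x i j • Matrix.toEuclideanCLM (𝕜 := ℝ) (Matrix.single i j 1) := by
    funext x
    exact toEuclideanCLM_eq_sum (M.K x)
  rw [h]
  exact memLp_sum_sum (fun x i j => M.K x i j • _) _ (memLp_smul_const_of_entries M.K _ _ M.K_bdd)

lemma memLp_innerSL_b : MemLp (fun x => innerSL ℝ (M.b x)) ∞ (volume.restrict M.Ω) :=
  M.b_bdd.of_le ((innerSL ℝ).continuous.comp_aestronglyMeasurable M.b_bdd.1)
    (Eventually.of_forall fun x => by simp)

/-- The multiplication `G ↦ K G` on `L²`. -/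
def fluxL : Lp (Pt d) 2 (volume.restrict M.Ω) →L[ℝ] Lp (Pt d) 2 (volume.restrict M.Ω) :=
  (ContinuousLinearMap.id ℝ (Pt d →L[ℝ] Pt d)).holderL _ ∞ 2 2 M.memLp_KOp.toLp

lemma coe_fluxL (G : Lp (Pt d) 2 (volume.restrict M.Ω)) :
    M.fluxL G =ᵐ[volume.restrict M.Ω] fun x => M.KOp x (G x) := by
  filter_upwards [(ContinuousLinearMap.id ℝ (Pt d →L[ℝ] Pt d)).coeFn_holder (r := 2)
    M.memLp_KOp.toLp G, M.memLp_KOp.coeFn_toLp] with x h1 h2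
  rw [h2] at h1
  exact h1

/-- The lower order operator `v ↦ b · ∇v + c v`. -/
def lowerL : H01 M.Ω →L[ℝ] Lp ℝ 2 (volume.restrict M.Ω) :=
  ((ContinuousLinearMap.id ℝ (Pt d →L[ℝ] ℝ)).holderL _ ∞ 2 2 M.memLp_innerSL_b.toLp).comp
      (gradL M.Ω) +
    ((ContinuousLinearMap.mul ℝ ℝ).holderL _ ∞ 2 2 M.c_bdd.toLp).comp (valL M.Ω)

lemma coe_lowerL (v : H01 M.Ω) :
    M.lowerL v =ᵐ[volume.restrict M.Ω] fun x => ⟪M.b x, grad v x⟫ + M.c x * val v x := by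
  filter_upwards [(ContinuousLinearMap.id ℝ (Pt d →L[ℝ] ℝ)).coeFn_holder (r := 2)
      M.memLp_innerSL_b.toLp (gradL M.Ω v), M.memLp_innerSL_b.coeFn_toLp,
    (ContinuousLinearMap.mul ℝ ℝ).coeFn_holder (r := 2) M.c_bdd.toLp (valL M.Ω v),
    M.c_bdd.coeFn_toLp,
    Lp.coeFn_add ((ContinuousLinearMap.id ℝ (Pt d →L[ℝ] ℝ)).holder 2 M.memLp_innerSL_b.toLp
      (gradL M.Ω v)) ((ContinuousLinearMap.mul ℝ ℝ).holder 2 M.c_bdd.toLp (valL M.Ω v))]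
    with x h1 h2 h3 h4 h5
  rw [h2] at h1
  rw [h4] at h3
  refine h5.trans ?_
  rw [Pi.add_apply, h1, h3]
  rfl

lemma a_eq_inner (v w : H01 M.Ω) : M.a v w = ⟪M.fluxL (gradL M.Ω v), gradL M.Ω w⟫ := by
  rw [L2.inner_def, a]
  refine integral_congr_ae ?_
  filter_upwards [M.coe_fluxL (gradL M.Ω v)] with x hx
  rw [hx]
  rfl

lemma memLp_b_grad (v : H01 M.Ω) :
    MemLp (fun x => ⟪M.b x, grad v x⟫) 2 (volume.restrict M.Ω) :=
  (ContinuousLinearMap.id ℝ (Pt d →L[ℝ] ℝ)).memLp_of_bilin 2 M.memLp_innerSL_b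
    (Lp.memLp (gradL M.Ω v))

lemma memLp_c_val (v : H01 M.Ω) :
    MemLp (fun x => M.c x * val v x) 2 (volume.restrict M.Ω) :=
  (ContinuousLinearMap.mul ℝ ℝ).memLp_of_bilin 2 M.c_bdd (Lp.memLp (valL M.Ω v))

lemma bil_eq_inner (v w : H01 M.Ω) :
    M.bil v w = M.a v w + ⟪M.lowerL v, valL M.Ω w⟫ := by
  rw [L2.inner_def, bil, add_assoc, ← integral_add]
  · congr 1
    refine integral_congr_ae ?_
    filter_upwards [M.coe_lowerL v] with x hx
    rw [hx, coe_valL]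
    simp only [RCLike.inner_apply, conj_trivial]
    ring
  · exact (M.memLp_b_grad v).integrable_mul (Lp.memLp (valL M.Ω w))
  · exact (M.memLp_c_val v).integrable_mul (Lp.memLp (valL M.Ω w))

lemma load_eq_inner (v : H01 M.Ω) :
    M.load v = ⟪M.f_mem.toLp, valL M.Ω v⟫ + ⟪M.fvec_mem.toLp, gradL M.Ω v⟫ := by
  rw [L2.inner_def, L2.inner_def, load]
  congr 1
  · refine integral_congr_ae ?_
    filter_upwards [M.f_mem.coeFn_toLp] with x hx
    rw [hx, coe_valL]
    simp only [RCLike.inner_apply, conj_trivial]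
    ring
  · refine integral_congr_ae ?_
    filter_upwards [M.fvec_mem.coeFn_toLp] with x hx
    rw [hx, coe_gradL]

/-- The principal part as a continuous bilinear form. -/
def aL : H01 M.Ω →L[ℝ] H01 M.Ω →L[ℝ] ℝ :=
  LinearMap.mkContinuous₂
    (LinearMap.mk₂ ℝ (fun v w => ⟪M.fluxL (gradL M.Ω v), gradL M.Ω w⟫)
      (fun _ _ _ => by simp [inner_add_left]) (fun _ _ _ => by simp [real_inner_smul_left])
      (fun _ _ _ => by simp [inner_add_right]) (fun _ _ _ => by simp [real_inner_smul_right]))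
    (‖M.fluxL.comp (gradL M.Ω)‖ * ‖gradL M.Ω‖) fun v w => by
      refine (norm_inner_le_norm (𝕜 := ℝ) (M.fluxL (gradL M.Ω v)) (gradL M.Ω w)).trans ?_
      have h1 := (M.fluxL.comp (gradL M.Ω)).le_opNorm v
      have h2 := (gradL M.Ω).le_opNorm w
      calc _ ≤ (‖M.fluxL.comp (gradL M.Ω)‖ * ‖v‖) * (‖gradL M.Ω‖ * ‖w‖) :=
            mul_le_mul h1 h2 (norm_nonneg _) (by positivity)
        _ = _ := by ring

/-- The bilinear form `b` as a continuous bilinear form. -/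
def bilL : H01 M.Ω →L[ℝ] H01 M.Ω →L[ℝ] ℝ :=
  M.aL + LinearMap.mkContinuous₂
    (LinearMap.mk₂ ℝ (fun v w => ⟪M.lowerL v, valL M.Ω w⟫)
      (fun _ _ _ => by simp [inner_add_left]) (fun _ _ _ => by simp [real_inner_smul_left])
      (fun _ _ _ => by simp [inner_add_right]) (fun _ _ _ => by simp [real_inner_smul_right]))
    (‖M.lowerL‖ * ‖valL M.Ω‖) fun v w => by
      refine (norm_inner_le_norm (𝕜 := ℝ) (M.lowerL v) (valL M.Ω w)).trans ?_
      have h1 := M.lowerL.le_opNorm v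
      have h2 := (valL M.Ω).le_opNorm w
      calc _ ≤ (‖M.lowerL‖ * ‖v‖) * (‖valL M.Ω‖ * ‖w‖) :=
            mul_le_mul h1 h2 (norm_nonneg _) (by positivity)
        _ = _ := by ring

lemma aL_apply (v w : H01 M.Ω) : M.aL v w = M.a v w := (M.a_eq_inner v w).symm

lemma bilL_apply (v w : H01 M.Ω) : M.bilL v w = M.bil v w := by
  rw [M.bil_eq_inner, ← M.aL_apply]
  rfl

/-- The right-hand side as a continuous functional. -/
def loadL : H01 M.Ω →L[ℝ] ℝ :=
  (innerSL ℝ M.f_mem.toLp).comp (valL M.Ω) + (innerSL ℝ M.fvec_mem.toLp).comp (gradL M.Ω)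

lemma loadL_apply (v : H01 M.Ω) : M.loadL v = M.load v := (M.load_eq_inner v).symm

lemma a_symm (v w : H01 M.Ω) : M.a v w = M.a w v := by
  refine integral_congr_ae ?_
  filter_upwards [M.K_symm] with x hx
  have h1 := Matrix.inner_toEuclideanCLM (M.K x) (grad w x) (grad v x)
  have h2 := Matrix.inner_toEuclideanCLM (M.K x) (grad v x) (grad w x)
  have h3 : (M.K x)ᵀ = M.K x := hx
  change ⟪Matrix.toEuclideanCLM (𝕜 := ℝ) (M.K x) (grad v x), grad w x⟫ =
    ⟪Matrix.toEuclideanCLM (𝕜 := ℝ) (M.K x) (grad w x), grad v x⟫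
  rw [real_inner_comm, h1, real_inner_comm, h2, Matrix.dotProduct_mulVec, ← Matrix.mulVec_transpose,
    h3, dotProduct_comm]

lemma exists_a_ge : ∃ α > 0, ∀ v : H01 M.Ω, α * ‖gradL M.Ω v‖ ^ 2 ≤ M.a v v := by
  obtain ⟨α, hα, h⟩ := M.K_elliptic
  refine ⟨α, hα, fun v => ?_⟩
  rw [a_eq_inner, ← real_inner_self_eq_norm_sq, L2.inner_def, L2.inner_def, ← integral_const_mul]
  refine integral_mono_ae ((L2.integrable_inner _ _).const_mul _) (L2.integrable_inner _ _) ?_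
  filter_upwards [h, M.coe_fluxL (gradL M.Ω v)] with x h1 h2
  rw [h2, coe_gradL]
  have h3 := Matrix.inner_toEuclideanCLM (M.K x) (grad v x) (grad v x)
  have h4 := h1 (grad v x)
  rw [← h3] at h4
  rw [real_inner_comm] at h4
  have h5 : ⟪grad v x, grad v x⟫ = grad v x ⬝ᵥ grad v x :=
    EuclideanSpace.inner_eq_star_dotProduct _ _
  rw [h5]
  exact h4

end ModelProblem

end AFEM

namespace AFEM

variable {d : ℕ}

lemma exists_abs_bilinear_le {V : Type*} [NormedAddCommGroup V] [NormedSpace ℝ V]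
    (B : V →L[ℝ] V →L[ℝ] ℝ) : ∃ C ≥ 0, ∀ v w, |B v w| ≤ C * ‖v‖ * ‖w‖ :=
  ⟨‖B‖, norm_nonneg B, fun v w => B.le_opNorm₂ v w⟩

/-! ### Test functions, the Poincaré inequality and ellipticity -/

/-- Since test pairs are dense by definition, an inequality between continuous expressions has to be
checked only for smooth, compactly supported functions, where integration by parts is available. -/
lemma isClosed_induction_H01 {Ω : Set (Pt d)} {p : H01 Ω → Prop} (hp : IsClosed {v | p v})
    (h : ∀ v φ, IsTestFn Ω φ → val v =ᵐ[volume.restrict Ω] φ →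
      grad v =ᵐ[volume.restrict Ω] gradient φ → p v) (v : H01 Ω) : p v := by
  obtain ⟨x, hx, hxv⟩ := mem_closure_iff_seq_limit.1 v.2
  let y : ℕ → H01 Ω := fun n => ⟨x n, subset_closure (hx n)⟩
  have hy : Tendsto y atTop (𝓝 v) := tendsto_subtype_rng.2 hxv
  refine hp.mem_of_tendsto hy (Eventually.of_forall fun n => ?_)
  obtain ⟨φ, h1, h2, h3⟩ := hx n
  exact h (y n) φ h1 h2 h3

namespace IsTestFn

variable {U : Set (Pt d)} {φ : Pt d → ℝ}

lemma continuous_gradient (hφ : IsTestFn U φ) : Continuous (gradient φ) :=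
  (InnerProductSpace.toDual ℝ (Pt d)).symm.continuous.comp (hφ.1.continuous_fderiv (by simp))

lemma differentiable (hφ : IsTestFn U φ) : Differentiable ℝ φ := hφ.1.differentiable (by simp)

lemma hasCompactSupport_gradient (hφ : IsTestFn U φ) : HasCompactSupport (gradient φ) :=
  (hφ.2.1.fderiv (𝕜 := ℝ)).comp_left (g := (InnerProductSpace.toDual ℝ (Pt d)).symm) (map_zero _)

lemma inner_gradient (φ : Pt d → ℝ) (x v : Pt d) : ⟪gradient φ x, v⟫ = fderiv ℝ φ x v := by
  rw [gradient, InnerProductSpace.toDual_symm_apply]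

lemma sq (hφ : IsTestFn U φ) : IsTestFn U (fun x => φ x ^ 2) := by
  have hs : Function.support (fun x => φ x ^ 2) = Function.support φ := by
    ext x; simp
  refine ⟨hφ.1.pow 2, ?_, ?_⟩
  · rw [HasCompactSupport, tsupport, hs]; exact hφ.2.1
  · rw [tsupport, hs]; exact hφ.2.2

lemma gradient_sq (hφ : IsTestFn U φ) (x : Pt d) :
    gradient (fun x => φ x ^ 2) x = (2 * φ x) • gradient φ x := by
  have h1 := (hφ.differentiable x).hasFDerivAt.pow 2
  rw [gradient, h1.fderiv, gradient]
  simp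

lemma eq_zero_of_notMem (hφ : IsTestFn U φ) {x : Pt d} (hx : x ∉ U) : φ x = 0 :=
  image_eq_zero_of_notMem_tsupport fun h => hx (hφ.2.2 h)

lemma gradient_eq_zero_of_notMem (hφ : IsTestFn U φ) {x : Pt d} (hx : x ∉ U) :
    gradient φ x = 0 := by
  have h : fderiv ℝ φ x = 0 := by
    by_contra h
    exact hx (hφ.2.2 (support_fderiv_subset ℝ h))
  rw [gradient, h, map_zero]

lemma integrable_sq (hφ : IsTestFn U φ) : Integrable (fun x => φ x ^ 2) :=
  (hφ.sq.1.continuous).integrable_of_hasCompactSupport hφ.sq.2.1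

lemma integrable_norm_gradient_sq (hφ : IsTestFn U φ) :
    Integrable (fun x => ‖gradient φ x‖ ^ 2) := by
  refine (hφ.continuous_gradient.norm.pow 2).integrable_of_hasCompactSupport ?_
  exact hφ.hasCompactSupport_gradient.mono fun x hx h0 => hx (by simp [h0])

/-- The Poincaré inequality for test functions. -/
lemma integral_sq_le [NeZero d] (hφ : IsTestFn U φ) {r : ℝ} (hr : ∀ x ∈ U, ‖x‖ ≤ r) :
    ∫ x, φ x ^ 2 ≤ 4 * r ^ 2 * ∫ x, ‖gradient φ x‖ ^ 2 := by
  -- The weight ⟪e, x⟫ has derivative one in direction e and is bounded by r on U, so integration by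
  -- parts in this single direction expresses ∫ φ² through ∂ₑ(φ²).
  let e : Pt d := EuclideanSpace.single 0 1
  have he : ‖e‖ = 1 := by simp [e]
  have h2 := hφ.sq
  have hc : Continuous fun x : Pt d => ⟪e, x⟫ := by fun_prop
  have hd : ∀ x : Pt d, fderiv ℝ (fun x : Pt d => ⟪e, x⟫) x e = 1 := by
    intro x
    change fderiv ℝ (innerSL ℝ e) x e = 1
    rw [ContinuousLinearMap.fderiv, innerSL_apply_apply, real_inner_self_eq_norm_sq, he, one_pow]
  have hint : Integrable fun x => ⟪e, x⟫ * fderiv ℝ (fun x => φ x ^ 2) x e := by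
    refine (hc.mul ((h2.1.continuous_fderiv (by simp)).clm_apply
      continuous_const)).integrable_of_hasCompactSupport ?_
    have h3 : HasCompactSupport fun x => fderiv ℝ (fun x => φ x ^ 2) x e :=
      (h2.2.1.fderiv (𝕜 := ℝ)).comp_left (g := fun L : Pt d →L[ℝ] ℝ => L e) (by simp)
    exact h3.mul_left
  have h := integral_mul_fderiv_eq_neg_fderiv_mul_of_integrable (μ := volume)
    (f := fun x : Pt d => ⟪e, x⟫) (g := fun x => φ x ^ 2) (v := e)
    (by simpa only [hd, one_mul] using hφ.integrable_sq) hint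
    ((hc.mul h2.1.continuous).integrable_of_hasCompactSupport h2.2.1.mul_left)
    (fun x _ => (innerSL ℝ e).differentiableAt) (fun x _ => h2.differentiable x)
  simp only [hd, one_mul] at h
  -- Young's inequality is weighted so that half of ∫ φ² returns on the right and is absorbed; this
  -- produces the constant 4r².
  have h4 : ∫ x, φ x ^ 2 ≤ ∫ x, (φ x ^ 2 / 2 + 2 * r ^ 2 * ‖gradient φ x‖ ^ 2) := by
    rw [← neg_eq_iff_eq_neg.2 h, ← integral_neg]
    refine integral_mono hint.neg ((hφ.integrable_sq.div_const 2).add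
      (hφ.integrable_norm_gradient_sq.const_mul _)) fun x => ?_
    simp only
    rw [← inner_gradient, hφ.gradient_sq, real_inner_smul_left]
    by_cases hx : x ∈ U
    · have h5 : |⟪e, x⟫| ≤ r :=
        (abs_real_inner_le_norm _ _).trans (by rw [he, one_mul]; exact hr x hx)
      have h6 : |⟪gradient φ x, e⟫| ≤ ‖gradient φ x‖ :=
        (abs_real_inner_le_norm _ _).trans (by rw [he, mul_one])
      have h7 : (⟪e, x⟫ * ⟪gradient φ x, e⟫) ^ 2 ≤ r ^ 2 * ‖gradient φ x‖ ^ 2 := by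
        rw [mul_pow, ← sq_abs ⟪e, x⟫, ← sq_abs ⟪gradient φ x, e⟫]
        gcongr
      nlinarith [sq_nonneg (φ x + 2 * (⟪e, x⟫ * ⟪gradient φ x, e⟫))]
    · rw [hφ.eq_zero_of_notMem hx, hφ.gradient_eq_zero_of_notMem hx]
      simp
  rw [integral_add (hφ.integrable_sq.div_const 2)
    (hφ.integrable_norm_gradient_sq.const_mul _), integral_div, integral_const_mul] at h4
  linarith

end IsTestFn

lemma norm_valL_sq {Ω : Set (Pt d)} {v : H01 Ω} {φ : Pt d → ℝ} (hφ : IsTestFn Ω φ)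
    (h : val v =ᵐ[volume.restrict Ω] φ) : ‖valL Ω v‖ ^ 2 = ∫ x, φ x ^ 2 := by
  have h0 : ∫ x in Ω, φ x ^ 2 = ∫ x, φ x ^ 2 := setIntegral_eq_integral_of_forall_compl_eq_zero
    fun x hx => by rw [hφ.eq_zero_of_notMem hx]; simp
  rw [← real_inner_self_eq_norm_sq, L2.inner_def, ← h0]
  refine integral_congr_ae ?_
  filter_upwards [h] with x hx
  rw [coe_valL, hx, real_inner_self_eq_norm_sq, Real.norm_eq_abs, sq_abs]

lemma norm_gradL_sq {Ω : Set (Pt d)} {v : H01 Ω} {φ : Pt d → ℝ} (hφ : IsTestFn Ω φ)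
    (h : grad v =ᵐ[volume.restrict Ω] gradient φ) :
    ‖gradL Ω v‖ ^ 2 = ∫ x, ‖gradient φ x‖ ^ 2 := by
  have h0 : ∫ x in Ω, ‖gradient φ x‖ ^ 2 = ∫ x, ‖gradient φ x‖ ^ 2 :=
    setIntegral_eq_integral_of_forall_compl_eq_zero
      fun x hx => by rw [hφ.gradient_eq_zero_of_notMem hx]; simp
  rw [← real_inner_self_eq_norm_sq, L2.inner_def, ← h0]
  refine integral_congr_ae ?_
  filter_upwards [h] with x hx
  rw [coe_gradL, hx, real_inner_self_eq_norm_sq]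

/-- The Poincaré inequality on a bounded set. -/
lemma poincare [NeZero d] {Ω : Set (Pt d)} (hΩ : Bornology.IsBounded Ω) :
    ∃ C > 0, ∀ v : H01 Ω, ‖valL Ω v‖ ^ 2 ≤ C * ‖gradL Ω v‖ ^ 2 := by
  obtain ⟨r, hr0, hr⟩ := hΩ.exists_pos_norm_le
  refine ⟨4 * r ^ 2, by positivity, fun v => ?_⟩
  refine isClosed_induction_H01 (isClosed_le (f := fun v => ‖valL Ω v‖ ^ 2)
    (g := fun v => 4 * r ^ 2 * ‖gradL Ω v‖ ^ 2) (by fun_prop) (by fun_prop))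
    (fun v φ hφ h1 h2 => ?_) v
  rw [norm_valL_sq hφ h1, norm_gradL_sq hφ h2]
  exact hφ.integral_sq_le hr

namespace ModelProblem

variable (M : ModelProblem d)

/-- Testing the weak divergence of b with φ² gives 2∫ (b·∇φ)φ = -∫ (div b)φ², so for a test function
the expression is half the integral of (-div b + 2c)φ². -/
lemma lower_nonneg (v : H01 M.Ω) : 0 ≤ ⟪M.lowerL v, valL M.Ω v⟫ := by
  refine isClosed_induction_H01 (isClosed_le continuous_const
    (M.lowerL.continuous.inner (valL M.Ω).continuous)) (fun v φ hφ h1 h2 => ?_) v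
  obtain ⟨g, hg, hdiv, hpos⟩ := M.div_b
  have h3 := hdiv _ hφ.sq
  have hv : MemLp φ 2 (volume.restrict M.Ω) := (memLp_congr_ae h1).1 (Lp.memLp (valL M.Ω v))
  have hsq : Integrable (fun x => φ x * φ x) (volume.restrict M.Ω) := hv.integrable_mul hv
  have hc : Integrable (fun x => M.c x * φ x * φ x) (volume.restrict M.Ω) :=
    (((memLp_congr_ae (h1.mono fun x hx => by rw [hx])).1 (M.memLp_c_val v)).integrable_mul hv)
  have hg2 : Integrable (fun x => g x * φ x * φ x) (volume.restrict M.Ω) :=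
    MemLp.integrable_mul ((ContinuousLinearMap.mul ℝ ℝ).memLp_of_bilin 2 hg hv) hv
  have hb : Integrable (fun x => ⟪M.b x, gradient φ x⟫ * φ x) (volume.restrict M.Ω) :=
    (((memLp_congr_ae (h2.mono fun x hx => by rw [hx])).1 (M.memLp_b_grad v)).integrable_mul hv)
  have h4 : ⟪M.lowerL v, valL M.Ω v⟫ =
      (∫ x in M.Ω, ⟪M.b x, gradient φ x⟫ * φ x) + ∫ x in M.Ω, M.c x * φ x * φ x := by
    rw [L2.inner_def, ← integral_add hb hc]
    refine integral_congr_ae ?_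
    filter_upwards [M.coe_lowerL v, h1, h2] with x hx hx1 hx2
    rw [hx, coe_valL, hx1, hx2]
    simp only [RCLike.inner_apply, conj_trivial]
    ring
  have h5 : ∫ x in M.Ω, ⟪M.b x, gradient (fun x => φ x ^ 2) x⟫ =
      2 * ∫ x in M.Ω, ⟪M.b x, gradient φ x⟫ * φ x := by
    rw [← integral_const_mul]
    refine integral_congr_ae (Eventually.of_forall fun x => ?_)
    simp only
    rw [hφ.gradient_sq, real_inner_smul_right]
    ring
  have h6 : 0 ≤ ∫ x in M.Ω, (2 * (M.c x * φ x * φ x) - g x * φ x * φ x) := by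
    refine integral_nonneg_of_ae ?_
    filter_upwards [hpos] with x hx
    have := mul_nonneg hx (mul_self_nonneg (φ x))
    simp only [Pi.zero_apply]
    linarith
  rw [integral_sub (hc.const_mul 2) hg2, integral_const_mul] at h6
  have h7 : ∫ x in M.Ω, g x * φ x ^ 2 = ∫ x in M.Ω, g x * φ x * φ x := by
    congr 1; ext x; ring
  rw [h5, h7] at h3
  rw [h4]
  linarith

/-! ### The energy norm -/

lemma a_self_nonneg (v : H01 M.Ω) : 0 ≤ M.a v v := by
  obtain ⟨α, hα, h⟩ := M.exists_a_ge
  exact le_trans (by positivity) (h v)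

lemma energyNorm_nonneg (v : H01 M.Ω) : 0 ≤ M.energyNorm v := Real.sqrt_nonneg _

lemma energyNorm_sq (v : H01 M.Ω) : M.energyNorm v ^ 2 = M.a v v :=
  Real.sq_sqrt (M.a_self_nonneg v)

lemma a_add_left (u v w : H01 M.Ω) : M.a (u + v) w = M.a u w + M.a v w := by
  simp only [← aL_apply, map_add, add_apply]

lemma a_smul_left (c : ℝ) (v w : H01 M.Ω) : M.a (c • v) w = c * M.a v w := by
  simp only [← aL_apply, map_smul, smul_apply, smul_eq_mul]

lemma a_add_right (u v w : H01 M.Ω) : M.a u (v + w) = M.a u v + M.a u w := by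
  rw [a_symm, a_add_left, a_symm, M.a_symm w]

lemma a_smul_right (c : ℝ) (v w : H01 M.Ω) : M.a v (c • w) = c * M.a v w := by
  rw [a_symm, a_smul_left, a_symm]

lemma bil_sub_left (u v w : H01 M.Ω) : M.bil (u - v) w = M.bil u w - M.bil v w := by
  simp only [← bilL_apply, map_sub, sub_apply]

lemma bil_smul_left (c : ℝ) (v w : H01 M.Ω) : M.bil (c • v) w = c * M.bil v w := by
  simp only [← bilL_apply, map_smul, smul_apply, smul_eq_mul]

lemma bil_add_right (u v w : H01 M.Ω) : M.bil u (v + w) = M.bil u v + M.bil u w := by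
  simp only [← bilL_apply, map_add]

lemma energyNorm_smul (c : ℝ) (v : H01 M.Ω) : M.energyNorm (c • v) = |c| * M.energyNorm v := by
  rw [energyNorm, a_smul_left, a_smul_right, ← mul_assoc, Real.sqrt_mul (mul_self_nonneg c),
    Real.sqrt_mul_self_eq_abs, energyNorm]

lemma energyNorm_neg (v : H01 M.Ω) : M.energyNorm (-v) = M.energyNorm v := by
  simpa using M.energyNorm_smul (-1) v

lemma energyNorm_sub_comm (v w : H01 M.Ω) : M.energyNorm (v - w) = M.energyNorm (w - v) := by
  rw [← energyNorm_neg, neg_sub]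

lemma abs_a_le (v w : H01 M.Ω) : |M.a v w| ≤ M.energyNorm v * M.energyNorm w := by
  have key : ∀ t : ℝ, 0 ≤ M.a w w * (t * t) + 2 * M.a v w * t + M.a v v := fun t => by
    have h := M.a_self_nonneg (v + t • w)
    rw [a_add_left, a_add_right, a_add_right, a_smul_left, a_smul_left, a_smul_right, a_smul_right,
      M.a_symm w v] at h
    linarith
  have h := discrim_le_zero key
  rw [discrim] at h
  refine abs_le_of_sq_le_sq ?_ (mul_nonneg (M.energyNorm_nonneg v) (M.energyNorm_nonneg w))
  rw [mul_pow, energyNorm_sq, energyNorm_sq]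
  nlinarith

lemma energyNorm_add_sq (v w : H01 M.Ω) :
    M.energyNorm (v + w) ^ 2 = M.energyNorm v ^ 2 + 2 * M.a v w + M.energyNorm w ^ 2 := by
  rw [energyNorm_sq, energyNorm_sq, energyNorm_sq, a_add_left, a_add_right, a_add_right,
    M.a_symm w v]
  ring

lemma energyNorm_add_le (v w : H01 M.Ω) :
    M.energyNorm (v + w) ≤ M.energyNorm v + M.energyNorm w := by
  refine abs_le_of_sq_le_sq' ?_ (add_nonneg (M.energyNorm_nonneg v) (M.energyNorm_nonneg w)) |>.2
  rw [energyNorm_add_sq]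
  nlinarith [(abs_le.1 (M.abs_a_le v w)).2]

lemma energyNorm_sub_le (u v w : H01 M.Ω) :
    M.energyNorm (u - w) ≤ M.energyNorm (u - v) + M.energyNorm (v - w) := by
  simpa using M.energyNorm_add_le (u - v) (v - w)

/-- The lower order terms only help, so the ellipticity constant in the energy norm is exactly one.
-/
lemma energyNorm_sq_le_bil (v : H01 M.Ω) : M.energyNorm v ^ 2 ≤ M.bil v v := by
  rw [energyNorm_sq, bil_eq_inner]
  linarith [M.lower_nonneg v]

lemma norm_gradL_le_energyNorm :
    ∃ C > 0, ∀ v : H01 M.Ω, ‖gradL M.Ω v‖ ≤ C * M.energyNorm v := by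
  obtain ⟨α, hα, h⟩ := M.exists_a_ge
  refine ⟨√(α⁻¹), by positivity, fun v => ?_⟩
  refine abs_le_of_sq_le_sq' ?_ (mul_nonneg (Real.sqrt_nonneg _) (M.energyNorm_nonneg v)) |>.2
  rw [mul_pow, energyNorm_sq, Real.sq_sqrt (by positivity), inv_mul_eq_div, le_div_iff₀ hα, mul_comm]
  exact h v

lemma norm_le_energyNorm [NeZero d] (hΩ : Bornology.IsBounded M.Ω) :
    ∃ C > 0, ∀ v : H01 M.Ω, ‖v‖ ≤ C * M.energyNorm v := by
  obtain ⟨C, hC, h⟩ := poincare hΩ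
  obtain ⟨D, hD, h'⟩ := M.norm_gradL_le_energyNorm
  refine ⟨√(C + 1) * D, by positivity, fun v => ?_⟩
  have h1 : ‖v‖ ≤ √(C + 1) * ‖gradL M.Ω v‖ := by
    refine abs_le_of_sq_le_sq' ?_ (by positivity) |>.2
    rw [mul_pow, Real.sq_sqrt (by positivity), norm_sq_eq_valL_gradL]
    linarith [h v]
  calc ‖v‖ ≤ √(C + 1) * ‖gradL M.Ω v‖ := h1
    _ ≤ √(C + 1) * (D * M.energyNorm v) := by gcongr; exact h' v
    _ = _ := by ring

lemma exists_abs_bil_le [NeZero d] (hΩ : Bornology.IsBounded M.Ω) :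
    ∃ C ≥ 1, ∀ v w : H01 M.Ω, |M.bil v w| ≤ C * M.energyNorm v * M.energyNorm w := by
  obtain ⟨C, hC, h⟩ := M.norm_le_energyNorm hΩ
  obtain ⟨D, hD, h'⟩ := exists_abs_bilinear_le M.bilL
  refine ⟨D * C * C + 1, by linarith [show 0 ≤ D * C * C by positivity], fun v w => ?_⟩
  have h1 := h' v w
  rw [bilL_apply] at h1
  have hv := M.energyNorm_nonneg v
  have hw := M.energyNorm_nonneg w
  calc _ ≤ D * ‖v‖ * ‖w‖ := h1
    _ ≤ D * (C * M.energyNorm v) * (C * M.energyNorm w) := by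
        gcongr
        · exact h v
        · exact h w
    _ ≤ _ := by nlinarith [mul_nonneg hv hw]

lemma isCoercive_bilL [NeZero d] (hΩ : Bornology.IsBounded M.Ω) : IsCoercive M.bilL := by
  obtain ⟨C, hC, h⟩ := M.norm_le_energyNorm hΩ
  refine ⟨(C ^ 2)⁻¹, by positivity, fun v => ?_⟩
  rw [bilL_apply]
  refine le_trans ?_ (M.energyNorm_sq_le_bil v)
  have h1 : ‖v‖ ^ 2 ≤ (C * M.energyNorm v) ^ 2 := by gcongr; exact h v
  rw [mul_assoc, ← pow_two, inv_mul_le_iff₀ (by positivity), ← mul_pow]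
  exact h1

lemma exists_isWeakSol [NeZero d] (hΩ : Bornology.IsBounded M.Ω) : ∃ u, M.IsWeakSol u := by
  let A := (M.isCoercive_bilL hΩ).continuousLinearEquivOfBilin
  refine ⟨A.symm ((InnerProductSpace.toDual ℝ (H01 M.Ω)).symm M.loadL), fun v => ?_⟩
  rw [← bilL_apply, ← (M.isCoercive_bilL hΩ).continuousLinearEquivOfBilin_apply]
  change ⟪A (A.symm _), v⟫ = _
  rw [A.apply_symm_apply, InnerProductSpace.toDual_symm_apply, loadL_apply]

end ModelProblem

end AFEM

namespace AFEM

variable {d : ℕ}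

/-! ### Compactness of the embedding of `H¹₀(Ω)` into `L²(Ω)` -/

/-- Cauchy–Schwarz against the constant one: with V the total mass and c the integral of f, expand
the integral of (V f - c)², which is nonnegative. -/
lemma sq_integral_le {α : Type*} [MeasurableSpace α] {ν : Measure α} [IsFiniteMeasure ν]
    {f : α → ℝ} (hf : Integrable f ν) (hf2 : Integrable (fun x => f x ^ 2) ν) :
    (∫ x, f x ∂ν) ^ 2 ≤ ν.real Set.univ * ∫ x, f x ^ 2 ∂ν := by
  set V := ν.real Set.univ with hV
  set c := ∫ x, f x ∂ν with hc
  rcases (measureReal_nonneg (μ := ν) (s := Set.univ)).eq_or_lt with h0 | h0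
  · have : ν = 0 := by
      rw [← Measure.measure_univ_eq_zero]
      exact (measureReal_eq_zero_iff).1 h0.symm
    simp [hc, this]
  · have h : 0 ≤ ∫ x, (V * f x - c) ^ 2 ∂ν := integral_nonneg fun x => sq_nonneg _
    have h1 : ∫ x, (V * f x - c) ^ 2 ∂ν = V ^ 2 * ∫ x, f x ^ 2 ∂ν - 2 * V * c * c + c ^ 2 * V := by
      have : (fun x => (V * f x - c) ^ 2) =
          fun x => V ^ 2 * f x ^ 2 - 2 * V * c * f x + c ^ 2 := by ext x; ring
      have hi : Integrable (fun x => V ^ 2 * f x ^ 2 - 2 * V * c * f x) ν :=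
        (hf2.const_mul _).sub (hf.const_mul _)
      rw [this, integral_add hi (integrable_const _), integral_sub (hf2.const_mul _) (hf.const_mul _), integral_const_mul, integral_const_mul,
        integral_const, smul_eq_mul]
      ring
    rw [h1] at h
    have h2 : 0 ≤ V * (V * ∫ x, f x ^ 2 ∂ν - c ^ 2) := by linarith
    nlinarith [nonneg_of_mul_nonneg_right h2 h0]

lemma integrable_translate {Y : Type*} [MeasurableSpace Y] {ν : Measure Y}
    [IsFiniteMeasure ν] {f : Pt d → ℝ} (hf : Integrable f) (hfc : Continuous f) {T : Y → Pt d}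
    (hT : Measurable T) : Integrable (fun p : Pt d × Y => f (p.1 + T p.2)) (volume.prod ν) := by
  have hm : AEStronglyMeasurable (fun p : Pt d × Y => f (p.1 + T p.2)) (volume.prod ν) :=
    (hfc.measurable.comp (measurable_fst.add (hT.comp measurable_snd))).aestronglyMeasurable
  rw [integrable_prod_iff' hm]
  refine ⟨Eventually.of_forall fun y => hf.comp_add_right (T y), ?_⟩
  simp only [integral_add_right_eq_self (fun x => ‖f x‖)]
  exact integrable_const _

namespace IsTestFn

variable {U : Set (Pt d)} {φ : Pt d → ℝ}

lemma continuous (hφ : IsTestFn U φ) : Continuous φ := hφ.1.continuous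

lemma integrable (hφ : IsTestFn U φ) : Integrable φ :=
  hφ.continuous.integrable_of_hasCompactSupport hφ.2.1

lemma integrable_mul_translate (hφ : IsTestFn U φ) (z : Pt d) :
    Integrable fun x => φ x * φ (x + z) := by
  refine (hφ.continuous.mul (hφ.continuous.comp (continuous_id.add
    continuous_const))).integrable_of_hasCompactSupport ?_
  exact hφ.2.1.mul_right

/-- The fundamental theorem of calculus along the segment from x to x + z, followed by
Cauchy–Schwarz on the unit interval. -/
lemma sub_sq_le (hφ : IsTestFn U φ) (x z : Pt d) :
    (φ (x + z) - φ x) ^ 2 ≤ ‖z‖ ^ 2 * ∫ t in Set.Ioc (0 : ℝ) 1, ‖gradient φ (x + t • z)‖ ^ 2 := by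
  have hline : Continuous fun t : ℝ => x + t • z := by fun_prop
  have hc : Continuous fun t : ℝ => ⟪gradient φ (x + t • z), z⟫ :=
    (hφ.continuous_gradient.comp hline).inner continuous_const
  have h1 : ∫ t in (0 : ℝ)..1, ⟪gradient φ (x + t • z), z⟫ = φ (x + z) - φ x := by
    have hd : ∀ t ∈ Set.uIcc (0 : ℝ) 1, HasDerivAt (fun t : ℝ => φ (x + t • z))
        ⟪gradient φ (x + t • z), z⟫ t := fun t _ => by
      have h2 : HasDerivAt (fun t : ℝ => x + t • z) z t := by
        simpa using ((hasDerivAt_id t).smul_const z).const_add x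
      rw [inner_gradient]
      exact (hφ.differentiable (x + t • z)).hasFDerivAt.comp_hasDerivAt t h2
    simpa using intervalIntegral.integral_eq_sub_of_hasDerivAt hd (hc.intervalIntegrable 0 1)
  have hint : ∀ {f : ℝ → ℝ}, Continuous f → Integrable f (volume.restrict (Set.Ioc 0 1)) :=
    fun hf => (hf.integrableOn_Icc).mono_set Set.Ioc_subset_Icc_self
  have h2 := sq_integral_le (hint hc) (hint (hc.pow 2))
  rw [intervalIntegral.integral_of_le zero_le_one] at h1
  rw [h1] at h2
  have h3 : (volume.restrict (Set.Ioc (0 : ℝ) 1)).real Set.univ = 1 := by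
    simp [measureReal_def]
  rw [h3, one_mul] at h2
  refine h2.trans ?_
  rw [← integral_const_mul]
  refine integral_mono (hint (hc.pow 2))
    (hint (((hφ.continuous_gradient.comp hline).norm.pow 2).const_mul _)) fun t => ?_
  simp only
  rw [← mul_pow, ← sq_abs, mul_comm ‖z‖]
  gcongr
  exact abs_real_inner_le_norm _ _

/-- The pointwise bound along segments is integrated over x. After exchanging the integrals, every
translate contributes the same amount by invariance of the measure. -/
lemma integral_sub_translate_sq_le (hφ : IsTestFn U φ) (z : Pt d) :
    ∫ x, (φ (x + z) - φ x) ^ 2 ≤ ‖z‖ ^ 2 * ∫ x, ‖gradient φ x‖ ^ 2 := by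
  have hT := integrable_translate (ν := volume.restrict (Set.Ioc (0 : ℝ) 1))
    hφ.integrable_norm_gradient_sq (hφ.continuous_gradient.norm.pow 2)
    (T := fun t => t • z) (by fun_prop)
  have hint : Integrable fun x => (φ (x + z) - φ x) ^ 2 := by
    have h : (fun x => (φ (x + z) - φ x) ^ 2) =
        fun x => φ (x + z) ^ 2 - 2 * (φ x * φ (x + z)) + φ x ^ 2 := by ext x; ring
    rw [h]
    exact ((hφ.integrable_sq.comp_add_right z).sub
      ((hφ.integrable_mul_translate z).const_mul 2)).add hφ.integrable_sq
  refine (integral_mono hint (hT.integral_prod_left.const_mul (‖z‖ ^ 2))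
    fun x => hφ.sub_sq_le x z).trans_eq ?_
  rw [integral_const_mul, integral_integral_swap hT]
  congr 1
  simp only [integral_add_right_eq_self (fun x => ‖gradient φ x‖ ^ 2)]
  simp

/-- The integral of `φ` over the ball of radius `r` around `x`. -/
def ballIntegral (φ : Pt d → ℝ) (r : ℝ) (x : Pt d) : ℝ := ∫ z in Metric.ball 0 r, φ (x + z)

lemma integrable_mul_ballTranslate (hφ : IsTestFn U φ) (r : ℝ) :
    Integrable (fun p : Pt d × Pt d => φ p.1 * φ (p.1 + p.2))
      (volume.prod (volume.restrict (Metric.ball 0 r))) := by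
  have : IsFiniteMeasure (volume.restrict (Metric.ball (0 : Pt d) r)) :=
    ⟨by simpa using measure_ball_lt_top⟩
  obtain ⟨C, hC⟩ := hφ.2.1.exists_bound_of_continuous hφ.continuous
  exact (integrable_translate hφ.integrable hφ.continuous measurable_id).bdd_mul (c := C)
    (hφ.continuous.comp continuous_fst).aestronglyMeasurable (Eventually.of_forall fun p => hC _)

/-- Expanding the square in the translation estimate gives, for every z in the ball, ∫ φ² ≤ r²/2 ∫
|∇φ|² + ∫ φ(x)φ(x+z). Integration over z turns the last term into a pairing of φ with its ball
integral, which weak convergence can handle. -/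
lemma integral_sq_le_ballIntegral (hφ : IsTestFn U φ) (r : ℝ) :
    volume.real (Metric.ball (0 : Pt d) r) * ∫ x, φ x ^ 2 ≤
      volume.real (Metric.ball (0 : Pt d) r) * (r ^ 2 / 2 * ∫ x, ‖gradient φ x‖ ^ 2) +
        ∫ x, φ x * ballIntegral φ r x := by
  have : IsFiniteMeasure (volume.restrict (Metric.ball (0 : Pt d) r)) :=
    ⟨by simpa using measure_ball_lt_top⟩
  have hI := hφ.integrable_mul_ballTranslate r
  have h1 : ∫ x, φ x * ballIntegral φ r x =
      ∫ z in Metric.ball 0 r, ∫ x, φ x * φ (x + z) := by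
    rw [← integral_integral_swap hI]
    simp only [ballIntegral, integral_const_mul]
  have h2 : ∀ z ∈ Metric.ball (0 : Pt d) r,
      ∫ x, φ x ^ 2 ≤ r ^ 2 / 2 * (∫ x, ‖gradient φ x‖ ^ 2) + ∫ x, φ x * φ (x + z) := by
    intro z hz
    have h3 := hφ.integral_sub_translate_sq_le z
    have h4 : (fun x => (φ (x + z) - φ x) ^ 2) =
        fun x => φ (x + z) ^ 2 - 2 * (φ x * φ (x + z)) + φ x ^ 2 := by ext x; ring
    have hi : Integrable fun x => φ (x + z) ^ 2 - 2 * (φ x * φ (x + z)) :=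
      (hφ.integrable_sq.comp_add_right z).sub ((hφ.integrable_mul_translate z).const_mul 2)
    rw [h4, integral_add hi hφ.integrable_sq, integral_sub (hφ.integrable_sq.comp_add_right z)
      ((hφ.integrable_mul_translate z).const_mul 2), integral_const_mul,
      integral_add_right_eq_self (fun x => φ x ^ 2)] at h3
    have h5 : ‖z‖ ^ 2 ≤ r ^ 2 := by
      gcongr
      exact (mem_ball_zero_iff.1 hz).le
    have h6 : 0 ≤ ∫ x, ‖gradient φ x‖ ^ 2 := integral_nonneg fun x => by positivity
    nlinarith
  have h7 : ∫ z in Metric.ball (0 : Pt d) r, (∫ x, φ x ^ 2) ≤ ∫ z in Metric.ball (0 : Pt d) r,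
      (r ^ 2 / 2 * (∫ x, ‖gradient φ x‖ ^ 2) + ∫ x, φ x * φ (x + z)) :=
    setIntegral_mono_on (integrable_const _) ((integrable_const _).add hI.integral_prod_right)
      measurableSet_ball h2
  rw [integral_add (integrable_const _) hI.integral_prod_right, ← h1, integral_const,
    integral_const] at h7
  simpa [measureReal_def] using h7

lemma ballIntegral_sq_le (hφ : IsTestFn U φ) (r : ℝ) (x : Pt d) :
    ballIntegral φ r x ^ 2 ≤ volume.real (Metric.ball (0 : Pt d) r) * ∫ x, φ x ^ 2 := by
  have : IsFiniteMeasure (volume.restrict (Metric.ball (0 : Pt d) r)) :=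
    ⟨by simpa using measure_ball_lt_top⟩
  have h2 : Integrable fun z => φ (x + z) ^ 2 := hφ.integrable_sq.comp_add_left x
  have h := sq_integral_le (ν := volume.restrict (Metric.ball (0 : Pt d) r))
    (hφ.integrable.comp_add_left x).integrableOn h2.integrableOn
  refine h.trans ?_
  have h3 : (volume.restrict (Metric.ball (0 : Pt d) r)).real Set.univ =
      volume.real (Metric.ball (0 : Pt d) r) := by simp [measureReal_def]
  rw [h3]
  gcongr
  rw [← integral_add_left_eq_self (fun x => φ x ^ 2) x]
  exact setIntegral_le_integral h2 (Eventually.of_forall fun z => sq_nonneg _)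

lemma continuous_ballIntegral (hφ : IsTestFn U φ) (r : ℝ) : Continuous (ballIntegral φ r) := by
  have : IsFiniteMeasure (volume.restrict (Metric.ball (0 : Pt d) r)) :=
    ⟨by simpa using measure_ball_lt_top⟩
  obtain ⟨C, hC⟩ := hφ.2.1.exists_bound_of_continuous hφ.continuous
  refine continuous_of_dominated (bound := fun _ => C) (fun x => ?_)
    (fun x => Eventually.of_forall fun z => hC _) (integrable_const _)
    (Eventually.of_forall fun z => ?_)
  · exact (hφ.continuous.comp (continuous_const.add continuous_id)).aestronglyMeasurable
  · exact hφ.continuous.comp (continuous_id.add continuous_const)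

end IsTestFn

open IsTestFn in
/-- The Rellich theorem for sequences of test functions. -/
lemma tendsto_integral_sq_of_ballIntegral [NeZero d] {Ω : Set (Pt d)} (hΩ : Bornology.IsBounded Ω)
    {φ : ℕ → Pt d → ℝ} (hφ : ∀ n, IsTestFn Ω (φ n)) {C : ℝ} (hC : ∀ n, ∫ x, φ n x ^ 2 ≤ C)
    (hC' : ∀ n, ∫ x, ‖gradient (φ n) x‖ ^ 2 ≤ C)
    (h : ∀ r > 0, ∀ x, Tendsto (fun n => ballIntegral (φ n) r x) atTop (𝓝 0)) :
    Tendsto (fun n => ∫ x, φ n x ^ 2) atTop (𝓝 0) := by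
  have hC0 : 0 ≤ C := (integral_nonneg fun x => sq_nonneg _).trans (hC 0)
  obtain ⟨R, hR0, hR⟩ := hΩ.exists_pos_norm_le
  have hΩR : Ω ⊆ Metric.closedBall 0 R := fun x hx => mem_closedBall_zero_iff.2 (hR x hx)
  have : IsFiniteMeasure (volume.restrict (Metric.closedBall (0 : Pt d) R)) :=
    ⟨by simpa using measure_closedBall_lt_top⟩
  -- Dominated convergence on a bounded set: the ball integrals converge pointwise and are bounded
  -- uniformly in x and n by `ballIntegral_sq_le`.
  have hm : ∀ r > 0, Tendsto (fun n => ∫ x in Metric.closedBall 0 R, ballIntegral (φ n) r x ^ 2)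
      atTop (𝓝 0) := by
    intro r hr
    have h0 : ∫ x in Metric.closedBall (0 : Pt d) R, (0 : ℝ) = 0 := by simp
    rw [← h0]
    refine tendsto_integral_of_dominated_convergence
      (fun _ => volume.real (Metric.ball (0 : Pt d) r) * C) (fun n => ?_) (integrable_const _)
      (fun n => Eventually.of_forall fun x => ?_) (Eventually.of_forall fun x => ?_)
    · exact ((continuous_ballIntegral (hφ n) r).pow 2).aestronglyMeasurable
    · rw [Real.norm_of_nonneg (sq_nonneg _)]
      exact ((hφ n).ballIntegral_sq_le r x).trans (by gcongr; exact hC n)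
    · simpa using (h r hr x).pow 2
  have hbound : ∀ r > 0, ∀ n, ∫ x, φ n x ^ 2 ≤ r ^ 2 * C +
      (2 * r ^ 2 * volume.real (Metric.ball (0 : Pt d) r) ^ 2)⁻¹ *
        ∫ x in Metric.closedBall 0 R, ballIntegral (φ n) r x ^ 2 := by
    intro r hr n
    set V := volume.real (Metric.ball (0 : Pt d) r) with hV
    have hV0 : 0 < V := ENNReal.toReal_pos (Metric.measure_ball_pos _ _ hr).ne'
      measure_ball_lt_top.ne
    have h1 := (hφ n).integral_sq_le_ballIntegral r
    -- This is the weight in Young's inequality. It makes the φ² part cost r²V/2 · C, the same as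
    -- the gradient part, so that both together give r² C after division by V.
    have hδ : 0 < r ^ 2 * V := by positivity
    have h2 : ∫ x, φ n x * ballIntegral (φ n) r x ≤ r ^ 2 * V / 2 * (∫ x, φ n x ^ 2) +
        (2 * (r ^ 2 * V))⁻¹ * ∫ x in Metric.closedBall 0 R, ballIntegral (φ n) r x ^ 2 := by
      have hi : IntegrableOn (fun x => ballIntegral (φ n) r x ^ 2) (Metric.closedBall 0 R) :=
        ((continuous_ballIntegral (hφ n) r).pow 2).continuousOn.integrableOn_compact
          (isCompact_closedBall _ _)
      have h3 : ∀ f : Pt d → ℝ, (∀ x ∉ Ω, f x = 0) →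
          ∫ x in Metric.closedBall 0 R, f x = ∫ x, f x := fun f hf =>
        setIntegral_eq_integral_of_forall_compl_eq_zero fun x hx => hf x fun h => hx (hΩR h)
      rw [← h3 _ fun x hx => by rw [(hφ n).eq_zero_of_notMem hx, zero_mul],
        ← h3 (fun x => φ n x ^ 2) fun x hx => by rw [(hφ n).eq_zero_of_notMem hx]; simp,
        ← integral_const_mul, ← integral_const_mul, ← integral_add
          ((hφ n).integrable_sq.integrableOn.const_mul _) (hi.const_mul _)]
      refine integral_mono ?_ (((hφ n).integrable_sq.integrableOn.const_mul _).add
        (hi.const_mul _)) fun x => ?_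
      · exact (((hφ n).continuous.mul (continuous_ballIntegral (hφ n) r))).continuousOn.integrableOn_compact
          (isCompact_closedBall _ _)
      · simp only
        have h4 := sq_nonneg (r ^ 2 * V * φ n x - ballIntegral (φ n) r x)
        have h5 : r ^ 2 * V / 2 * φ n x ^ 2 + (2 * (r ^ 2 * V))⁻¹ * ballIntegral (φ n) r x ^ 2 -
            φ n x * ballIntegral (φ n) r x = (2 * (r ^ 2 * V))⁻¹ *
              (r ^ 2 * V * φ n x - ballIntegral (φ n) r x) ^ 2 := by
          field_simp
          ring
        have h6 : 0 ≤ (2 * (r ^ 2 * V))⁻¹ *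
          (r ^ 2 * V * φ n x - ballIntegral (φ n) r x) ^ 2 := by positivity
        linarith
    have h7 : V * ∫ x, φ n x ^ 2 ≤ V * (r ^ 2 * C + (2 * r ^ 2 * V ^ 2)⁻¹ *
        ∫ x in Metric.closedBall 0 R, ballIntegral (φ n) r x ^ 2) := by
      have h8 : V * (2 * r ^ 2 * V ^ 2)⁻¹ = (2 * (r ^ 2 * V))⁻¹ := by field_simp
      have h9 : V * (r ^ 2 / 2 * ∫ x, ‖gradient (φ n) x‖ ^ 2) ≤ V * (r ^ 2 / 2 * C) := by
        gcongr; exact hC' n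
      have h10 : r ^ 2 * V / 2 * ∫ x, φ n x ^ 2 ≤ r ^ 2 * V / 2 * C := by gcongr; exact hC n
      rw [mul_add, ← mul_assoc V (2 * r ^ 2 * V ^ 2)⁻¹, h8]
      linarith
    exact le_of_mul_le_mul_left h7 hV0
  rw [Metric.tendsto_atTop]
  intro ε hε
  -- The radius is fixed before n tends to infinity, because the factor in front of the ball
  -- integrals depends on r.
  obtain ⟨r, hr, hrε⟩ : ∃ r > 0, r ^ 2 * C ≤ ε / 2 := by
    refine ⟨√(ε / 2 / (C + 1)), by positivity, ?_⟩
    rw [Real.sq_sqrt (by positivity), div_mul_eq_mul_div, div_le_iff₀ (by positivity)]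
    nlinarith
  have h1 := (hm r hr).const_mul (2 * r ^ 2 * volume.real (Metric.ball (0 : Pt d) r) ^ 2)⁻¹
  rw [mul_zero] at h1
  obtain ⟨N, hN⟩ := eventually_atTop.1 (h1.eventually (gt_mem_nhds (half_pos hε)))
  refine ⟨N, fun n hn => ?_⟩
  rw [Real.dist_0_eq_abs, abs_of_nonneg (integral_nonneg fun x => sq_nonneg _)]
  have := hN n hn
  have := hbound r hr n
  linarith

open IsTestFn in
/-- Bounded sequences in `H¹₀(Ω)` that converge weakly to zero in `L²(Ω)` converge strongly. -/
lemma tendsto_norm_valL [NeZero d] {Ω : Set (Pt d)} (hΩ : Bornology.IsBounded Ω)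
    {w : ℕ → H01 Ω} (hw : ∀ n, ‖w n‖ ≤ 1)
    (h : ∀ g : Lp ℝ 2 (volume.restrict Ω), Tendsto (fun n => ⟪g, valL Ω (w n)⟫) atTop (𝓝 0)) :
    Tendsto (fun n => ‖valL Ω (w n)‖) atTop (𝓝 0) := by
  have hval : ∀ v : H01 Ω, ‖valL Ω v‖ ≤ ‖v‖ := fun v => by
    refine abs_le_of_sq_le_sq' ?_ (norm_nonneg v) |>.2
    rw [norm_sq_eq_valL_gradL]
    nlinarith [sq_nonneg ‖gradL Ω v‖]
  have hgrad : ∀ v : H01 Ω, ‖gradL Ω v‖ ≤ ‖v‖ := fun v => by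
    refine abs_le_of_sq_le_sq' ?_ (norm_nonneg v) |>.2
    rw [norm_sq_eq_valL_gradL]
    nlinarith [sq_nonneg ‖valL Ω v‖]
  -- Replacing each function by a test function at distance below 1/(n+1) changes neither the weak
  -- nor the strong limit.
  have hex : ∀ n, ∃ v : H01 Ω, ∃ φ, IsTestFn Ω φ ∧ val v =ᵐ[volume.restrict Ω] φ ∧
      grad v =ᵐ[volume.restrict Ω] gradient φ ∧ ‖w n - v‖ < ((n : ℝ) + 1)⁻¹ := by
    intro n
    obtain ⟨x, hx, hxv⟩ := Metric.mem_closure_iff.1 (w n).2 ((n : ℝ) + 1)⁻¹ (by positivity)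
    obtain ⟨φ, h1, h2, h3⟩ := hx
    refine ⟨⟨x, subset_closure ⟨φ, h1, h2, h3⟩⟩, φ, h1, h2, h3, ?_⟩
    rwa [dist_eq_norm] at hxv
  choose v φ hφ hv hgv hd using hex
  have hlim : Tendsto (fun n : ℕ => ((n : ℝ) + 1)⁻¹) atTop (𝓝 0) := by
    simpa [one_div] using tendsto_one_div_add_atTop_nhds_zero_nat (𝕜 := ℝ)
  have hsub : Tendsto (fun n => w n - v n) atTop (𝓝 0) :=
    squeeze_zero_norm (fun n => (hd n).le) hlim
  have hv2 : ∀ n, ‖v n‖ ≤ 2 := fun n => by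
    have h1 : ‖v n‖ ≤ ‖w n‖ + ‖w n - v n‖ := by
      simpa using norm_sub_le (w n) (w n - v n)
    have h2 : ((n : ℝ) + 1)⁻¹ ≤ 1 := inv_le_one_of_one_le₀ (by linarith [n.cast_nonneg (α := ℝ)])
    linarith [hd n, hw n]
  have hval2 : ∀ n, ∫ x, φ n x ^ 2 ≤ 4 := fun n => by
    rw [← norm_valL_sq (hφ n) (hv n)]
    nlinarith [hval (v n), hv2 n, norm_nonneg (valL Ω (v n))]
  have hgrad2 : ∀ n, ∫ x, ‖gradient (φ n) x‖ ^ 2 ≤ 4 := fun n => by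
    rw [← norm_gradL_sq (hφ n) (hgv n)]
    nlinarith [hgrad (v n), hv2 n, norm_nonneg (gradL Ω (v n))]
  -- The ball integral at x is the L²(Ω) pairing with the indicator of the ball around x, as φ n
  -- vanishes outside Ω. Weak convergence therefore gives pointwise convergence of the ball
  -- integrals.
  have hweak : ∀ r > 0, ∀ x, Tendsto (fun n => ballIntegral (φ n) r x) atTop (𝓝 0) := by
    intro r hr x
    have hs : MeasurableSet (Metric.ball x r) := measurableSet_ball
    have hs' : (volume.restrict Ω) (Metric.ball x r) ≠ ⊤ :=
      ((Measure.restrict_apply_le _ _).trans_lt measure_ball_lt_top).ne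
    have h1 : ∀ n, ballIntegral (φ n) r x =
        ⟪indicatorConstLp 2 hs hs' (1 : ℝ), valL Ω (v n)⟫ := by
      intro n
      rw [L2.inner_indicatorConstLp_one, Measure.restrict_restrict hs]
      have h2 : ∫ y in Metric.ball x r ∩ Ω, (valL Ω (v n) : Pt d → ℝ) y =
          ∫ y in Metric.ball x r ∩ Ω, φ n y :=
        integral_congr_ae (ae_restrict_of_ae_restrict_of_subset Set.inter_subset_right (hv n))
      have h3 : ∫ y in Metric.ball x r ∩ Ω, φ n y = ∫ y in Metric.ball x r, φ n y :=
        (setIntegral_eq_of_subset_of_forall_sdiff_eq_zero hs Set.inter_subset_left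
          fun y hy => (hφ n).eq_zero_of_notMem fun h => hy.2 ⟨hy.1, h⟩).symm
      have h4 := (measurePreserving_add_left volume x).setIntegral_preimage_emb
        (measurableEmbedding_addLeft x) (φ n) (Metric.ball x r)
      have h5 : (fun y => x + y) ⁻¹' Metric.ball x r = Metric.ball 0 r := by
        ext y; simp [mem_ball_iff_norm]
      rw [h2, h3, ← h4, h5, ballIntegral]
    simp only [h1]
    have h3 : Tendsto (fun n => ⟪indicatorConstLp 2 hs hs' (1 : ℝ), valL Ω (w n - v n)⟫)
        atTop (𝓝 0) := by
      have h4 : Continuous fun y => ⟪indicatorConstLp 2 hs hs' (1 : ℝ), valL Ω y⟫ := by fun_prop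
      have h5 := (h4.tendsto 0).comp hsub
      rwa [map_zero, inner_zero_right] at h5
    have h5 := (h (indicatorConstLp 2 hs hs' (1 : ℝ))).sub h3
    simpa [inner_sub_right] using h5
  have h1 := tendsto_integral_sq_of_ballIntegral hΩ hφ hval2 hgrad2 hweak
  have h2 : Tendsto (fun n => ‖valL Ω (v n)‖) atTop (𝓝 0) := by
    have := h1.sqrt
    simp only [Real.sqrt_zero] at this
    refine this.congr fun n => ?_
    rw [← norm_valL_sq (hφ n) (hv n), Real.sqrt_sq (norm_nonneg _)]
  have h3 : Tendsto (fun n => ‖valL Ω (w n - v n)‖) atTop (𝓝 0) := by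
    have h4 : Continuous fun y => ‖valL Ω y‖ := by fun_prop
    have h5 := (h4.tendsto 0).comp hsub
    rwa [map_zero, norm_zero] at h5
  have h4 := h2.add h3
  rw [add_zero] at h4
  refine squeeze_zero (fun n => norm_nonneg _) (fun n => ?_) h4
  simpa using norm_add_le (valL Ω (v n)) (valL Ω (w n - v n))

/-! ### Quasi-orthogonality -/

/-- A bounded sequence in an increasing sequence of subspaces that is orthogonal to the previous
subspaces with respect to a coercive form converges weakly to zero. -/
lemma tendsto_of_galerkin_orthogonal {V : Type*} [NormedAddCommGroup V] [InnerProductSpace ℝ V]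
    [CompleteSpace V] {B : V →L[ℝ] V →L[ℝ] ℝ} (hB : IsCoercive B) {X : ℕ → Submodule ℝ V}
    (hX : Monotone X) {w : ℕ → V} (hwX : ∀ n, w n ∈ X (n + 1)) (hw1 : ∀ n, ‖w n‖ ≤ 1)
    (hw : ∀ n, ∀ v ∈ X n, B (w n) v = 0) (L : V →L[ℝ] ℝ) :
    Tendsto (fun n => L (w n)) atTop (𝓝 0) := by
  let Y : Submodule ℝ V := (⨆ n, X n).topologicalClosure
  have hXY : ∀ n, X n ≤ Y := fun n => (le_iSup X n).trans (Submodule.le_topologicalClosure _)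
  have : CompleteSpace Y := (⨆ n, X n).isClosed_topologicalClosure.completeSpace_coe
  -- Flipping the arguments sets up the adjoint problem: Lax–Milgram on the closure Y of the union
  -- yields z with B(v, z) = L v on Y, so that L (w n) = B(w n, z).
  let B' : Y →L[ℝ] Y →L[ℝ] ℝ := B.flip.bilinearComp Y.subtypeL Y.subtypeL
  have hB' : IsCoercive B' := by
    obtain ⟨c, hc, h⟩ := hB
    exact ⟨c, hc, fun v => h v⟩
  let A := hB'.continuousLinearEquivOfBilin
  let z : Y := A.symm ((InnerProductSpace.toDual ℝ Y).symm (L.comp Y.subtypeL))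
  have hz : ∀ v : Y, B v z = L v := fun v => by
    have h1 := hB'.continuousLinearEquivOfBilin_apply z v
    change ⟪A (A.symm _), v⟫ = _ at h1
    rw [A.apply_symm_apply, InnerProductSpace.toDual_symm_apply] at h1
    exact h1.symm
  obtain ⟨C, hC, hCB⟩ := exists_abs_bilinear_le B
  rw [Metric.tendsto_atTop]
  intro ε hε
  -- The dual solution is nearly contained in one of the subspaces X N, and from index N on w n is
  -- orthogonal to that part.
  obtain ⟨y, hy, hyz⟩ := Metric.mem_closure_iff.1 z.2 (ε / (C + 1)) (by positivity)
  obtain ⟨N, hN⟩ := (Submodule.mem_iSup_of_directed X hX.directed_le).1 hy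
  refine ⟨N, fun n hn => ?_⟩
  rw [Real.dist_0_eq_abs, ← hz ⟨w n, hXY _ (hwX n)⟩]
  have h1 : B (w n) z = B (w n) (z - y) := by rw [map_sub, hw n y (hX hn hN), sub_zero]
  rw [dist_eq_norm, lt_div_iff₀ (by positivity)] at hyz
  have h2 := hCB (w n) (z - y)
  simp only
  rw [h1]
  nlinarith [hw1 n, norm_nonneg ((z : V) - y), mul_nonneg hC (norm_nonneg ((z : V) - y))]

namespace ModelProblem

variable (M : ModelProblem d)

/-- The normalized vectors converge weakly to zero by orthogonality, and compactness of the
embedding makes their L² norms tend to zero. Undoing the normalization gives an estimate relative to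
the energy norm. -/
lemma eventually_norm_valL_le [NeZero d] (hΩ : Bornology.IsBounded M.Ω)
    {X : ℕ → Submodule ℝ (H01 M.Ω)} (hX : Monotone X) {w : ℕ → H01 M.Ω}
    (hwX : ∀ n, w n ∈ X (n + 1)) (hw : ∀ n, ∀ v ∈ X n, M.bil (w n) v = 0) {ε : ℝ} (hε : 0 < ε) :
    ∀ᶠ n in atTop, ‖valL M.Ω (w n)‖ ≤ ε * M.energyNorm (w n) := by
  obtain ⟨C, hC, hCE⟩ := M.norm_le_energyNorm hΩ
  let y : ℕ → H01 M.Ω := fun n => ‖w n‖⁻¹ • w n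
  have hy1 : ∀ n, ‖y n‖ ≤ 1 := fun n => by
    rw [norm_smul, norm_inv, norm_norm]
    exact inv_mul_le_one
  have hyX : ∀ n, y n ∈ X (n + 1) := fun n => (X _).smul_mem _ (hwX n)
  have hy : ∀ n, ∀ v ∈ X n, M.bilL (y n) v = 0 := fun n v hv => by
    rw [bilL_apply, bil_smul_left, hw n v hv, mul_zero]
  have h := tendsto_norm_valL hΩ hy1 fun g =>
    tendsto_of_galerkin_orthogonal (M.isCoercive_bilL hΩ) hX hyX hy1 hy
      ((innerSL ℝ g).comp (valL M.Ω))
  filter_upwards [h.eventually (gt_mem_nhds (div_pos hε hC))] with n hn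
  rcases eq_or_ne (w n) 0 with h0 | h0
  · rw [h0, map_zero, norm_zero]
    exact mul_nonneg hε.le (M.energyNorm_nonneg _)
  · have h1 : 0 < ‖w n‖ := norm_pos_iff.2 h0
    rw [map_smul, norm_smul, norm_inv, norm_norm, inv_mul_lt_iff₀ h1] at hn
    calc ‖valL M.Ω (w n)‖ ≤ ‖w n‖ * (ε / C) := hn.le
      _ ≤ (C * M.energyNorm (w n)) * (ε / C) := by gcongr; exact hCE _
      _ = ε * M.energyNorm (w n) := by field_simp

/-- Asymptotic quasi-orthogonality of the Galerkin solutions. -/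
lemma eventually_abs_a_le [NeZero d] (hΩ : Bornology.IsBounded M.Ω)
    {X : ℕ → Submodule ℝ (H01 M.Ω)} (hX : Monotone X) {u : H01 M.Ω} (hu : M.IsWeakSol u)
    {U : ℕ → H01 M.Ω} (hU : ∀ n, M.IsGalerkinSol (X n) (U n)) {ε : ℝ} (hε : 0 < ε) :
    ∀ᶠ n in atTop, |M.a (u - U (n + 1)) (U (n + 1) - U n)| ≤
      ε * M.energyNorm (u - U (n + 1)) * M.energyNorm (U (n + 1) - U n) := by
  obtain ⟨C, hC, hCE⟩ := M.norm_le_energyNorm hΩ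
  have hpos : 0 < ‖M.lowerL‖ * C + 1 := by positivity
  filter_upwards [M.eventually_norm_valL_le hΩ hX (w := fun n => U (n + 1) - U n)
    (fun n => (X _).sub_mem (hU _).1 (hX n.le_succ (hU n).1))
    (fun n v hv => by
      rw [bil_sub_left, (hU n).2 v hv, (hU (n + 1)).2 v (hX n.le_succ hv), sub_self])
    (div_pos hε hpos)] with n hn
  set e := u - U (n + 1)
  set δ := U (n + 1) - U n
  -- By Galerkin orthogonality a(e, δ) is minus the lower order term, which involves δ only through
  -- its L² norm.
  have h1 : M.bil e δ = 0 := by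
    have hδ : δ ∈ X (n + 1) := (X _).sub_mem (hU _).1 (hX n.le_succ (hU n).1)
    rw [bil_sub_left, hu, (hU _).2 _ hδ, sub_self]
  rw [bil_eq_inner] at h1
  rw [eq_neg_of_add_eq_zero_left h1, abs_neg]
  calc _ ≤ ‖M.lowerL e‖ * ‖valL M.Ω δ‖ := abs_real_inner_le_norm _ _
    _ ≤ (‖M.lowerL‖ * ‖e‖) * (ε / (‖M.lowerL‖ * C + 1) * M.energyNorm δ) := by
        gcongr
        exact M.lowerL.le_opNorm e
    _ ≤ (‖M.lowerL‖ * (C * M.energyNorm e)) * (ε / (‖M.lowerL‖ * C + 1) * M.energyNorm δ) := by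
        have := M.energyNorm_nonneg δ
        gcongr
        exact hCE e
    _ = (‖M.lowerL‖ * C) / (‖M.lowerL‖ * C + 1) * (ε * M.energyNorm e * M.energyNorm δ) := by
        field_simp
    _ ≤ 1 * (ε * M.energyNorm e * M.energyNorm δ) := by
        have := M.energyNorm_nonneg δ
        have := M.energyNorm_nonneg e
        gcongr
        rw [div_le_one hpos]
        linarith
    _ = _ := one_mul _

end ModelProblem

end AFEM

namespace AFEM

/-! ### The Arnoldi process -/

section Arnoldi

variable {E : Type*} [AddCommGroup E] [Module ℝ E]

/-- The iteration operator of the Richardson iteration with damping parameter `α`. -/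
def richardson (A : E →ₗ[ℝ] E) (α : ℝ) : Module.End ℝ E := LinearMap.id - α • A

/-- `n` steps of the Arnoldi process for the operator `A` with starting vector `s`, where division
by zero returns zero. -/
structure IsArnoldi (ip : LinearMap.BilinForm ℝ E) (A : E →ₗ[ℝ] E) (s : E) (n : ℕ)
    (V : ℕ → E) (W : ℕ → ℕ → E) (h : ℕ → ℕ → ℝ) : Prop where
  start : V 1 = (√(ip s s))⁻¹ • s
  W_zero : ∀ k ∈ Finset.Icc 1 n, W k 0 = A (V k)
  h_eq : ∀ k ∈ Finset.Icc 1 n, ∀ j ∈ Finset.Icc 1 k, h k j = ip (W k (j - 1)) (V j)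
  W_succ : ∀ k ∈ Finset.Icc 1 n, ∀ j ∈ Finset.Icc 1 k, W k j = W k (j - 1) - h k j • V j
  h_last : ∀ k ∈ Finset.Icc 1 n, h k (k + 1) = √(ip (W k k) (W k k))
  V_succ : ∀ k ∈ Finset.Icc 1 n, V (k + 1) = (h k (k + 1))⁻¹ • W k k

variable {ip : LinearMap.BilinForm ℝ E} {A : E →ₗ[ℝ] E} {s : E} {n : ℕ} {V : ℕ → E}
  {W : ℕ → ℕ → E} {h : ℕ → ℕ → ℝ}

namespace IsArnoldi

lemma W_eq (H : IsArnoldi ip A s n V W h) {k : ℕ} (hk : k ∈ Finset.Icc 1 n) {j : ℕ} (hj : j ≤ k) :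
    W k j = A (V k) - ∑ i ∈ Finset.Icc 1 j, h k i • V i := by
  induction j with
  | zero => simp [H.W_zero k hk]
  | succ j ih =>
    rw [H.W_succ k hk (j + 1) (Finset.mem_Icc.2 ⟨by omega, hj⟩), Nat.add_sub_cancel, ih (by omega),
      Finset.sum_Icc_succ_top (by omega), sub_sub]

/-- Because 0⁻¹ = 0, normalizing the zero vector returns zero. This is how breakdown of the Arnoldi
process is covered without stopping it. -/
lemma normalize_dichotomy (hpd : ∀ y, y ≠ 0 → 0 < ip y y) (y : E) :
    ip ((√(ip y y))⁻¹ • y) ((√(ip y y))⁻¹ • y) = 1 ∨ (√(ip y y) = 0 ∧ y = 0) := by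
  rcases eq_or_ne y 0 with h0 | h0
  · right; simp [h0]
  · left
    have h1 := hpd y h0
    have h2 : √(ip y y) * √(ip y y) = ip y y := Real.mul_self_sqrt h1.le
    rw [map_smul, map_smul, LinearMap.smul_apply, smul_eq_mul, smul_eq_mul, ← mul_assoc, ← mul_inv,
      h2, inv_mul_cancel₀ h1.ne']

/-- Every Arnoldi vector is either normalized or zero. -/
lemma V_dichotomy (H : IsArnoldi ip A s n V W h) (hpd : ∀ y, y ≠ 0 → 0 < ip y y) {i : ℕ}
    (hi : i ∈ Finset.Icc 1 (n + 1)) : ip (V i) (V i) = 1 ∨ V i = 0 := by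
  obtain ⟨k, rfl⟩ : ∃ k, i = k + 1 := ⟨i - 1, by have := Finset.mem_Icc.1 hi; omega⟩
  rcases Nat.eq_zero_or_pos k with rfl | hk
  · rw [zero_add, H.start]
    exact (normalize_dichotomy hpd s).imp_right fun h0 => by rw [h0.2, smul_zero]
  · have hk' : k ∈ Finset.Icc 1 n := Finset.mem_Icc.2 ⟨hk, by have := Finset.mem_Icc.1 hi; omega⟩
    rw [H.V_succ k hk', H.h_last k hk']
    exact (normalize_dichotomy hpd _).imp_right fun h0 => by rw [h0.2, smul_zero]

/-- Different Arnoldi vectors are orthogonal. -/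
lemma orthogonal (H : IsArnoldi ip A s n V W h) (hsymm : ∀ y z, ip y z = ip z y)
    (hpd : ∀ y, y ≠ 0 → 0 < ip y y) :
    ∀ m ≤ n, ∀ i ∈ Finset.Icc 1 (m + 1), ∀ j ∈ Finset.Icc 1 (m + 1), i ≠ j →
      ip (V i) (V j) = 0 := by
  intro m
  induction m with
  | zero => intro _ i hi j hj hij; simp only [Finset.mem_Icc] at hi hj; omega
  | succ k ih =>
    intro hk
    have ih' := ih (by omega)
    have hkn : k + 1 ∈ Finset.Icc 1 n := Finset.mem_Icc.2 ⟨by omega, hk⟩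
    -- Modified Gram–Schmidt: each step removes the component along the current vector, and by the
    -- outer induction hypothesis it does not reintroduce the components removed before.
    have hW : ∀ j ≤ k + 1, ∀ i ∈ Finset.Icc 1 j, ip (W (k + 1) j) (V i) = 0 := by
      intro j
      induction j with
      | zero => intro _ i hi; simp at hi
      | succ j ihj =>
        intro hj i hi
        rw [H.W_succ _ hkn (j + 1) (Finset.mem_Icc.2 ⟨by omega, hj⟩), Nat.add_sub_cancel, map_sub,
          map_smul, LinearMap.sub_apply, LinearMap.smul_apply, smul_eq_mul]
        rcases eq_or_ne i (j + 1) with rfl | hij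
        · rw [H.h_eq _ hkn (j + 1) (Finset.mem_Icc.2 ⟨by omega, hj⟩), Nat.add_sub_cancel]
          rcases H.V_dichotomy hpd (i := j + 1) (Finset.mem_Icc.2 ⟨by omega, by omega⟩) with h1 | h1
          · rw [h1]; ring
          · rw [h1]; simp
        · have hi' := Finset.mem_Icc.1 hi
          rw [ihj (by omega) i (Finset.mem_Icc.2 ⟨hi'.1, by omega⟩),
            ih' (j + 1) (Finset.mem_Icc.2 ⟨by omega, by omega⟩) i
              (Finset.mem_Icc.2 ⟨hi'.1, by omega⟩) (Ne.symm hij)]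
          simp
    have hnew : ∀ i ∈ Finset.Icc 1 (k + 1), ip (V (k + 1 + 1)) (V i) = 0 := by
      intro i hi
      rw [H.V_succ _ hkn, map_smul, LinearMap.smul_apply, hW _ le_rfl i hi, smul_zero]
    intro i hi j hj hij
    simp only [Finset.mem_Icc] at hi hj
    rcases eq_or_ne i (k + 1 + 1) with rfl | hi2
    · exact hnew j (Finset.mem_Icc.2 ⟨hj.1, by omega⟩)
    · rcases eq_or_ne j (k + 1 + 1) with rfl | hj2
      · rw [hsymm]
        exact hnew i (Finset.mem_Icc.2 ⟨hi.1, by omega⟩)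
      · exact ih' i (Finset.mem_Icc.2 ⟨hi.1, by omega⟩) j (Finset.mem_Icc.2 ⟨hj.1, by omega⟩) hij

/-- The Arnoldi relation. -/
lemma map_V (H : IsArnoldi ip A s n V W h) (hpd : ∀ y, y ≠ 0 → 0 < ip y y) {k : ℕ}
    (hk : k ∈ Finset.Icc 1 n) : A (V k) = ∑ i ∈ Finset.Icc 1 (k + 1), h k i • V i := by
  -- This survives a breakdown: a zero normalization factor forces W k k = 0 by definiteness.
  have h1 : h k (k + 1) • V (k + 1) = W k k := by
    rw [H.V_succ k hk]
    rcases eq_or_ne (h k (k + 1)) 0 with h0 | h0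
    · have h2 : W k k = 0 := by
        by_contra hne
        rw [H.h_last k hk] at h0
        exact (Real.sqrt_pos.2 (hpd _ hne)).ne' h0
      rw [h2, smul_zero, smul_zero]
    · rw [smul_inv_smul₀ h0]
  rw [Finset.sum_Icc_succ_top (by omega), h1, H.W_eq hk le_rfl, add_sub_cancel]

lemma norm_smul_V_one (H : IsArnoldi ip A s n V W h) (hpd : ∀ y, y ≠ 0 → 0 < ip y y) :
    √(ip s s) • V 1 = s := by
  rw [H.start]
  rcases eq_or_ne s 0 with h0 | h0
  · simp [h0]
  · rw [smul_inv_smul₀ (Real.sqrt_pos.2 (hpd _ h0)).ne']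

/-- A zero Arnoldi vector does not contribute to the residual, but its row does enter the
least-squares functional. The two agree only because the row vanishes. -/
lemma coeff_eq_zero (H : IsArnoldi ip A s n V W h) {k i : ℕ}
    (hk : k ∈ Finset.Icc 1 n) (hi : i ∈ Finset.Icc 1 (k + 1)) (h0 : V i = 0) : h k i = 0 := by
  have hi' := Finset.mem_Icc.1 hi
  rcases eq_or_ne i (k + 1) with rfl | hne
  · rw [H.V_succ k hk] at h0
    rcases smul_eq_zero.1 h0 with h1 | h1
    · exact inv_eq_zero.1 h1
    · rw [H.h_last k hk, h1]; simp
  · rw [H.h_eq k hk i (Finset.mem_Icc.2 ⟨hi'.1, by omega⟩), h0, map_zero]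

/-- The coefficients of the residual in the Arnoldi basis. -/
def resCoeff (β : ℝ) (h : ℕ → ℕ → ℝ) (n : ℕ) (z : ℕ → ℝ) (i : ℕ) : ℝ :=
  (if i = 1 then β else 0) - ∑ m ∈ Finset.Icc 1 n, (if i ≤ m + 1 then h m i else 0) * z m

lemma residual_eq_sum (H : IsArnoldi ip A s n V W h) (hpd : ∀ y, y ≠ 0 → 0 < ip y y)
    (z : ℕ → ℝ) : s - A (∑ m ∈ Finset.Icc 1 n, z m • V m) =
      ∑ i ∈ Finset.Icc 1 (n + 1), resCoeff (√(ip s s)) h n z i • V i := by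
  simp only [resCoeff, sub_smul, Finset.sum_sub_distrib]
  congr 1
  · rw [Finset.sum_eq_single_of_mem 1 (Finset.mem_Icc.2 ⟨le_rfl, by omega⟩)
      fun i _ hi => by rw [if_neg hi, zero_smul], if_pos rfl, H.norm_smul_V_one hpd]
  · simp only [Finset.sum_smul]
    rw [Finset.sum_comm, map_sum]
    refine Finset.sum_congr rfl fun m hm => ?_
    rw [map_smul, H.map_V hpd hm, Finset.smul_sum]
    have hsub : Finset.Icc 1 (m + 1) ⊆ Finset.Icc 1 (n + 1) :=
      Finset.Icc_subset_Icc_right (by have := Finset.mem_Icc.1 hm; omega)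
    rw [← Finset.sum_subset hsub]
    · refine Finset.sum_congr rfl fun i hi => ?_
      rw [if_pos (Finset.mem_Icc.1 hi).2, smul_smul, mul_comm]
    · intro i hi hi'
      simp only [Finset.mem_Icc] at hi hi'
      rw [if_neg (by omega), zero_mul, zero_smul]

/-- The norm of the residual is the least-squares functional. -/
lemma residual_norm (H : IsArnoldi ip A s n V W h) (hsymm : ∀ y z, ip y z = ip z y)
    (hpd : ∀ y, y ≠ 0 → 0 < ip y y) (z : ℕ → ℝ) :
    ip (s - A (∑ m ∈ Finset.Icc 1 n, z m • V m)) (s - A (∑ m ∈ Finset.Icc 1 n, z m • V m)) =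
      ∑ i ∈ Finset.Icc 1 (n + 1), resCoeff (√(ip s s)) h n z i ^ 2 := by
  rw [H.residual_eq_sum hpd]
  simp only [map_sum, LinearMap.sum_apply, map_smul, LinearMap.smul_apply, smul_eq_mul]
  refine Finset.sum_congr rfl fun i hi => ?_
  rw [Finset.sum_eq_single_of_mem i hi]
  · rcases H.V_dichotomy hpd hi with h1 | h1
    · rw [h1]; ring
    · have h2 : resCoeff (√(ip s s)) h n z i = 0 := by
        rw [resCoeff, Finset.sum_eq_zero, sub_zero]
        · split_ifs with h3
          · rw [h3, H.start] at h1
            rcases smul_eq_zero.1 h1 with h4 | h4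
            · exact inv_eq_zero.1 h4
            · rw [h4]; simp
          · rfl
        · intro m hm
          split_ifs with h3
          · rw [H.coeff_eq_zero hm (Finset.mem_Icc.2 ⟨(Finset.mem_Icc.1 hi).1, h3⟩) h1, zero_mul]
          · rw [zero_mul]
      rw [h2]; ring
  · intro j hj hij
    rw [H.orthogonal hsymm hpd n le_rfl _ hj _ hi hij]
    ring

/-- Powers of the Richardson operator applied to the starting vector lie in the span of the Arnoldi
vectors. -/
lemma pow_mem_span (H : IsArnoldi ip A s n V W h) (hpd : ∀ y, y ≠ 0 → 0 < ip y y) (α : ℝ) :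
    ∀ j ≤ n, (richardson A α ^ j) s ∈ Submodule.span ℝ (V '' Finset.Icc 1 (j + 1)) := by
  intro j
  induction j with
  | zero =>
    intro _
    rw [pow_zero, Module.End.one_apply, ← H.norm_smul_V_one hpd]
    exact Submodule.smul_mem _ _ (Submodule.subset_span ⟨1, by simp, rfl⟩)
  | succ j ih =>
    intro hj
    rw [pow_succ', Module.End.mul_apply]
    have hA : Submodule.span ℝ (V '' Finset.Icc 1 (j + 1)) ≤
        (Submodule.span ℝ (V '' Finset.Icc 1 (j + 1 + 1))).comap A := by
      rw [Submodule.span_le]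
      rintro _ ⟨m, hm, rfl⟩
      simp only [Finset.coe_Icc, Set.mem_Icc] at hm
      rw [SetLike.mem_coe, Submodule.mem_comap,
        H.map_V hpd (Finset.mem_Icc.2 ⟨hm.1, by omega⟩)]
      refine Submodule.sum_mem _ fun i hi => Submodule.smul_mem _ _ (Submodule.subset_span ⟨i, ?_, rfl⟩)
      simp only [Finset.mem_Icc] at hi
      simp only [Finset.coe_Icc, Set.mem_Icc]
      omega
    have hsub : Submodule.span ℝ (V '' Finset.Icc 1 (j + 1)) ≤
        Submodule.span ℝ (V '' Finset.Icc 1 (j + 1 + 1)) :=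
      Submodule.span_mono (Set.image_mono (by
        rw [Finset.coe_subset]; exact Finset.Icc_subset_Icc_right (by omega)))
    have h1 := ih (by omega)
    exact Submodule.sub_mem _ (hsub h1) (Submodule.smul_mem _ _ (hA h1))

/-- The n-th Richardson residual is s - A y, where y is α times the sum of (1 - αA)^j s over j < n.
Each summand lies in the span of the first n Arnoldi vectors, so Richardson is a competitor in the
GMRES minimization. -/
lemma exists_residual_eq_pow (H : IsArnoldi ip A s n V W h) (hpd : ∀ y, y ≠ 0 → 0 < ip y y)
    (α : ℝ) : ∃ z : ℕ → ℝ, s - A (∑ m ∈ Finset.Icc 1 n, z m • V m) =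
      (richardson A α ^ n) s := by
  have h1 : ∀ j ≤ n, ∃ y ∈ Submodule.span ℝ (V '' Finset.Icc 1 j),
      s - A y = (richardson A α ^ j) s := by
    intro j
    induction j with
    | zero => exact fun _ => ⟨0, Submodule.zero_mem _, by simp⟩
    | succ j ih =>
      intro hj
      obtain ⟨y, hy, hye⟩ := ih (by omega)
      have hsub : Submodule.span ℝ (V '' Finset.Icc 1 j) ≤
          Submodule.span ℝ (V '' Finset.Icc 1 (j + 1)) :=
        Submodule.span_mono (Set.image_mono (by
          rw [Finset.coe_subset]; exact Finset.Icc_subset_Icc_right (by omega)))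
      refine ⟨y + α • (richardson A α ^ j) s, Submodule.add_mem _ (hsub hy)
        (Submodule.smul_mem _ _ (H.pow_mem_span hpd α j (by omega))), ?_⟩
      rw [pow_succ', Module.End.mul_apply, map_add, ← sub_sub, hye, map_smul]
      rfl
  obtain ⟨y, hy, hye⟩ := h1 n le_rfl
  obtain ⟨z, hz⟩ := (Submodule.mem_span_image_finset_iff_exists_fun' ℝ).1 hy
  exact ⟨z, by rw [hz, hye]⟩

end IsArnoldi

/-- Expanding the square gives the factor 1 - 2αc + α²Λ² per step. It is minimal for α = c/Λ², with
value 1 - (c/Λ)². -/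
lemma richardson_le {c Λ : ℝ} (hΛ : 0 < Λ) (hsymm : ∀ y z, ip y z = ip z y)
    (h1 : ∀ y, c * ip y y ≤ ip (A y) y) (h2 : ∀ y, ip (A y) (A y) ≤ Λ ^ 2 * ip y y) (hc : 0 ≤ c)
    (hcΛ : c ≤ Λ) (n : ℕ) (y : E) :
    ip ((richardson A (c / Λ ^ 2) ^ n) y) ((richardson A (c / Λ ^ 2) ^ n) y) ≤
      (1 - (c / Λ) ^ 2) ^ n * ip y y := by
  have hq : 0 ≤ 1 - (c / Λ) ^ 2 := by
    have : (c / Λ) ^ 2 ≤ 1 := pow_le_one₀ (by positivity) ((div_le_one hΛ).2 hcΛ)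
    linarith
  induction n with
  | zero => simp
  | succ n ih =>
    rw [pow_succ', Module.End.mul_apply]
    set r := (richardson A (c / Λ ^ 2) ^ n) y
    have h3 : ip (richardson A (c / Λ ^ 2) r) (richardson A (c / Λ ^ 2) r) =
        ip r r - 2 * (c / Λ ^ 2) * ip (A r) r + (c / Λ ^ 2) ^ 2 * ip (A r) (A r) := by
      simp only [richardson, LinearMap.sub_apply, LinearMap.id_apply, LinearMap.smul_apply, map_sub, map_smul,
        smul_eq_mul]
      rw [hsymm r (A r)]
      ring
    have h4 : ip r r - 2 * (c / Λ ^ 2) * ip (A r) r + (c / Λ ^ 2) ^ 2 * ip (A r) (A r) ≤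
        ip r r - 2 * (c / Λ ^ 2) * (c * ip r r) + (c / Λ ^ 2) ^ 2 * (Λ ^ 2 * ip r r) := by
      gcongr
      · exact h1 r
      · exact h2 r
    have h5 : ip r r - 2 * (c / Λ ^ 2) * (c * ip r r) + (c / Λ ^ 2) ^ 2 * (Λ ^ 2 * ip r r) =
        (1 - (c / Λ) ^ 2) * ip r r := by field_simp; ring
    rw [h3]
    refine (h4.trans_eq h5).trans ?_
    rw [pow_succ' (1 - (c / Λ) ^ 2), mul_assoc]
    gcongr

end Arnoldi

end AFEM

namespace AFEM

/-! ### Contraction of restarted preconditioned GMRES -/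

section GMRES

variable {N : ℕ} {B P : Matrix (Fin N) (Fin N) ℝ} {rhs : Fin N → ℝ} {kmax : ℕ}

/-- The inner product `(P⁻¹ ·, ·)₂`. -/
def precForm (P : Matrix (Fin N) (Fin N) ℝ) : LinearMap.BilinForm ℝ (Fin N → ℝ) :=
  Matrix.toBilin' P⁻¹

lemma precForm_apply (P : Matrix (Fin N) (Fin N) ℝ) (y z : Fin N → ℝ) :
    precForm P y z = y ⬝ᵥ (P⁻¹ *ᵥ z) := Matrix.toBilin'_apply' _ _ _

lemma precNorm_eq (P : Matrix (Fin N) (Fin N) ℝ) (y : Fin N → ℝ) :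
    precNorm P y = √(precForm P y y) := by rw [precNorm, precForm_apply, dotProduct_comm]

lemma precNorm_nonneg (P : Matrix (Fin N) (Fin N) ℝ) (y : Fin N → ℝ) : 0 ≤ precNorm P y :=
  Real.sqrt_nonneg _

lemma precForm_symm (hP : P.PosDef) (y z : Fin N → ℝ) : precForm P y z = precForm P z y := by
  have h : (P⁻¹)ᵀ = P⁻¹ := by
    have h1 : P⁻¹.IsSymm := by simpa using hP.inv.isHermitian
    exact h1
  rw [precForm_apply, precForm_apply, Matrix.dotProduct_mulVec, ← Matrix.mulVec_transpose, h,
    dotProduct_comm]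

lemma precForm_pos (hP : P.PosDef) (y : Fin N → ℝ) (hy : y ≠ 0) : 0 < precForm P y y := by
  rw [precForm_apply]
  simpa using hP.inv.dotProduct_mulVec_pos hy

lemma precForm_nonneg (hP : P.PosDef) (y : Fin N → ℝ) : 0 ≤ precForm P y y := by
  rcases eq_or_ne y 0 with rfl | hy
  · simp
  · exact (precForm_pos hP y hy).le

lemma precNorm_sq (hP : P.PosDef) (y : Fin N → ℝ) : precNorm P y ^ 2 = precForm P y y := by
  rw [precNorm_eq, Real.sq_sqrt (precForm_nonneg hP y)]

lemma precForm_mulVec_right (hP : P.PosDef) (y r : Fin N → ℝ) :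
    precForm P y (P *ᵥ r) = y ⬝ᵥ r := by
  have hdet : IsUnit P.det := (Matrix.isUnit_iff_isUnit_det P).1 hP.isUnit
  rw [precForm_apply, Matrix.mulVec_mulVec, Matrix.nonsing_inv_mul P hdet, Matrix.one_mulVec]

lemma precForm_mulVec_left (hP : P.PosDef) (y r : Fin N → ℝ) :
    precForm P (P *ᵥ r) y = r ⬝ᵥ y := by
  rw [precForm_symm hP, precForm_mulVec_right hP, dotProduct_comm]

/-- The preconditioned operator. -/
def precOp (B P : Matrix (Fin N) (Fin N) ℝ) : (Fin N → ℝ) →ₗ[ℝ] (Fin N → ℝ) :=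
  P.mulVecLin.comp B.mulVecLin

lemma precOp_apply (B P : Matrix (Fin N) (Fin N) ℝ) (y : Fin N → ℝ) :
    precOp B P y = P *ᵥ (B *ᵥ y) := rfl

/-- Step numbers are written as n * kmax + K with 1 ≤ K ≤ kmax, so the end of a cycle is K = kmax of
that cycle and not K = 0 of the next one. -/
lemma cycleLen_add {K : ℕ} (n : ℕ) (hK : 1 ≤ K) (hK' : K ≤ kmax) :
    cycleLen kmax (n * kmax + K) = K := by
  have h : n * kmax + K - 1 = K - 1 + kmax * n := by rw [mul_comm]; omega
  rw [cycleLen, h, Nat.add_mul_mod_self_left, Nat.mod_eq_of_lt (by omega)]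
  omega

lemma cycleStart_add {K : ℕ} (n : ℕ) (hK : 1 ≤ K) (hK' : K ≤ kmax) :
    cycleStart kmax (n * kmax + K) = n * kmax := by
  have h : n * kmax + K - 1 = K - 1 + kmax * n := by rw [mul_comm]; omega
  rw [cycleStart, h, Nat.add_mul_div_left _ _ (by omega), Nat.div_eq_of_lt (by omega), zero_add]

/-- The preconditioned residual. -/
def precRes (B P : Matrix (Fin N) (Fin N) ℝ) (rhs y : Fin N → ℝ) : Fin N → ℝ :=
  P *ᵥ (rhs - B *ᵥ y)

lemma precRes_add (y z : Fin N → ℝ) :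
    precRes B P rhs (y + z) = precRes B P rhs y - precOp B P z := by
  rw [precRes, precRes, precOp_apply, ← Matrix.mulVec_sub, Matrix.mulVec_add, sub_sub]

/-- All the steps up to `kbar`, together with the initialization. -/
structure IsGMRES (B P : Matrix (Fin N) (Fin N) ℝ) (rhs : Fin N → ℝ) (kmax : ℕ) (kbar : ℕ∞)
    (x : ℕ → Fin N → ℝ) (I : GMRESInternals N) : Prop where
  vt_one : I.vt 1 = (precNorm P (precRes B P rhs (x 0)))⁻¹ • (rhs - B *ᵥ x 0)
  v_one : I.v 1 = P *ᵥ I.vt 1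
  step : ∀ k : ℕ, 1 ≤ k → (k : ℕ∞) ≤ kbar → IsGMRESStep B P rhs kmax x I k

namespace IsGMRES

variable {kbar : ℕ∞} {x : ℕ → Fin N → ℝ} {I : GMRESInternals N}

/-- Both families of vectors are updated by the same linear operations with the same coefficients,
so P maps one to the other. Hence the Euclidean products computed by the algorithm are P⁻¹-inner
products. The induction is strong because orthogonalization refers to all earlier vectors of the
cycle. -/
lemma v_eq_and_w_eq (H : IsGMRES B P rhs kmax kbar x I) :
    ∀ k : ℕ, 1 ≤ k → (k : ℕ∞) ≤ kbar → I.v k = P *ᵥ I.vt k ∧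
      ∀ j ≤ cycleLen kmax k, I.w k j = P *ᵥ I.wt k j := by
  intro k
  induction k using Nat.strong_induction_on with
  | _ k ih =>
    intro hk hkb
    have hv : I.v k = P *ᵥ I.vt k := by
      rcases Nat.lt_or_ge 1 k with h1 | h1
      · have hb : ((k - 1 : ℕ) : ℕ∞) ≤ kbar := le_trans (by exact_mod_cast Nat.sub_le k 1) hkb
        have S := H.step (k - 1) (by omega) hb
        have e : k - 1 + 1 = k := by omega
        by_cases hr : (k - 1) % kmax = 0
        · have := S.restart hr
          rw [e] at this
          rw [this.1, this.2, Matrix.mulVec_smul]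
        · have := S.continue_ hr
          rw [e] at this
          rw [this.1, this.2, Matrix.mulVec_smul, (ih (k - 1) (by omega) (by omega) hb).2 _ le_rfl]
      · obtain rfl : k = 1 := by omega
        exact H.v_one
    refine ⟨hv, fun j => ?_⟩
    have S := H.step k hk hkb
    have hlen : cycleLen kmax k ≤ k := by
      have := Nat.mod_le (k - 1) kmax
      unfold cycleLen
      omega
    induction j with
    | zero => intro _; rw [S.w_zero]
    | succ j ihj =>
      intro hj
      rw [S.w_succ (j + 1) (by omega) hj, S.wt_succ (j + 1) (by omega) hj, Nat.add_sub_cancel,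
        ihj (by omega), Matrix.mulVec_sub, Matrix.mulVec_smul]
      congr 2
      rcases eq_or_ne (k + (j + 1) - cycleLen kmax k) k with h1 | h1
      · rw [h1, hv]
      · refine (ih _ (by omega) (by omega) (le_trans ?_ hkb)).1
        exact_mod_cast (by omega)

/-- Each cycle of GMRES is an Arnoldi process. -/
lemma isArnoldi (H : IsGMRES B P rhs kmax kbar x I) (hkmax : 1 ≤ kmax) (hP : P.PosDef) {n K : ℕ}
    (hK : 1 ≤ K) (hK' : K ≤ kmax) (hb : ((n * kmax + K : ℕ) : ℕ∞) ≤ kbar) :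
    IsArnoldi (precForm P) (precOp B P) (precRes B P rhs (x (n * kmax))) K
      (fun j => if j ≤ K then I.v (n * kmax + j) else
        (I.h (n * kmax + K) (K + 1))⁻¹ • I.w (n * kmax + K) K)
      (fun k => I.w (n * kmax + k)) (fun k => I.h (n * kmax + k)) := by
  have hstep : ∀ k ∈ Finset.Icc 1 K, IsGMRESStep B P rhs kmax x I (n * kmax + k) ∧
      cycleLen kmax (n * kmax + k) = k ∧ ∀ j ≤ k, I.w (n * kmax + k) j = P *ᵥ I.wt (n * kmax + k) j := by
    intro k hk
    rw [Finset.mem_Icc] at hk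
    have hb' : ((n * kmax + k : ℕ) : ℕ∞) ≤ kbar :=
      le_trans (by exact_mod_cast Nat.add_le_add_left hk.2 _) hb
    have hlen := cycleLen_add (kmax := kmax) n hk.1 (hk.2.trans hK')
    refine ⟨H.step _ (by omega) hb', hlen, ?_⟩
    have := (H.v_eq_and_w_eq _ (by omega) hb').2
    rwa [hlen] at this
  have hidx : ∀ k j : ℕ, n * kmax + k + j - k = n * kmax + j := fun k j => by omega
  refine ⟨?_, ?_, ?_, ?_, ?_, ?_⟩
  · rw [if_pos hK, ← precNorm_eq]
    rcases Nat.eq_zero_or_pos n with rfl | hn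
    · rw [zero_mul, zero_add, H.v_one, H.vt_one, Matrix.mulVec_smul]
      rfl
    · have hpos : 1 ≤ n * kmax := Nat.mul_pos hn hkmax
      have hb' : ((n * kmax : ℕ) : ℕ∞) ≤ kbar :=
        le_trans (by exact_mod_cast Nat.le_add_right _ _) hb
      exact ((H.step _ hpos hb').restart (Nat.mul_mod_left n kmax)).2
  · intro k hk
    obtain ⟨S, -, -⟩ := hstep k hk
    rw [if_pos (Finset.mem_Icc.1 hk).2, S.w_zero, S.wt_zero, precOp_apply]
  · intro k hk j hj
    obtain ⟨S, hlen, hw⟩ := hstep k hk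
    rw [Finset.mem_Icc] at hk hj
    have h1 := S.h_eq j hj.1 (by rw [hlen]; exact hj.2)
    rw [hlen, hidx] at h1
    rw [if_pos (hj.2.trans hk.2), h1, hw (j - 1) (by omega), precForm_mulVec_left hP]
  · intro k hk j hj
    obtain ⟨S, hlen, -⟩ := hstep k hk
    rw [Finset.mem_Icc] at hk hj
    have h1 := S.w_succ j hj.1 (by rw [hlen]; exact hj.2)
    rw [hlen, hidx] at h1
    rw [if_pos (hj.2.trans hk.2), h1]
  · intro k hk
    obtain ⟨S, hlen, hw⟩ := hstep k hk
    have h1 := S.h_last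
    rw [hlen] at h1
    rw [h1]
    conv_rhs => rw [hw k le_rfl, precForm_mulVec_left hP, ← hw k le_rfl]
  · intro k hk
    obtain ⟨S, hlen, -⟩ := hstep k hk
    rw [Finset.mem_Icc] at hk
    -- The vector with index K + 1 was supplied by its formula in the statement: for K = kmax the
    -- vector stored by the algorithm at that index belongs to the restarted cycle.
    rcases eq_or_ne k K with rfl | hne
    · simp
    · rw [if_pos (by omega)]
      have hmod : (n * kmax + k) % kmax ≠ 0 := by
        rw [add_comm, mul_comm, Nat.add_mul_mod_self_left, Nat.mod_eq_of_lt (by omega)]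
        omega
      have h1 := (S.continue_ hmod).2
      rwa [hlen] at h1

lemma sum_V_eq (n K : ℕ) (I : GMRESInternals N) (y : Fin N → ℝ) (z : ℕ → ℝ) :
    ∑ m ∈ Finset.Icc 1 K, z m • (if m ≤ K then I.v (n * kmax + m) else y) =
      ∑ m ∈ Finset.Icc 1 K, z m • I.v (n * kmax + m) :=
  Finset.sum_congr rfl fun m hm => by rw [if_pos (Finset.mem_Icc.1 hm).2]

lemma precRes_eq (H : IsGMRES B P rhs kmax kbar x I) {n K : ℕ} (hK : 1 ≤ K) (hK' : K ≤ kmax)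
    (hb : ((n * kmax + K : ℕ) : ℕ∞) ≤ kbar) :
    precRes B P rhs (x (n * kmax + K)) = precRes B P rhs (x (n * kmax)) -
      precOp B P (∑ m ∈ Finset.Icc 1 K, I.y (n * kmax + K) m • I.v (n * kmax + m)) := by
  have h := (H.step _ (by omega) hb).x_eq
  rw [cycleLen_add n hK hK', cycleStart_add n hK hK'] at h
  have hidx : ∀ j : ℕ, n * kmax + K + j - K = n * kmax + j := fun j => by omega
  simp only [hidx] at h
  conv_lhs => rw [h]
  rw [precRes_add]

/-- The minimal residual property. -/
lemma precNorm_precRes_le (H : IsGMRES B P rhs kmax kbar x I) (hkmax : 1 ≤ kmax) (hP : P.PosDef)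
    {n K : ℕ} (hK : 1 ≤ K) (hK' : K ≤ kmax) (hb : ((n * kmax + K : ℕ) : ℕ∞) ≤ kbar) (z : ℕ → ℝ) :
    precNorm P (precRes B P rhs (x (n * kmax + K))) ≤ precNorm P (precRes B P rhs (x (n * kmax)) -
      precOp B P (∑ m ∈ Finset.Icc 1 K, z m • I.v (n * kmax + m))) := by
  have HA := H.isArnoldi hkmax hP hK hK' hb
  have h1 := HA.residual_norm (precForm_symm hP) (precForm_pos hP)
  simp only [sum_V_eq] at h1
  have hls : ∀ z, lsFunctional I kmax (precNorm P (precRes B P rhs (x (n * kmax)))) (n * kmax + K) z =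
      ∑ i ∈ Finset.Icc 1 (K + 1), IsArnoldi.resCoeff (√(precForm P (precRes B P rhs (x (n * kmax)))
        (precRes B P rhs (x (n * kmax))))) (fun k => I.h (n * kmax + k)) K z i ^ 2 := by
    intro z
    rw [lsFunctional, cycleLen_add n hK hK']
    simp only [Nat.add_sub_cancel, IsArnoldi.resCoeff, precNorm_eq]
  have h2 := (H.step _ (by omega) hb).y_min z
  rw [cycleStart_add n hK hK'] at h2
  change lsFunctional I kmax (precNorm P (precRes B P rhs (x (n * kmax)))) _ _ ≤
    lsFunctional I kmax (precNorm P (precRes B P rhs (x (n * kmax)))) _ _ at h2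
  rw [hls, hls, ← h1, ← h1, ← H.precRes_eq hK hK' hb] at h2
  rw [precNorm_eq, precNorm_eq]
  exact Real.sqrt_le_sqrt h2

/-- Inside a cycle, the coefficients of the previous step extended by zero are admissible in the
next minimization. For the first step of a cycle, zero coefficients are admissible. -/
lemma precNorm_succ_le (H : IsGMRES B P rhs kmax kbar x I) (hkmax : 1 ≤ kmax) (hP : P.PosDef)
    {k : ℕ} (hb : ((k + 1 : ℕ) : ℕ∞) ≤ kbar) :
    precNorm P (precRes B P rhs (x (k + 1))) ≤ precNorm P (precRes B P rhs (x k)) := by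
  obtain ⟨n, K, hK, rfl⟩ : ∃ n K, K < kmax ∧ k = n * kmax + K :=
    ⟨k / kmax, k % kmax, Nat.mod_lt _ hkmax, by rw [mul_comm]; exact (Nat.div_add_mod k kmax).symm⟩
  have h := H.precNorm_precRes_le hkmax hP (n := n) (K := K + 1) (by omega) (by omega) hb
  rcases Nat.eq_zero_or_pos K with rfl | hpos
  · simpa using h 0
  · have hb' : ((n * kmax + K : ℕ) : ℕ∞) ≤ kbar :=
      le_trans (by exact_mod_cast Nat.le_succ _) hb
    have h1 := h fun m => if m ≤ K then I.y (n * kmax + K) m else 0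
    rw [Finset.sum_Icc_succ_top (by omega), if_neg (by omega), zero_smul, add_zero,
      Finset.sum_congr rfl fun m hm => by rw [if_pos (Finset.mem_Icc.1 hm).2],
      ← H.precRes_eq hpos hK.le hb'] at h1
    exact h1

lemma precNorm_antitone (H : IsGMRES B P rhs kmax kbar x I) (hkmax : 1 ≤ kmax) (hP : P.PosDef)
    {k' k : ℕ} (hk : k' ≤ k) (hb : (k : ℕ∞) ≤ kbar) :
    precNorm P (precRes B P rhs (x k)) ≤ precNorm P (precRes B P rhs (x k')) := by
  induction k, hk using Nat.le_induction with
  | base => exact le_rfl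
  | succ k hk ih =>
    exact (H.precNorm_succ_le hkmax hP hb).trans (ih (le_trans (by exact_mod_cast Nat.le_succ k) hb))

/-- Contraction within a cycle. -/
lemma precNorm_cycle_le (H : IsGMRES B P rhs kmax kbar x I) (hkmax : 1 ≤ kmax) (hP : P.PosDef)
    {c Λ : ℝ} (hc : 0 ≤ c) (hΛ : 0 < Λ) (hcΛ : c ≤ Λ)
    (h1 : ∀ y, c * precForm P y y ≤ (B *ᵥ y) ⬝ᵥ y)
    (h2 : ∀ y, precForm P (precOp B P y) (precOp B P y) ≤ Λ ^ 2 * precForm P y y)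
    {n K : ℕ} (hK' : K ≤ kmax) (hb : ((n * kmax + K : ℕ) : ℕ∞) ≤ kbar) :
    precNorm P (precRes B P rhs (x (n * kmax + K))) ≤
      √(1 - (c / Λ) ^ 2) ^ K * precNorm P (precRes B P rhs (x (n * kmax))) := by
  have hq : 0 ≤ 1 - (c / Λ) ^ 2 := by
    have : (c / Λ) ^ 2 ≤ 1 := pow_le_one₀ (by positivity) ((div_le_one hΛ).2 hcΛ)
    linarith
  rcases Nat.eq_zero_or_pos K with rfl | hK
  · simp
  · obtain ⟨z, hz⟩ := (H.isArnoldi hkmax hP hK hK' hb).exists_residual_eq_pow (precForm_pos hP)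
      (c / Λ ^ 2)
    rw [sum_V_eq] at hz
    refine (H.precNorm_precRes_le hkmax hP hK hK' hb z).trans ?_
    rw [hz]
    refine abs_le_of_sq_le_sq' ?_ (mul_nonneg (by positivity) (precNorm_nonneg _ _)) |>.2
    rw [mul_pow, precNorm_sq hP, precNorm_sq hP, ← pow_mul, mul_comm K 2, pow_mul, Real.sq_sqrt hq]
    refine richardson_le hΛ (precForm_symm hP) (fun y => ?_) h2 hc hcΛ K _
    rw [precOp_apply, precForm_mulVec_left hP]
    exact h1 y

/-- R-linear convergence of restarted GMRES. -/
lemma precNorm_le (H : IsGMRES B P rhs kmax kbar x I) (hkmax : 1 ≤ kmax) (hP : P.PosDef)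
    {c Λ : ℝ} (hc : 0 ≤ c) (hΛ : 0 < Λ) (hcΛ : c < Λ)
    (h1 : ∀ y, c * precForm P y y ≤ (B *ᵥ y) ⬝ᵥ y)
    (h2 : ∀ y, precForm P (precOp B P y) (precOp B P y) ≤ Λ ^ 2 * precForm P y y)
    {k' k : ℕ} (hk : k' ≤ k) (hb : (k : ℕ∞) ≤ kbar) :
    precNorm P (precRes B P rhs (x k)) ≤ (√(1 - (c / Λ) ^ 2) ^ kmax)⁻¹ *
      √(1 - (c / Λ) ^ 2) ^ (k - k') * precNorm P (precRes B P rhs (x k')) := by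
  set q := √(1 - (c / Λ) ^ 2) with hqdef
  have hq0 : 0 < q := by
    have : (c / Λ) ^ 2 < 1 := pow_lt_one₀ (by positivity) ((div_lt_one hΛ).2 hcΛ) (by norm_num)
    exact Real.sqrt_pos.2 (by linarith)
  have hq1 : q ≤ 1 := Real.sqrt_le_one.2 (by linarith [sq_nonneg (c / Λ)])
  have hcyc : ∀ n K, K ≤ kmax → ((n * kmax + K : ℕ) : ℕ∞) ≤ kbar →
      precNorm P (precRes B P rhs (x (n * kmax + K))) ≤
        q ^ K * precNorm P (precRes B P rhs (x (n * kmax))) := fun n K hK hb =>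
    H.precNorm_cycle_le hkmax hP hc hΛ hcΛ.le h1 h2 hK hb
  have hmul : ∀ n j, (((n + j) * kmax : ℕ) : ℕ∞) ≤ kbar →
      precNorm P (precRes B P rhs (x ((n + j) * kmax))) ≤
        q ^ (j * kmax) * precNorm P (precRes B P rhs (x (n * kmax))) := by
    intro n j
    induction j with
    | zero => intro _; simp
    | succ j ih =>
      intro hb
      have e : (n + (j + 1)) * kmax = (n + j) * kmax + kmax := by ring
      rw [e] at hb ⊢
      refine (hcyc _ _ le_rfl hb).trans ?_
      have h3 := ih (le_trans (by exact_mod_cast Nat.le_add_right _ _) hb)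
      have e2 : (j + 1) * kmax = kmax + j * kmax := by ring
      rw [e2, pow_add, mul_assoc]
      gcongr
  have hfrom : ∀ n j, ((n * kmax + j : ℕ) : ℕ∞) ≤ kbar →
      precNorm P (precRes B P rhs (x (n * kmax + j))) ≤
        q ^ j * precNorm P (precRes B P rhs (x (n * kmax))) := by
    intro n j hb
    have e : n * kmax + j = (n + j / kmax) * kmax + j % kmax := by
      have := Nat.div_add_mod j kmax
      rw [add_mul, mul_comm (j / kmax)]
      omega
    rw [e] at hb ⊢
    refine (hcyc _ _ (Nat.mod_lt _ hkmax).le hb).trans ?_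
    have h3 := hmul n (j / kmax) (le_trans (by exact_mod_cast Nat.le_add_right _ _) hb)
    have e2 : j = j % kmax + j / kmax * kmax := (Nat.mod_add_div' j kmax).symm
    conv_rhs => rw [e2, pow_add, mul_assoc]
    gcongr
  have hpn := precNorm_nonneg P (precRes B P rhs (x k'))
  have hqk : 0 < q ^ kmax := pow_pos hq0 _
  rw [mul_assoc, inv_mul_eq_div, le_div_iff₀ hqk]
  -- The index n * kmax is a restart at most kmax steps after k'. Contraction is known only from
  -- restarts on; the steps before it are covered by monotonicity, which costs the factor q⁻ᵏᵐᵃˣ.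
  set n := k' / kmax + 1
  have hn : k' ≤ n * kmax ∧ n * kmax ≤ k' + kmax := by
    have := Nat.div_add_mod k' kmax
    have h3 := Nat.mod_lt k' hkmax
    have e : n * kmax = kmax * (k' / kmax) + kmax := by simp only [n]; ring
    omega
  rcases le_or_gt k (n * kmax) with hle | hlt
  · have h3 := H.precNorm_antitone hkmax hP hk hb
    rw [mul_comm]
    refine mul_le_mul ?_ h3 (precNorm_nonneg _ _) (by positivity)
    exact pow_le_pow_of_le_one hq0.le hq1 (by omega)
  · obtain ⟨j, rfl⟩ := Nat.exists_eq_add_of_le hlt.le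
    have h3 := hfrom n j hb
    have h4 := H.precNorm_antitone hkmax hP hn.1
      (le_trans (by exact_mod_cast Nat.le_add_right _ _) hb)
    calc _ ≤ (q ^ j * precNorm P (precRes B P rhs (x k'))) * q ^ kmax := by
          gcongr
          exact h3.trans (by gcongr)
      _ = q ^ (j + kmax) * precNorm P (precRes B P rhs (x k')) := by rw [pow_add]; ring
      _ ≤ _ := by
          gcongr ?_ * _
          exact pow_le_pow_of_le_one hq0.le hq1 (by omega)

end IsGMRES

end GMRES

end AFEM

namespace AFEM

variable {d : ℕ}

/-! ### Meshes and the error estimator -/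

lemma TSimplex.vol_nonneg (T : TSimplex d) : 0 ≤ T.vol := measureReal_nonneg

lemma TSimplex.verts_subset_carrier (T : TSimplex d) : T.verts ⊆ T.carrier :=
  subset_convexHull ℝ _

lemma TSimplex.isBounded_carrier (T : TSimplex d) : Bornology.IsBounded T.carrier :=
  isBounded_convexHull.2 (Set.finite_range _).isBounded

lemma TSimplex.IsBisection.carrier_subset {T T₁ T₂ : TSimplex d} (h : T.IsBisection T₁ T₂) :
    T₁.carrier ⊆ T.carrier ∧ T₂.carrier ⊆ T.carrier := by
  have hp : ∀ i, T.simplex.points i ∈ T.carrier := fun i => T.verts_subset_carrier ⟨i, rfl⟩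
  have hz : midpoint ℝ (T.simplex.points 0) (T.simplex.points T.tag) ∈ T.carrier :=
    (convex_convexHull ℝ _).midpoint_mem (hp _) (hp _)
  obtain ⟨-, -, h1, h2⟩ := h
  refine ⟨convexHull_min ?_ (convex_convexHull ℝ _), convexHull_min ?_ (convex_convexHull ℝ _)⟩
  · rintro _ ⟨i, rfl⟩
    rw [h1 i]
    split_ifs
    · exact hz
    · exact hp _
  · rintro _ ⟨i, rfl⟩
    rw [h2 i]
    split_ifs
    · exact hp _
    · exact hz
    · exact hp _

lemma BisectStep.exists_carrier_subset {𝒯 𝒯' : Finset (TSimplex d)} (h : BisectStep 𝒯 𝒯') :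
    ∀ T' ∈ 𝒯', ∃ T ∈ 𝒯, T'.carrier ⊆ T.carrier := by
  classical
  obtain ⟨T, hT, T₁, T₂, hb, rfl⟩ := h
  intro T' hT'
  simp only [Finset.mem_union, Finset.mem_erase, Finset.mem_insert, Finset.mem_singleton] at hT'
  rcases hT' with h1 | rfl | rfl
  · exact ⟨T', h1.2, subset_rfl⟩
  · exact ⟨T, hT, hb.carrier_subset.1⟩
  · exact ⟨T, hT, hb.carrier_subset.2⟩

namespace IsRefinement

variable {𝒯₀ 𝒯 𝒯' 𝒯'' : Finset (TSimplex d)}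

lemma refl_of_conforming (h : Conforming 𝒯₀) : IsRefinement 𝒯₀ 𝒯₀ 𝒯₀ :=
  ⟨.refl, h, fun _ T hT T' hT' hne => ⟨T, hT, T', hT', hne, by
    have := div_nonneg T.vol_nonneg T'.vol_nonneg
    linarith⟩⟩

lemma refl_right (h : IsRefinement 𝒯₀ 𝒯 𝒯') : IsRefinement 𝒯₀ 𝒯' 𝒯' := ⟨.refl, h.2⟩

lemma trans (h : IsRefinement 𝒯₀ 𝒯 𝒯') (h' : IsRefinement 𝒯₀ 𝒯' 𝒯'') :
    IsRefinement 𝒯₀ 𝒯 𝒯'' := ⟨h.1.trans h'.1, h'.2⟩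

lemma exists_carrier_subset (h : IsRefinement 𝒯₀ 𝒯 𝒯') :
    ∀ T' ∈ 𝒯', ∃ T ∈ 𝒯, T'.carrier ⊆ T.carrier := by
  obtain ⟨h, -⟩ := h
  induction h with
  | refl => exact fun T' hT' => ⟨T', hT', subset_rfl⟩
  | tail _ hs ih =>
    intro T' hT'
    obtain ⟨T, hT, h1⟩ := hs.exists_carrier_subset T' hT'
    obtain ⟨S, hS, h2⟩ := ih T hT
    exact ⟨S, hS, h1.trans h2⟩

/-- Every element of the refined mesh lies in an element of the coarse one, so the same function and
the same polynomials can be used. -/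
lemma feSpace_le (h : IsRefinement 𝒯₀ 𝒯 𝒯') (Ω : Set (Pt d)) (p : ℕ) :
    feSpace Ω p 𝒯 ≤ feSpace Ω p 𝒯' := by
  rintro v ⟨g, hg, hq, hv⟩
  refine ⟨g, hg, fun T' hT' => ?_, hv⟩
  obtain ⟨T, hT, hsub⟩ := h.exists_carrier_subset T' hT'
  obtain ⟨q, hqp, hqe⟩ := hq T hT
  exact ⟨q, hqp, fun x hx => hqe x (hsub hx)⟩

end IsRefinement

/-- Boundedness of the domain, on which Poincaré's inequality and compactness rest, comes from its
cover by finitely many simplices. -/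
lemma IsTriangulation.isBounded {Ω : Set (Pt d)} {𝒯₀ : Finset (TSimplex d)}
    (h : IsTriangulation Ω 𝒯₀) : Bornology.IsBounded Ω := by
  have h1 : Bornology.IsBounded (⋃ T ∈ 𝒯₀, T.carrier) :=
    (Bornology.isBounded_biUnion_finset 𝒯₀).2 fun T _ => T.isBounded_carrier
  rw [h.2] at h1
  exact h1.subset subset_closure

namespace ModelProblem

variable (M : ModelProblem d) [NeZero d] {p : ℕ} {𝒯₀ 𝒯 𝒯' 𝒰 𝒰' : Finset (TSimplex d)}

lemma etaSq_nonneg (𝒯 : Finset (TSimplex d)) (T : TSimplex d) (v : H01 M.Ω) :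
    0 ≤ M.etaSq 𝒯 T v := by
  refine add_nonneg (mul_nonneg (Real.rpow_nonneg T.vol_nonneg _)
    (integral_nonneg fun x => sq_nonneg _)) (mul_nonneg (Real.rpow_nonneg T.vol_nonneg _)
    (Finset.sum_nonneg fun i _ => integral_nonneg fun x => sq_nonneg _))

lemma etaOn_nonneg (𝒯 𝒰 : Finset (TSimplex d)) (v : H01 M.Ω) : 0 ≤ M.etaOn 𝒯 𝒰 v :=
  Real.sqrt_nonneg _

lemma eta_nonneg (𝒯 : Finset (TSimplex d)) (v : H01 M.Ω) : 0 ≤ M.eta 𝒯 v :=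
  Real.sqrt_nonneg _

lemma etaOn_sq (𝒯 𝒰 : Finset (TSimplex d)) (v : H01 M.Ω) :
    M.etaOn 𝒯 𝒰 v ^ 2 = ∑ T ∈ 𝒰, M.etaSq 𝒯 T v :=
  Real.sq_sqrt (Finset.sum_nonneg fun _ _ => M.etaSq_nonneg _ _ _)

lemma etaOn_sq_mono (h : 𝒰 ⊆ 𝒰') (v : H01 M.Ω) : M.etaOn 𝒯 𝒰 v ^ 2 ≤ M.etaOn 𝒯 𝒰' v ^ 2 := by
  rw [etaOn_sq, etaOn_sq]
  exact Finset.sum_le_sum_of_subset_of_nonneg h fun _ _ _ => M.etaSq_nonneg _ _ _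

open Classical in
lemma eta_sq_eq (𝒯 𝒰 : Finset (TSimplex d)) (v : H01 M.Ω) :
    M.eta 𝒯 v ^ 2 = M.etaOn 𝒯 (𝒯 ∩ 𝒰) v ^ 2 + M.etaOn 𝒯 (𝒯 \ 𝒰) v ^ 2 := by
  rw [eta, etaOn_sq, etaOn_sq, etaOn_sq]
  exact (Finset.sum_inter_add_sum_sdiff _ _ _).symm

/-- The constants of the axioms of adaptivity. -/
structure Axioms (p : ℕ) (𝒯₀ : Finset (TSimplex d)) (Cstab qred : ℝ) : Prop where
  Cstab_pos : 0 < Cstab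
  qred_pos : 0 < qred
  qred_lt : qred < 1
  stability : ∀ 𝒯, IsRefinement 𝒯₀ 𝒯₀ 𝒯 → ∀ v ∈ feSpace M.Ω p 𝒯, ∀ v' ∈ feSpace M.Ω p 𝒯,
    |M.eta 𝒯 v' - M.eta 𝒯 v| ≤ Cstab * M.energyNorm (v' - v)
  reduction : ∀ 𝒯 𝒯', IsRefinement 𝒯₀ 𝒯₀ 𝒯 → IsRefinement 𝒯₀ 𝒯 𝒯' → ∀ v ∈ feSpace M.Ω p 𝒯,
    ∀ 𝒰, (∀ T ∈ 𝒰, T ∈ 𝒯 ∧ T ∉ 𝒯') →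
      M.eta 𝒯' v ^ 2 ≤ M.eta 𝒯 v ^ 2 - (1 - qred ^ 2) * M.etaOn 𝒯 𝒰 v ^ 2

/-- Stability for one and the same function shows that the contributions of the unrefined elements
agree on both meshes. The squared estimator therefore changes only on refined elements, where it
loses at least the fraction 1 - qred². -/
lemma exists_axioms (h1 : M.Stability p 𝒯₀) (h2 : M.Reduction p 𝒯₀) :
    ∃ Cstab qred, M.Axioms p 𝒯₀ Cstab qred := by
  classical
  obtain ⟨Cstab, hC, hstab⟩ := h1
  obtain ⟨qred, hq0, hq1, hred⟩ := h2
  refine ⟨Cstab, qred, hC, hq0, hq1, fun 𝒯 h𝒯 v hv v' hv' => ?_, ?_⟩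
  · have := hstab 𝒯 𝒯 h𝒯 h𝒯.refl_right v hv v' hv'
    rwa [Finset.inter_self] at this
  · intro 𝒯 𝒯' h𝒯 h𝒯' v hv 𝒰 h𝒰
    have h3 := hstab 𝒯 𝒯' h𝒯 h𝒯' v hv v (h𝒯'.feSpace_le M.Ω p hv)
    have h0 : M.energyNorm (v - v) = 0 := by simp [energyNorm, a_eq_inner]
    rw [h0, mul_zero, abs_nonpos_iff, sub_eq_zero] at h3
    have h4 := hred 𝒯 𝒯' h𝒯 h𝒯' v hv
    have h5 := M.eta_sq_eq 𝒯' 𝒯 v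
    have h6 := M.eta_sq_eq 𝒯 𝒯' v
    have h7 : M.etaOn 𝒯 𝒰 v ^ 2 ≤ M.etaOn 𝒯 (𝒯 \ 𝒯') v ^ 2 :=
      M.etaOn_sq_mono (fun T hT => Finset.mem_sdiff.2 (h𝒰 T hT)) v
    have h8 : M.etaOn 𝒯' (𝒯' \ 𝒯) v ^ 2 ≤ qred ^ 2 * M.etaOn 𝒯 (𝒯 \ 𝒯') v ^ 2 := by
      rw [← mul_pow]
      exact pow_le_pow_left₀ (M.etaOn_nonneg _ _ _) h4 2
    rw [Finset.inter_comm 𝒯 𝒯', ← h3] at h6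
    have h9 : 0 ≤ 1 - qred ^ 2 := by nlinarith
    nlinarith [mul_le_mul_of_nonneg_left h7 h9]

namespace Axioms

variable {M} {Cstab qred : ℝ}

lemma eta_le (H : M.Axioms p 𝒯₀ Cstab qred) (h𝒯 : IsRefinement 𝒯₀ 𝒯₀ 𝒯) {v w : H01 M.Ω}
    (hv : v ∈ feSpace M.Ω p 𝒯) (hw : w ∈ feSpace M.Ω p 𝒯) :
    M.eta 𝒯 v ≤ M.eta 𝒯 w + Cstab * M.energyNorm (v - w) := by
  linarith [(abs_le.1 (H.stability 𝒯 h𝒯 w hw v hv)).2]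

lemma eta_refine_le (H : M.Axioms p 𝒯₀ Cstab qred) (h𝒯 : IsRefinement 𝒯₀ 𝒯₀ 𝒯)
    (h𝒯' : IsRefinement 𝒯₀ 𝒯 𝒯') {v : H01 M.Ω} (hv : v ∈ feSpace M.Ω p 𝒯) :
    M.eta 𝒯' v ≤ M.eta 𝒯 v := by
  have h := H.reduction 𝒯 𝒯' h𝒯 h𝒯' v hv ∅ (by simp)
  have h0 : M.etaOn 𝒯 ∅ v = 0 := by simp [etaOn]
  rw [h0] at h
  exact abs_le_of_sq_le_sq' (by linarith) (M.eta_nonneg _ _) |>.2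

open Classical in
-- Marked elements are refined and carry at least the fraction θ of the squared estimator.
lemma estimator_reduction (H : M.Axioms p 𝒯₀ Cstab qred) (h𝒯 : IsRefinement 𝒯₀ 𝒯₀ 𝒯)
    (h𝒯' : IsRefinement 𝒯₀ 𝒯 𝒯') {v : H01 M.Ω} (hv : v ∈ feSpace M.Ω p 𝒯) {θ : ℝ}
    (h𝒰 : 𝒰 ⊆ 𝒯 \ 𝒯') (hm : θ * M.eta 𝒯 v ^ 2 ≤ M.etaOn 𝒯 𝒰 v ^ 2) :
    M.eta 𝒯' v ^ 2 ≤ (1 - (1 - qred ^ 2) * θ) * M.eta 𝒯 v ^ 2 := by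
  have h := H.reduction 𝒯 𝒯' h𝒯 h𝒯' v hv 𝒰 fun T hT => Finset.mem_sdiff.1 (h𝒰 hT)
  have h9 : 0 ≤ 1 - qred ^ 2 := by nlinarith [H.qred_pos, H.qred_lt]
  nlinarith [mul_le_mul_of_nonneg_left hm h9]

end Axioms

end ModelProblem

end AFEM

namespace AFEM

/-! ### Linear convergence of sequences -/

lemma exists_forall_lt_le (a : ℕ → ℝ) (L : ℕ) : ∃ C > 0, ∀ n < L, a n ≤ C := by
  refine ⟨∑ n ∈ Finset.range L, |a n| + 1, by positivity, fun n hn => ?_⟩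
  have := Finset.single_le_sum (f := fun n => |a n|) (fun i _ => abs_nonneg _)
    (Finset.mem_range.2 hn)
  linarith [le_abs_self (a n)]

lemma exists_forall_le_of_eventually {a : ℕ → ℝ} {L : ℕ} {C : ℝ} (h : ∀ n ≥ L, a n ≤ C) :
    ∃ C > 0, ∀ n, a n ≤ C := by
  obtain ⟨D, hD, hD'⟩ := exists_forall_lt_le a L
  refine ⟨max C D, lt_max_of_lt_right hD, fun n => ?_⟩
  rcases lt_or_ge n L with hn | hn
  · exact (hD' n hn).trans (le_max_right _ _)
  · exact (h n hn).trans (le_max_left _ _)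

/-- Sequences whose reciprocals have summable heads converge linearly. -/
lemma linear_convergence_of_sum_inv_le {h : ℕ → ℝ} (hpos : ∀ n, 0 < h n) {C : ℝ}
    (hC : ∀ n, ∑ m ∈ Finset.range (n + 1), (h m)⁻¹ ≤ C * (h n)⁻¹) :
    ∃ q D : ℝ, 0 < q ∧ q < 1 ∧ 0 < D ∧ ∀ m n, m ≤ n → h n ≤ D * q ^ (n - m) * h m := by
  set σ : ℕ → ℝ := fun n => ∑ m ∈ Finset.range (n + 1), (h m)⁻¹ with hσ
  have hle : ∀ n, (h n)⁻¹ ≤ σ n := fun n =>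
    Finset.single_le_sum (f := fun m => (h m)⁻¹) (fun i _ => (inv_pos.2 (hpos i)).le)
      (Finset.mem_range.2 n.lt_succ_self)
  have hC1 : 1 ≤ C := by
    have h1 := (hle 0).trans (hC 0)
    have h2 := inv_pos.2 (hpos 0)
    nlinarith
  -- Enlarging C makes the rate 1 - D⁻¹ strictly positive.
  set D := C + 1
  have hD : 1 < D := by simp only [D]; linarith
  have hD' : ∀ n, σ n ≤ D * (h n)⁻¹ := fun n => (hC n).trans (by
    have := inv_pos.2 (hpos n)
    gcongr
    simp only [D]; linarith)
  have hq1 : D⁻¹ < 1 := inv_lt_one_of_one_lt₀ hD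
  have hq0 : 0 < D⁻¹ := inv_pos.2 (by linarith)
  -- The increment 1/h (n+1) is at least the fraction D⁻¹ of σ (n+1), so σ grows geometrically. As
  -- 1/h and σ are equivalent, h decays at the same rate.
  have hstep : ∀ n, σ n ≤ (1 - D⁻¹) * σ (n + 1) := fun n => by
    have h1 : σ (n + 1) = σ n + (h (n + 1))⁻¹ := Finset.sum_range_succ _ _
    have h2 : D⁻¹ * σ (n + 1) ≤ (h (n + 1))⁻¹ := by
      rw [inv_mul_le_iff₀ (by linarith)]
      exact hD' (n + 1)
    linarith
  refine ⟨1 - D⁻¹, D, by linarith, by linarith, by linarith, fun m n hmn => ?_⟩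
  have hind : σ m ≤ (1 - D⁻¹) ^ (n - m) * σ n := by
    induction n, hmn using Nat.le_induction with
    | base => simp
    | succ n hmn ih =>
      refine ih.trans ?_
      rw [Nat.succ_sub hmn, pow_succ, mul_assoc]
      exact mul_le_mul_of_nonneg_left (hstep n) (pow_nonneg (by linarith) _)
  have h1 : (h m)⁻¹ ≤ (1 - D⁻¹) ^ (n - m) * (D * (h n)⁻¹) :=
    (hle m).trans (hind.trans (mul_le_mul_of_nonneg_left (hD' n) (pow_nonneg (by linarith) _)))
  have hm := hpos m
  have hn := hpos n
  have h2 := mul_le_mul_of_nonneg_left h1 (mul_pos hm hn).le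
  have h3 : h m * h n * (h m)⁻¹ = h n := by field_simp
  have h4 : h m * h n * ((1 - D⁻¹) ^ (n - m) * (D * (h n)⁻¹)) = D * (1 - D⁻¹) ^ (n - m) * h m := by
    field_simp
  rwa [h3, h4] at h2

/-- Version for sequences that may become zero. -/
lemma linear_convergence_of_nonneg {h : ℕ → ℝ} (hnn : ∀ n, 0 ≤ h n)
    (hzero : ∀ n, h n = 0 → h (n + 1) = 0)
    (hsum : (∀ n, 0 < h n) → ∃ C, ∀ n, ∑ m ∈ Finset.range (n + 1), (h m)⁻¹ ≤ C * (h n)⁻¹) :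
    ∃ q D : ℝ, 0 < q ∧ q < 1 ∧ 0 < D ∧ ∀ m n, m ≤ n → h n ≤ D * q ^ (n - m) * h m := by
  by_cases hpos : ∀ n, 0 < h n
  · obtain ⟨C, hC⟩ := hsum hpos
    exact linear_convergence_of_sum_inv_le hpos hC
  push Not at hpos
  obtain ⟨N, hN⟩ := hpos
  have hN0 : ∀ n ≥ N, h n = 0 := by
    intro n hn
    induction n, hn using Nat.le_induction with
    | base => exact le_antisymm hN (hnn N)
    | succ n _ ih => exact hzero n ih
  have hpersist : ∀ m n, m ≤ n → h m = 0 → h n = 0 := by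
    intro m n hmn h0
    induction n, hmn using Nat.le_induction with
    | base => exact h0
    | succ n _ ih => exact hzero n ih
  have hS : ∀ n, 0 ≤ ∑ i ∈ Finset.range N, h n * (2 : ℝ) ^ N * (h i)⁻¹ := fun n =>
    Finset.sum_nonneg fun i _ => by have := hnn n; have := hnn i; positivity
  -- Only finitely many values are nonzero. The double sum dominates every ratio of two of them
  -- times 2^N, which pays for any rate 1/2 over fewer than N steps.
  refine ⟨1 / 2, ∑ j ∈ Finset.range N, ∑ i ∈ Finset.range N, h j * (2 : ℝ) ^ N * (h i)⁻¹ + 1,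
    by norm_num, by norm_num, by linarith [Finset.sum_nonneg fun j (_ : j ∈ Finset.range N) => hS j],
    fun m n hmn => ?_⟩
  set D := ∑ j ∈ Finset.range N, ∑ i ∈ Finset.range N, h j * (2 : ℝ) ^ N * (h i)⁻¹ with hDdef
  have hD0 : 0 ≤ D := Finset.sum_nonneg fun j _ => hS j
  have hm := hnn m
  rcases le_or_gt N n with hn | hn
  · rw [hN0 n hn]
    positivity
  rcases eq_or_ne (h m) 0 with h0 | h0
  · rw [hpersist m n hmn h0, h0, mul_zero]
  have h1 : h n * (2 : ℝ) ^ N * (h m)⁻¹ ≤ D := by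
    refine le_trans ?_ (Finset.single_le_sum (fun j _ => hS j) (Finset.mem_range.2 hn))
    exact Finset.single_le_sum (f := fun i => h n * (2 : ℝ) ^ N * (h i)⁻¹)
      (fun i _ => by have := hnn n; have := hnn i; positivity)
      (Finset.mem_range.2 (hmn.trans_lt hn))
  have hmpos : 0 < h m := lt_of_le_of_ne hm (Ne.symm h0)
  rw [← div_eq_mul_inv, div_le_iff₀ hmpos] at h1
  have h2 : (1 : ℝ) ≤ (2 : ℝ) ^ N * (1 / 2) ^ (n - m) := by
    have h3 : (1 / 2 : ℝ) ^ N ≤ (1 / 2) ^ (n - m) :=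
      pow_le_pow_of_le_one (by norm_num) (by norm_num) (by omega)
    calc (1 : ℝ) = (2 : ℝ) ^ N * (1 / 2) ^ N := by rw [← mul_pow]; norm_num
      _ ≤ _ := by gcongr
  have hp : (0 : ℝ) ≤ (1 / 2) ^ (n - m) := by positivity
  calc h n ≤ h n * ((2 : ℝ) ^ N * (1 / 2) ^ (n - m)) := le_mul_of_one_le_right (hnn n) h2
    _ = (h n * (2 : ℝ) ^ N) * (1 / 2) ^ (n - m) := by ring
    _ ≤ (D * h m) * (1 / 2) ^ (n - m) := by gcongr
    _ ≤ (D + 1) * (1 / 2) ^ (n - m) * h m := by nlinarith [mul_nonneg hp hm]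

/-- Estimator reduction, reliability and quasi-orthogonality control the sum of the reciprocals. -/
lemma exists_sum_inv_bound_of_reduction {b K R : ℝ} (hb0 : 0 ≤ b) (hb : b < 1) (hK : 0 < K)
    (hR : 0 < R) : ∃ ε > 0, ε ≤ 1 / 4 ∧ ∀ (η e δ S H : ℕ → ℝ) (L : ℕ), (∀ n, 0 ≤ η n) →
      (∀ n, 0 ≤ e n) →
      (∀ n ≥ L, η (n + 1) ^ 2 ≤ b * η n ^ 2 + K * δ n ^ 2) → (∀ n ≥ L, e n ≤ R * η n) →
      (∀ n ≥ L, (1 - ε) * (e (n + 1) ^ 2 + δ n ^ 2) ≤ e n ^ 2) →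
      (∀ n ≥ L, S (n + 1) = S n + (H n)⁻¹) → 0 ≤ S L →
      (∀ n ≥ L, 0 < H n ∧ η n ≤ H n ∧ H n ≤ 2 * η n) →
      ∃ C, ∀ n ≥ L, S n ≤ C * (H n)⁻¹ := by
  -- This choice lets reliability bound 4εe² by half of the reduction gap of K⁻¹η².
  set ε := min (1 / 4) ((1 - b) / (8 * K * R ^ 2)) with hεdef
  have hε0 : 0 < ε := lt_min (by norm_num) (div_pos (by linarith) (by positivity))
  have hε4 : ε ≤ 1 / 4 := min_le_left _ _
  have hε' : 4 * ε * R ^ 2 ≤ K⁻¹ * ((1 - b) / 2) := by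
    have h1 : ε ≤ (1 - b) / (8 * K * R ^ 2) := min_le_right _ _
    rw [le_div_iff₀ (by positivity)] at h1
    rw [inv_mul_eq_div, le_div_iff₀ hK]
    linarith
  refine ⟨ε, hε0, hε4, fun η e δ S H L hη he h1 h2 h3 h4 hS0 h5 => ?_⟩
  set ρ := max ((1 + b) / 2) (1 - 2 * ε) with hρ
  have hρ1 : ρ < 1 := max_lt (by linarith) (by linarith)
  have hρ0 : 0 ≤ ρ := le_max_of_le_left (by linarith)
  -- With the weight K⁻¹, the perturbation δ² in the estimator reduction cancels against the δ²
  -- gained from quasi-orthogonality.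
  set Δ : ℕ → ℝ := fun n => K⁻¹ * η n ^ 2 + e n ^ 2 with hΔ
  have hΔ0 : ∀ n, 0 ≤ Δ n := fun n => by simp only [hΔ]; positivity
  have hcontr : ∀ n ≥ L, Δ (n + 1) ≤ ρ * Δ n := by
    intro n hn
    have a1 : e (n + 1) ^ 2 + δ n ^ 2 ≤ (1 + 2 * ε) * e n ^ 2 := by
      have b1 := h3 n hn
      have b2 : 0 ≤ e (n + 1) ^ 2 + δ n ^ 2 := by positivity
      have b3 : 1 ≤ (1 + 2 * ε) * (1 - ε) := by nlinarith
      calc _ ≤ ((1 + 2 * ε) * (1 - ε)) * (e (n + 1) ^ 2 + δ n ^ 2) := le_mul_of_one_le_left b2 b3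
        _ = (1 + 2 * ε) * ((1 - ε) * (e (n + 1) ^ 2 + δ n ^ 2)) := by ring
        _ ≤ _ := by gcongr
    have a2 : K⁻¹ * η (n + 1) ^ 2 ≤ K⁻¹ * b * η n ^ 2 + δ n ^ 2 := by
      have : K⁻¹ * η (n + 1) ^ 2 ≤ K⁻¹ * (b * η n ^ 2 + K * δ n ^ 2) := by
        gcongr
        exact h1 n hn
      refine this.trans_eq ?_
      field_simp
    have a3 : e n ^ 2 ≤ R ^ 2 * η n ^ 2 := by
      rw [← mul_pow]
      exact pow_le_pow_left₀ (he n) (h2 n hn) 2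
    have a4 : 4 * ε * e n ^ 2 ≤ K⁻¹ * ((1 - b) / 2) * η n ^ 2 := by
      calc 4 * ε * e n ^ 2 ≤ 4 * ε * (R ^ 2 * η n ^ 2) := by gcongr
        _ = 4 * ε * R ^ 2 * η n ^ 2 := by ring
        _ ≤ _ := by gcongr
    have a5 : (1 + b) / 2 * (K⁻¹ * η n ^ 2) ≤ ρ * (K⁻¹ * η n ^ 2) := by
      gcongr
      exact le_max_left _ _
    have a6 : (1 - 2 * ε) * e n ^ 2 ≤ ρ * e n ^ 2 := by
      gcongr
      exact le_max_right _ _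
    -- What remains of the error is (1 + 2ε)e² = (1 - 2ε)e² + 4εe², and the last term goes into the
    -- reduction gap of the estimator.
    simp only [hΔ]
    nlinarith
  set r := √ρ
  have hr1 : r < 1 := by
    rw [Real.sqrt_lt' one_pos]; linarith
  have hr0 : 0 ≤ r := Real.sqrt_nonneg _
  set Γ := √(K⁻¹ + R ^ 2)
  have hSn : ∀ n ≥ L, 0 ≤ S n := by
    intro n hn
    induction n, hn using Nat.le_induction with
    | base => exact hS0
    | succ n hn ih => rw [h4 n hn]; have := inv_pos.2 (h5 n hn).1; linarith
  -- The product of S and √Δ obeys y ↦ r y + r Γ at most, and every bound that is at least Γ/(1 - r)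
  -- is preserved by this recursion.
  set Y := max (S L * √(Δ L)) (Γ / (1 - r))
  have hbound : ∀ n ≥ L, S n * √(Δ n) ≤ Y := by
    intro n hn
    induction n, hn using Nat.le_induction with
    | base => exact le_max_left _ _
    | succ n hn ih =>
      obtain ⟨hH, hηH, -⟩ := h5 n hn
      have c1 : √(Δ (n + 1)) ≤ r * √(Δ n) := by
        rw [← Real.sqrt_mul hρ0]
        exact Real.sqrt_le_sqrt (hcontr n hn)
      have c2 : √(Δ n) ≤ Γ * H n := by
        refine Real.sqrt_le_iff.2 ⟨by positivity, ?_⟩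
        rw [mul_pow, Real.sq_sqrt (by positivity)]
        have d1 : e n ^ 2 ≤ R ^ 2 * η n ^ 2 := by
          rw [← mul_pow]
          exact pow_le_pow_left₀ (he n) (h2 n hn) 2
        have d2 : η n ^ 2 ≤ H n ^ 2 := pow_le_pow_left₀ (hη n) hηH 2
        calc Δ n ≤ (K⁻¹ + R ^ 2) * η n ^ 2 := by simp only [hΔ]; linarith
          _ ≤ _ := by gcongr
      have c3 : (H n)⁻¹ * √(Δ n) ≤ Γ := by
        rw [inv_mul_le_iff₀ hH, mul_comm]; exact c2
      have hΓ : Γ ≤ (1 - r) * Y := by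
        have := le_max_right (S L * √(Δ L)) (Γ / (1 - r))
        rw [div_le_iff₀ (by linarith)] at this
        linarith
      have hΓ0 : 0 ≤ Γ := Real.sqrt_nonneg _
      calc S (n + 1) * √(Δ (n + 1)) ≤ S (n + 1) * (r * √(Δ n)) :=
            mul_le_mul_of_nonneg_left c1 (hSn _ (by omega))
        _ = r * (S n * √(Δ n)) + r * ((H n)⁻¹ * √(Δ n)) := by rw [h4 n hn]; ring
        _ ≤ r * Y + r * Γ := by gcongr
        _ ≤ r * Y + 1 * Γ := by gcongr
        _ ≤ Y := by linarith
  refine ⟨2 * √K * Y, fun n hn => ?_⟩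
  obtain ⟨hH, -, hH2⟩ := h5 n hn
  rw [← div_eq_mul_inv, le_div_iff₀ hH]
  have c1 : η n ≤ √K * √(Δ n) := by
    rw [← Real.sqrt_mul hK.le]
    refine Real.le_sqrt_of_sq_le ?_
    have : K * Δ n = η n ^ 2 + K * e n ^ 2 := by simp only [hΔ]; field_simp
    rw [this]
    have : 0 ≤ K * e n ^ 2 := by positivity
    linarith
  calc S n * H n ≤ S n * (2 * (√K * √(Δ n))) :=
        mul_le_mul_of_nonneg_left (hH2.trans (by linarith)) (hSn n hn)
    _ = 2 * √K * (S n * √(Δ n)) := by ring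
    _ ≤ _ := by
        gcongr
        exact hbound n hn

end AFEM

namespace AFEM

/-! ### The enumeration of all the iterates -/

namespace AFEMHistory

variable {d : ℕ} {M : ModelProblem d} {p : ℕ} (R : AFEMHistory M p)

open Classical in
/-- The index of the iterate that is computed after the given one. -/
def nextIdx (m : ℕ × ℕ) : ℕ × ℕ := if (m.2 : ℕ∞) < R.kbar m.1 then (m.1, m.2 + 1) else (m.1 + 1, 0)

/-- The index of the `n`-th iterate. -/
def pos : ℕ → ℕ × ℕ
  | 0 => (0, 0)
  | n + 1 => R.nextIdx (pos n)

/-- The set of all the indices up to `m`. -/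
def idxSet (m : ℕ × ℕ) : Set (ℕ × ℕ) := {x | x ∈ R.Q ∧ (x.1 < m.1 ∨ x.1 = m.1 ∧ x.2 ≤ m.2)}

/-- All levels but the last one are finite, and the last one is infinite. -/
structure LevelsTerminate : Prop where
  ne_top : ∀ ℓ : ℕ, (ℓ : ℕ∞) < R.lbar → R.kbar ℓ ≠ ⊤
  eq_top : ∀ ℓ : ℕ, (ℓ : ℕ∞) = R.lbar → R.kbar ℓ = ⊤

variable {R}

namespace LevelsTerminate

lemma nextIdx_of_lt {ℓ k : ℕ} (hk : (k : ℕ∞) < R.kbar ℓ) : R.nextIdx (ℓ, k) = (ℓ, k + 1) :=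
  if_pos hk

lemma nextIdx_of_not_lt {ℓ k : ℕ} (hk : ¬ (k : ℕ∞) < R.kbar ℓ) : R.nextIdx (ℓ, k) = (ℓ + 1, 0) :=
  if_neg hk

lemma level_lt (H : R.LevelsTerminate) {ℓ k : ℕ} (hm : (ℓ, k) ∈ R.Q) (hk : ¬ (k : ℕ∞) < R.kbar ℓ) :
    (ℓ : ℕ∞) < R.lbar ∧ (R.kbar ℓ).toNat = k := by
  have h1 : (k : ℕ∞) = R.kbar ℓ := le_antisymm hm.2 (not_lt.1 hk)
  refine ⟨lt_of_le_of_ne hm.1 fun h => ?_, by rw [← h1]; rfl⟩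
  rw [H.eq_top ℓ h] at h1
  exact ENat.natCast_ne_top k h1

lemma nextIdx_mem (H : R.LevelsTerminate) {m : ℕ × ℕ} (hm : m ∈ R.Q) : R.nextIdx m ∈ R.Q := by
  obtain ⟨ℓ, k⟩ := m
  by_cases hk : (k : ℕ∞) < R.kbar ℓ
  · rw [nextIdx_of_lt hk]
    exact ⟨hm.1, by simpa using Order.add_one_le_of_lt hk⟩
  · rw [nextIdx_of_not_lt hk]
    exact ⟨by simpa using Order.add_one_le_of_lt (H.level_lt hm hk).1, by simp⟩

lemma pos_mem (H : R.LevelsTerminate) (n : ℕ) : R.pos n ∈ R.Q := by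
  induction n with
  | zero => exact ⟨by simp [pos], by simp [pos]⟩
  | succ n ih => exact H.nextIdx_mem ih

/-- The next index is the immediate successor in the lexicographic order of `Q`, so the initial
segment grows by exactly one element. -/
lemma idxSet_nextIdx (H : R.LevelsTerminate) {m : ℕ × ℕ} (hm : m ∈ R.Q) :
    R.idxSet (R.nextIdx m) = insert (R.nextIdx m) (R.idxSet m) ∧ R.nextIdx m ∉ R.idxSet m := by
  have hn := H.nextIdx_mem hm
  obtain ⟨ℓ, k⟩ := m
  by_cases hk : (k : ℕ∞) < R.kbar ℓ
  · rw [nextIdx_of_lt hk] at hn ⊢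
    refine ⟨?_, fun h => ?_⟩
    · ext ⟨i, j⟩
      simp only [idxSet, Set.mem_ofPred_eq, Set.mem_insert_iff, Prod.mk.injEq]
      constructor
      · rintro ⟨h1, h2⟩
        rcases eq_or_ne (i, j) (ℓ, k + 1) with h3 | h3
        · exact Or.inl (Prod.mk.injEq _ _ _ _ ▸ h3)
        · refine Or.inr ⟨h1, ?_⟩
          simp only [ne_eq, Prod.mk.injEq, not_and] at h3
          omega
      · rintro (⟨rfl, rfl⟩ | ⟨h1, h2⟩)
        · exact ⟨hn, by omega⟩
        · exact ⟨h1, by omega⟩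
    · have := h.2
      simp only at this
      omega
  · rw [nextIdx_of_not_lt hk] at hn ⊢
    refine ⟨?_, fun h => ?_⟩
    · ext ⟨i, j⟩
      simp only [idxSet, Set.mem_ofPred_eq, Set.mem_insert_iff, Prod.mk.injEq]
      constructor
      · rintro ⟨h1, h2⟩
        rcases eq_or_ne i (ℓ + 1) with h3 | h3
        · exact Or.inl (by omega)
        · refine Or.inr ⟨h1, ?_⟩
          rcases eq_or_ne i ℓ with rfl | h4
          · refine Or.inr ⟨rfl, ?_⟩
            have h5 := h1.2.trans (not_lt.1 hk)
            exact_mod_cast h5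
          · omega
      · rintro (⟨rfl, rfl⟩ | ⟨h1, h2⟩)
        · exact ⟨hn, by omega⟩
        · exact ⟨h1, by omega⟩
    · have := h.2
      simp only at this
      omega

lemma counter_pos (H : R.LevelsTerminate) (n : ℕ) : R.counter (R.pos n) = n + 1 := by
  -- Finiteness is carried along because `ncard` returns 0 on infinite sets. The offset n + 1 arises
  -- as the counter includes the index itself.
  have h : (R.idxSet (R.pos n)).Finite ∧ (R.idxSet (R.pos n)).ncard = n + 1 := by
    induction n with
    | zero =>
      have h0 : R.idxSet (R.pos 0) = {(0, 0)} := by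
        ext ⟨i, j⟩
        simp only [idxSet, pos, Set.mem_ofPred_eq, Set.mem_singleton_iff, Prod.mk.injEq]
        constructor
        · rintro ⟨-, h⟩; omega
        · rintro ⟨rfl, rfl⟩
          exact ⟨H.pos_mem 0, by omega⟩
      rw [h0]
      exact ⟨Set.finite_singleton _, Set.ncard_singleton _⟩
    | succ n ih =>
      obtain ⟨h1, h2⟩ := H.idxSet_nextIdx (H.pos_mem n)
      rw [pos, h1]
      exact ⟨ih.1.insert _, by rw [Set.ncard_insert_of_notMem h2 ih.1, ih.2]⟩
  exact h.2

lemma exists_pos_eq (H : R.LevelsTerminate) {m : ℕ × ℕ} (hm : m ∈ R.Q) : ∃ n, R.pos n = m := by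
  obtain ⟨ℓ, k⟩ := m
  induction ℓ generalizing k with
  | zero =>
    induction k with
    | zero => exact ⟨0, rfl⟩
    | succ k ih =>
      have hlt : (k : ℕ∞) < R.kbar 0 := lt_of_lt_of_le (by exact_mod_cast k.lt_succ_self) hm.2
      obtain ⟨n, hn⟩ := ih ⟨hm.1, hlt.le⟩
      exact ⟨n + 1, by rw [pos, hn, nextIdx_of_lt hlt]⟩
  | succ ℓ ihℓ =>
    induction k with
    | zero =>
      have hlt : (ℓ : ℕ∞) < R.lbar := lt_of_lt_of_le (by exact_mod_cast ℓ.lt_succ_self) hm.1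
      have hk : ((R.kbar ℓ).toNat : ℕ∞) = R.kbar ℓ := ENat.natCast_toNat (H.ne_top ℓ hlt)
      obtain ⟨n, hn⟩ := ihℓ (R.kbar ℓ).toNat ⟨hlt.le, hk.le⟩
      exact ⟨n + 1, by rw [pos, hn, nextIdx_of_not_lt (by rw [hk]; exact lt_irrefl _)]⟩
    | succ k ih =>
      have hlt : (k : ℕ∞) < R.kbar (ℓ + 1) :=
        lt_of_lt_of_le (by exact_mod_cast k.lt_succ_self) hm.2
      obtain ⟨n, hn⟩ := ih ⟨hm.1, hlt.le⟩
      exact ⟨n + 1, by rw [pos, hn, nextIdx_of_lt hlt]⟩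

lemma sum_pos_eq (H : R.LevelsTerminate) (f : ℕ → ℕ → ℝ) (n : ℕ) :
    ∑ m ∈ Finset.range (n + 1), f (R.pos m).1 (R.pos m).2 =
      ∑ i ∈ Finset.range (R.pos n).1, ∑ j ∈ Finset.range ((R.kbar i).toNat + 1), f i j +
        ∑ j ∈ Finset.range ((R.pos n).2 + 1), f (R.pos n).1 j := by
  induction n with
  | zero => simp [pos]
  | succ n ih =>
    rw [Finset.sum_range_succ, ih]
    have hm := H.pos_mem n
    rw [pos]
    set m := R.pos n
    obtain ⟨ℓ, k⟩ := m
    by_cases hk : (k : ℕ∞) < R.kbar ℓ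
    · rw [nextIdx_of_lt hk]
      simp only
      rw [Finset.sum_range_succ _ (k + 1), add_assoc]
    · rw [nextIdx_of_not_lt hk]
      simp only
      rw [Finset.sum_range_succ _ ℓ, (H.level_lt hm hk).2]
      simp

end LevelsTerminate

/-- Linear convergence follows from linear convergence on the levels and of the final errors. -/
lemma LevelsTerminate.linear_convergence (H : R.LevelsTerminate) {f : ℕ → ℕ → ℝ}
    (hnn : ∀ ℓ k, 0 ≤ f ℓ k) {Cout : ℝ} (hCout : 0 ≤ Cout)
    (hin : ∀ ℓ k : ℕ, (ℓ : ℕ∞) ≤ R.lbar → ((k + 1 : ℕ) : ℕ∞) ≤ R.kbar ℓ → f ℓ k = 0 →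
      f ℓ (k + 1) = 0)
    (hout : ∀ ℓ : ℕ, (ℓ : ℕ∞) < R.lbar → f (ℓ + 1) 0 ≤ Cout * f ℓ (R.kbar ℓ).toNat)
    (hpos : (∀ ℓ k, (ℓ, k) ∈ R.Q → 0 < f ℓ k) →
      (∃ D q : ℝ, 0 ≤ D ∧ 0 ≤ q ∧ q < 1 ∧ ∀ ℓ k' k : ℕ, (ℓ : ℕ∞) ≤ R.lbar → k' ≤ k →
        (k : ℕ∞) ≤ R.kbar ℓ → f ℓ k ≤ D * q ^ (k - k') * f ℓ k') ∧
      ∃ C, 0 ≤ C ∧ ∀ ℓ : ℕ, (ℓ : ℕ∞) < R.lbar →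
        ∑ i ∈ Finset.range (ℓ + 1), (f i (R.kbar i).toNat)⁻¹ ≤ C * (f ℓ (R.kbar ℓ).toNat)⁻¹) :
    ∃ q D : ℝ, 0 < q ∧ q < 1 ∧ 0 < D ∧ ∀ ℓ k ℓ' k' : ℕ, (ℓ, k) ∈ R.Q → (ℓ', k') ∈ R.Q →
      R.counter (ℓ', k') ≤ R.counter (ℓ, k) →
      f ℓ k ≤ D * q ^ (R.counter (ℓ, k) - R.counter (ℓ', k')) * f ℓ' k' := by
  have hfinal : ∀ ℓ : ℕ, (ℓ : ℕ∞) < R.lbar → (ℓ, (R.kbar ℓ).toNat) ∈ R.Q := fun ℓ hℓ =>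
    ⟨hℓ.le, (ENat.natCast_toNat (H.ne_top ℓ hℓ)).le⟩
  have hzero : ∀ n, f (R.pos n).1 (R.pos n).2 = 0 →
      f (R.pos (n + 1)).1 (R.pos (n + 1)).2 = 0 := by
    intro n h0
    have hm := H.pos_mem n
    simp only [pos] at h0 ⊢
    generalize R.pos n = m at h0 hm ⊢
    obtain ⟨ℓ, k⟩ := m
    by_cases hk : (k : ℕ∞) < R.kbar ℓ
    · rw [nextIdx_of_lt hk]
      exact hin ℓ k hm.1 (by simpa using Order.add_one_le_of_lt hk) h0
    · rw [nextIdx_of_not_lt hk]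
      obtain ⟨h1, h2⟩ := H.level_lt hm hk
      have h3 := hout ℓ h1
      simp only at h0
      rw [h2, h0, mul_zero] at h3
      exact le_antisymm h3 (hnn _ _)
  have hsum : (∀ n, 0 < f (R.pos n).1 (R.pos n).2) → ∃ C, ∀ n,
      ∑ m ∈ Finset.range (n + 1), (f (R.pos m).1 (R.pos m).2)⁻¹ ≤
        C * (f (R.pos n).1 (R.pos n).2)⁻¹ := by
    intro hpos'
    have hQpos : ∀ ℓ k, (ℓ, k) ∈ R.Q → 0 < f ℓ k := fun ℓ k hm => by
      obtain ⟨n, hn⟩ := H.exists_pos_eq hm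
      have := hpos' n
      rwa [hn] at this
    obtain ⟨⟨D, q, hD, hq0, hq1, hDq⟩, C, hC, hCsum⟩ := hpos hQpos
    -- Linear decay on a level bounds the reciprocals backwards from k by a geometric series.
    have hlevel : ∀ ℓ k : ℕ, (ℓ, k) ∈ R.Q →
        ∑ j ∈ Finset.range (k + 1), (f ℓ j)⁻¹ ≤ D / (1 - q) * (f ℓ k)⁻¹ := by
      intro ℓ k hm
      have hk := hQpos ℓ k hm
      have h1 : ∀ j ∈ Finset.range (k + 1), (f ℓ j)⁻¹ ≤ D * (f ℓ k)⁻¹ * q ^ (k + 1 - 1 - j) := by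
        intro j hj
        have hjk : j ≤ k := Nat.lt_succ_iff.1 (Finset.mem_range.1 hj)
        have hj0 := hQpos ℓ j ⟨hm.1, le_trans (by exact_mod_cast hjk) hm.2⟩
        have h2 := hDq ℓ j k hm.1 hjk hm.2
        rw [inv_le_iff_one_le_mul₀ hj0, Nat.add_sub_cancel]
        calc (1 : ℝ) = f ℓ k * (f ℓ k)⁻¹ := by field_simp
          _ ≤ (D * q ^ (k - j) * f ℓ j) * (f ℓ k)⁻¹ := by gcongr
          _ = _ := by ring
      refine (Finset.sum_le_sum h1).trans ?_
      rw [Finset.sum_range_reflect (fun j => D * (f ℓ k)⁻¹ * q ^ j), ← Finset.mul_sum]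
      have h2 : ∑ j ∈ Finset.range (k + 1), q ^ j ≤ (1 - q)⁻¹ := by
        rw [← tsum_geometric_of_lt_one hq0 hq1]
        exact (summable_geometric_of_lt_one hq0 hq1).sum_le_tsum _ fun j _ => pow_nonneg hq0 j
      calc D * (f ℓ k)⁻¹ * ∑ j ∈ Finset.range (k + 1), q ^ j ≤ D * (f ℓ k)⁻¹ * (1 - q)⁻¹ := by gcongr
        _ = _ := by ring
    have hD1 : 0 ≤ D / (1 - q) := div_nonneg hD (by linarith)
    refine ⟨D / (1 - q) * (C * Cout * D) + D / (1 - q), fun n => ?_⟩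
    have hm := H.pos_mem n
    rw [H.sum_pos_eq (fun i j => (f i j)⁻¹)]
    generalize R.pos n = m at hm ⊢
    obtain ⟨ℓ, k⟩ := m
    simp only
    rw [add_mul]
    refine add_le_add ?_ (hlevel ℓ k hm)
    have hlt : ∀ i < ℓ, (i : ℕ∞) < R.lbar := fun i hi =>
      lt_of_lt_of_le (by exact_mod_cast hi) hm.1
    have hk := hQpos ℓ k hm
    rcases Nat.eq_zero_or_pos ℓ with rfl | hℓ
    · simp only [Finset.range_zero, Finset.sum_empty]
      positivity
    obtain ⟨i, rfl⟩ : ∃ i, ℓ = i + 1 := ⟨ℓ - 1, by omega⟩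
    -- Each completed level is dominated by its final reciprocal, their sum by the one of the last
    -- completed level i, and passing from there to step k of level i + 1 costs Cout · D.
    have h1 : ∑ j ∈ Finset.range (i + 1), ∑ j' ∈ Finset.range ((R.kbar j).toNat + 1), (f j j')⁻¹ ≤
        ∑ j ∈ Finset.range (i + 1), D / (1 - q) * (f j (R.kbar j).toNat)⁻¹ :=
      Finset.sum_le_sum fun j hj => hlevel j _ (hfinal j (hlt j (Finset.mem_range.1 hj)))
    refine h1.trans ?_
    rw [← Finset.mul_sum, mul_assoc (D / (1 - q))]
    refine mul_le_mul_of_nonneg_left ((hCsum i (hlt i (by omega))).trans ?_) hD1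
    have h2 := hout i (hlt i (by omega))
    have h3 := hDq (i + 1) 0 k hm.1 (by omega) hm.2
    have h4 : q ^ (k - 0) ≤ 1 := pow_le_one₀ hq0 hq1.le
    have h5 : f (i + 1) k ≤ Cout * D * f i (R.kbar i).toNat := by
      calc f (i + 1) k ≤ D * q ^ (k - 0) * f (i + 1) 0 := h3
        _ ≤ D * 1 * (Cout * f i (R.kbar i).toNat) := by
            gcongr
            exact hnn _ _
        _ = _ := by ring
    have h6 := hQpos i _ (hfinal i (hlt i (by omega)))
    rw [mul_assoc C, mul_assoc C]
    refine mul_le_mul_of_nonneg_left ?_ hC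
    rw [inv_le_iff_one_le_mul₀ h6]
    calc (1 : ℝ) = f (i + 1) k * (f (i + 1) k)⁻¹ := by field_simp
      _ ≤ (Cout * D * f i (R.kbar i).toNat) * (f (i + 1) k)⁻¹ := by gcongr
      _ = _ := by ring
  obtain ⟨q, D, hq0, hq1, hD, h⟩ := linear_convergence_of_nonneg (fun n => hnn _ _) hzero hsum
  refine ⟨q, D, hq0, hq1, hD, fun ℓ k ℓ' k' hm hm' hc => ?_⟩
  obtain ⟨n, hn⟩ := H.exists_pos_eq hm
  obtain ⟨n', hn'⟩ := H.exists_pos_eq hm'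
  rw [← hn, ← hn', H.counter_pos, H.counter_pos] at hc ⊢
  have := h n' n (by omega)
  simp only [hn, hn'] at this
  rwa [Nat.add_sub_add_right]

end AFEMHistory

end AFEM

namespace AFEM

/-! ### Estimates on one level -/

lemma exists_mem_forall_mem_eq {V : Type*} [NormedAddCommGroup V] [InnerProductSpace ℝ V]
    {B : V →L[ℝ] V →L[ℝ] ℝ} (hB : IsCoercive B) (L : V →L[ℝ] ℝ) (X : Submodule ℝ V)
    [CompleteSpace X] : ∃ u ∈ X, ∀ v ∈ X, B u v = L v := by
  let B' : X →L[ℝ] X →L[ℝ] ℝ := B.bilinearComp X.subtypeL X.subtypeL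
  have hB' : IsCoercive B' := by
    obtain ⟨c, hc, h⟩ := hB
    exact ⟨c, hc, fun v => h v⟩
  let A := hB'.continuousLinearEquivOfBilin
  let u : X := A.symm ((InnerProductSpace.toDual ℝ X).symm (L.comp X.subtypeL))
  refine ⟨u, u.2, fun v hv => ?_⟩
  have h1 := hB'.continuousLinearEquivOfBilin_apply u ⟨v, hv⟩
  change ⟪A (A.symm _), _⟫ = B u v at h1
  rw [A.apply_symm_apply, InnerProductSpace.toDual_symm_apply] at h1
  exact h1.symm

lemma ModelProblem.exists_isGalerkinSol {d : ℕ} [NeZero d] (M : ModelProblem d)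
    (hΩ : Bornology.IsBounded M.Ω) (X : Submodule ℝ (H01 M.Ω)) [FiniteDimensional ℝ X] :
    ∃ u, M.IsGalerkinSol X u := by
  have hX := FiniteDimensional.complete ℝ X
  obtain ⟨u, hu, h⟩ := exists_mem_forall_mem_eq (M.isCoercive_bilL hΩ) M.loadL X
  exact ⟨u, hu, fun v hv => by rw [← M.bilL_apply, ← M.loadL_apply, h v hv]⟩

lemma abs_precForm_le {N : ℕ} {P : Matrix (Fin N) (Fin N) ℝ} (hP : P.PosDef) (y z : Fin N → ℝ) :
    |precForm P y z| ≤ precNorm P y * precNorm P z := by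
  refine abs_le_of_sq_le_sq ?_ (mul_nonneg (precNorm_nonneg _ _) (precNorm_nonneg _ _))
  rw [mul_pow, precNorm_sq hP, precNorm_sq hP]
  exact LinearMap.BilinForm.apply_sq_le_of_symm _ (precForm_nonneg hP) ⟨precForm_symm hP⟩ y z

namespace AFEMHistory

variable {d : ℕ} {M : ModelProblem d} {p : ℕ} (R : AFEMHistory M p)

/-- The finite element space on level `ℓ`. -/
abbrev X (ℓ : ℕ) : Submodule ℝ (H01 M.Ω) := feSpace M.Ω p (R.mesh ℓ)

lemma toFn_mem (ℓ : ℕ) (y : Fin (R.N ℓ) → ℝ) : R.toFn ℓ y ∈ R.X ℓ :=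
  Submodule.sum_mem _ fun j _ => Submodule.smul_mem _ _ (R.basis ℓ j).2

lemma u_mem (ℓ k : ℕ) : R.u ℓ k ∈ R.X ℓ := R.toFn_mem ℓ _

lemma exists_toFn_eq {ℓ : ℕ} {v : H01 M.Ω} (hv : v ∈ R.X ℓ) : ∃ y, R.toFn ℓ y = v := by
  refine ⟨(R.basis ℓ).repr ⟨v, hv⟩, ?_⟩
  have h := congrArg Subtype.val ((R.basis ℓ).sum_repr ⟨v, hv⟩)
  rw [Submodule.coe_sum] at h
  exact h

lemma bil_toFn (ℓ : ℕ) (y z : Fin (R.N ℓ) → ℝ) :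
    M.bil (R.toFn ℓ y) (R.toFn ℓ z) = (R.galerkinMatrix ℓ *ᵥ y) ⬝ᵥ z := by
  simp only [← M.bilL_apply, toFn, map_sum, map_smul, FunLike.coe_sum,
    Finset.sum_apply, smul_apply, smul_eq_mul, dotProduct, Matrix.mulVec, galerkinMatrix,
    Matrix.of_apply, Finset.sum_mul, Finset.mul_sum]
  refine Finset.sum_congr rfl fun i _ => Finset.sum_congr rfl fun j _ => ?_
  ring

lemma load_toFn (ℓ : ℕ) (z : Fin (R.N ℓ) → ℝ) :
    M.load (R.toFn ℓ z) = R.loadVector ℓ ⬝ᵥ z := by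
  simp only [← M.loadL_apply, toFn, map_sum, map_smul, smul_eq_mul, dotProduct, loadVector]
  exact Finset.sum_congr rfl fun i _ => mul_comm _ _

/-- The standing assumptions on the levels of a run, with explicit constants; `U ℓ` is the Galerkin
solution on level `ℓ`. -/
structure LevelData (kmax : ℕ) (Cb Cpre : ℝ) (U : ℕ → H01 M.Ω) : Prop where
  kmax_pos : 1 ≤ kmax
  Cb_ge : 1 ≤ Cb
  bil_le : ∀ v w : H01 M.Ω, |M.bil v w| ≤ Cb * M.energyNorm v * M.energyNorm w
  Cpre_ge : 1 ≤ Cpre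
  posDef : ∀ ℓ : ℕ, (ℓ : ℕ∞) ≤ R.lbar → (R.P ℓ).PosDef
  pre_le : ∀ ℓ : ℕ, (ℓ : ℕ∞) ≤ R.lbar → ∀ y, precNorm (R.P ℓ) y ≤ Cpre * M.energyNorm (R.toFn ℓ y)
  le_pre : ∀ ℓ : ℕ, (ℓ : ℕ∞) ≤ R.lbar → ∀ y, M.energyNorm (R.toFn ℓ y) ≤ Cpre * precNorm (R.P ℓ) y
  galerkin : ∀ ℓ : ℕ, (ℓ : ℕ∞) ≤ R.lbar → M.IsGalerkinSol (R.X ℓ) (U ℓ)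
  gmres : ∀ ℓ : ℕ, (ℓ : ℕ∞) ≤ R.lbar → ∃ I, IsGMRES (R.galerkinMatrix ℓ) (R.P ℓ) (R.loadVector ℓ)
    kmax (R.kbar ℓ) (R.x ℓ) I

/-- The norm of the preconditioned residual. -/
def resNorm (ℓ k : ℕ) : ℝ := precNorm (R.P ℓ) (R.s ℓ k)

lemma resNorm_nonneg (ℓ k : ℕ) : 0 ≤ R.resNorm ℓ k := precNorm_nonneg _ _

lemma quasiError_eq [NeZero d] (ℓ k : ℕ) :
    R.quasiError ℓ k = M.eta (R.mesh ℓ) (R.u ℓ k) + R.resNorm ℓ k := rfl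

lemma quasiError_nonneg [NeZero d] (ℓ k : ℕ) : 0 ≤ R.quasiError ℓ k :=
  add_nonneg (M.eta_nonneg _ _) (R.resNorm_nonneg ℓ k)

namespace LevelData

variable {R} {kmax : ℕ} {Cb Cpre : ℝ} {U : ℕ → H01 M.Ω} {ℓ : ℕ}

/-- The inverse preconditioner in the form cancels the one in the residual. What remains is the
algebraic residual, which the Galerkin equation identifies with a functional of the algebraic error.
-/
lemma precForm_s (H : R.LevelData kmax Cb Cpre U) (hℓ : (ℓ : ℕ∞) ≤ R.lbar) (k : ℕ)
    (z : Fin (R.N ℓ) → ℝ) :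
    precForm (R.P ℓ) (R.s ℓ k) z = M.bil (U ℓ - R.u ℓ k) (R.toFn ℓ z) := by
  rw [s, precForm_mulVec_left (H.posDef ℓ hℓ), sub_dotProduct, ← load_toFn, ← bil_toFn,
    M.bil_sub_left, (H.galerkin ℓ hℓ).2 _ (R.toFn_mem ℓ z)]
  rfl

/-- Test the residual functional with the residual itself and use continuity of b. -/
lemma resNorm_le (H : R.LevelData kmax Cb Cpre U) (hℓ : (ℓ : ℕ∞) ≤ R.lbar) (k : ℕ) :
    R.resNorm ℓ k ≤ Cb * Cpre * M.energyNorm (U ℓ - R.u ℓ k) := by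
  have hs := R.resNorm_nonneg ℓ k
  have he := M.energyNorm_nonneg (U ℓ - R.u ℓ k)
  have hCb := H.Cb_ge
  have hCpre := H.Cpre_ge
  have h1 : R.resNorm ℓ k ^ 2 ≤ Cb * Cpre * M.energyNorm (U ℓ - R.u ℓ k) * R.resNorm ℓ k := by
    rw [resNorm, precNorm_sq (H.posDef ℓ hℓ), H.precForm_s hℓ]
    refine (le_abs_self _).trans ((H.bil_le _ _).trans ?_)
    calc _ ≤ Cb * M.energyNorm (U ℓ - R.u ℓ k) * (Cpre * precNorm (R.P ℓ) (R.s ℓ k)) := by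
          gcongr
          exact H.le_pre ℓ hℓ _
      _ = _ := by ring
  rcases hs.eq_or_lt with h0 | h0
  · rw [← h0]; positivity
  · rw [pow_two] at h1
    exact le_of_mul_le_mul_right h1 h0

/-- Test the residual functional with the algebraic error itself and use ellipticity of b. -/
lemma energyNorm_sub_le (H : R.LevelData kmax Cb Cpre U) (hℓ : (ℓ : ℕ∞) ≤ R.lbar) (k : ℕ) :
    M.energyNorm (U ℓ - R.u ℓ k) ≤ Cpre * R.resNorm ℓ k := by
  have hs := R.resNorm_nonneg ℓ k
  have he := M.energyNorm_nonneg (U ℓ - R.u ℓ k)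
  have hCpre := H.Cpre_ge
  have h1 : M.energyNorm (U ℓ - R.u ℓ k) ^ 2 ≤
      Cpre * R.resNorm ℓ k * M.energyNorm (U ℓ - R.u ℓ k) := by
    refine (M.energyNorm_sq_le_bil _).trans ?_
    obtain ⟨z, hz⟩ := R.exists_toFn_eq
      ((R.X ℓ).sub_mem (H.galerkin ℓ hℓ).1 (R.u_mem ℓ k))
    have h2 := H.precForm_s hℓ k z
    rw [hz] at h2
    rw [← h2]
    refine (le_abs_self _).trans ((abs_precForm_le (H.posDef ℓ hℓ) _ z).trans ?_)
    have h3 := H.pre_le ℓ hℓ z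
    rw [hz] at h3
    calc _ ≤ R.resNorm ℓ k * (Cpre * M.energyNorm (U ℓ - R.u ℓ k)) := by
          rw [resNorm] at hs ⊢
          gcongr
      _ = _ := by ring
  rcases he.eq_or_lt with h0 | h0
  · rw [← h0]; positivity
  · rw [pow_two] at h1
    exact le_of_mul_le_mul_right h1 h0

lemma mul_precForm_le (H : R.LevelData kmax Cb Cpre U) (hℓ : (ℓ : ℕ∞) ≤ R.lbar)
    (y : Fin (R.N ℓ) → ℝ) :
    (Cpre ^ 2)⁻¹ * precForm (R.P ℓ) y y ≤ (R.galerkinMatrix ℓ *ᵥ y) ⬝ᵥ y := by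
  have hCpre := H.Cpre_ge
  rw [← bil_toFn, ← precNorm_sq (H.posDef ℓ hℓ)]
  refine le_trans ?_ (M.energyNorm_sq_le_bil _)
  rw [inv_mul_le_iff₀ (by positivity), ← mul_pow]
  exact pow_le_pow_left₀ (precNorm_nonneg _ _) (H.pre_le ℓ hℓ y) 2

lemma precForm_precOp_le (H : R.LevelData kmax Cb Cpre U) (hℓ : (ℓ : ℕ∞) ≤ R.lbar)
    (y : Fin (R.N ℓ) → ℝ) :
    precForm (R.P ℓ) (precOp (R.galerkinMatrix ℓ) (R.P ℓ) y)
      (precOp (R.galerkinMatrix ℓ) (R.P ℓ) y) ≤ (2 * Cb * Cpre ^ 2) ^ 2 * precForm (R.P ℓ) y y := by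
  have hCb := H.Cb_ge
  have hCpre := H.Cpre_ge
  set w := precOp (R.galerkinMatrix ℓ) (R.P ℓ) y with hw
  have hwn := precNorm_nonneg (R.P ℓ) w
  have hyn := precNorm_nonneg (R.P ℓ) y
  have h1 : precNorm (R.P ℓ) w ^ 2 ≤ Cb * Cpre ^ 2 * precNorm (R.P ℓ) y * precNorm (R.P ℓ) w := by
    rw [precNorm_sq (H.posDef ℓ hℓ)]
    conv_lhs => rw [hw, precOp_apply, precForm_mulVec_left (H.posDef ℓ hℓ), ← bil_toFn]
    rw [← precOp_apply, ← hw]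
    have := M.energyNorm_nonneg (R.toFn ℓ w)
    have := M.energyNorm_nonneg (R.toFn ℓ y)
    refine (le_abs_self _).trans ((H.bil_le _ _).trans ?_)
    calc _ ≤ Cb * (Cpre * precNorm (R.P ℓ) y) * (Cpre * precNorm (R.P ℓ) w) := by
          gcongr
          · exact H.le_pre ℓ hℓ _
          · exact H.le_pre ℓ hℓ _
      _ = _ := by ring
  -- The superfluous factor 2 makes the lower bound strictly smaller than the upper one, which keeps
  -- the GMRES rate positive and thus invertible.
  have h2 : precNorm (R.P ℓ) w ≤ 2 * Cb * Cpre ^ 2 * precNorm (R.P ℓ) y := by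
    have h3 : precNorm (R.P ℓ) w ≤ Cb * Cpre ^ 2 * precNorm (R.P ℓ) y := by
      rcases hwn.eq_or_lt with h0 | h0
      · rw [← h0]; positivity
      · rw [pow_two (precNorm (R.P ℓ) w)] at h1
        exact le_of_mul_le_mul_right h1 h0
    have : 0 ≤ Cb * Cpre ^ 2 * precNorm (R.P ℓ) y := by positivity
    linarith
  rw [← precNorm_sq (H.posDef ℓ hℓ), ← precNorm_sq (H.posDef ℓ hℓ), ← mul_pow]
  exact pow_le_pow_left₀ hwn h2 2

/-- The residuals decay linearly on each level. -/
lemma exists_resNorm_le (H : R.LevelData kmax Cb Cpre U) :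
    ∃ q D : ℝ, 0 < q ∧ q < 1 ∧ 1 ≤ D ∧ ∀ ℓ k' k : ℕ, (ℓ : ℕ∞) ≤ R.lbar → k' ≤ k →
      (k : ℕ∞) ≤ R.kbar ℓ → R.resNorm ℓ k ≤ D * q ^ (k - k') * R.resNorm ℓ k' := by
  have hCb := H.Cb_ge
  have hCpre := H.Cpre_ge
  have hc : 0 < (Cpre ^ 2)⁻¹ := by positivity
  have hΛ : 0 < 2 * Cb * Cpre ^ 2 := by positivity
  have hcΛ : (Cpre ^ 2)⁻¹ < 2 * Cb * Cpre ^ 2 := by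
    have h1 : (Cpre ^ 2)⁻¹ ≤ 1 := inv_le_one_of_one_le₀ (one_le_pow₀ hCpre)
    have h2 : 1 ≤ Cpre ^ 2 := one_le_pow₀ hCpre
    nlinarith
  set t := (Cpre ^ 2)⁻¹ / (2 * Cb * Cpre ^ 2)
  have ht0 : 0 < t := div_pos hc hΛ
  have ht1 : t ^ 2 < 1 := pow_lt_one₀ ht0.le ((div_lt_one hΛ).2 hcΛ) (by norm_num)
  have hq0 : 0 < √(1 - t ^ 2) := Real.sqrt_pos.2 (by linarith)
  have hq1 : √(1 - t ^ 2) < 1 := by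
    rw [Real.sqrt_lt' one_pos]
    nlinarith [pow_pos ht0 2]
  refine ⟨√(1 - t ^ 2), (√(1 - t ^ 2) ^ kmax)⁻¹, hq0, hq1,
    (one_le_inv₀ (pow_pos hq0 _)).2 (pow_le_one₀ hq0.le hq1.le), fun ℓ k' k hℓ hk hb => ?_⟩
  obtain ⟨I, hI⟩ := H.gmres ℓ hℓ
  exact hI.precNorm_le H.kmax_pos (H.posDef ℓ hℓ) hc.le hΛ hcΛ (H.mul_precForm_le hℓ)
    (H.precForm_precOp_le hℓ) hk hb

lemma resNorm_antitone (H : R.LevelData kmax Cb Cpre U) (hℓ : (ℓ : ℕ∞) ≤ R.lbar) {k' k : ℕ}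
    (hk : k' ≤ k) (hb : (k : ℕ∞) ≤ R.kbar ℓ) : R.resNorm ℓ k ≤ R.resNorm ℓ k' := by
  obtain ⟨I, hI⟩ := H.gmres ℓ hℓ
  exact hI.precNorm_antitone H.kmax_pos (H.posDef ℓ hℓ) hk hb

end LevelData

end AFEMHistory

end AFEM

/-! ### Estimates across levels and contraction for small solver tolerances -/

namespace AFEM

/-- Céa's lemma. -/
lemma ModelProblem.energyNorm_sub_galerkin_le {d : ℕ} [NeZero d] (M : ModelProblem d) {Cb : ℝ}
    (hCb : 0 ≤ Cb)
    (hb : ∀ v w : H01 M.Ω, |M.bil v w| ≤ Cb * M.energyNorm v * M.energyNorm w)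
    {X : Submodule ℝ (H01 M.Ω)} {u U v : H01 M.Ω} (hu : M.IsWeakSol u) (hU : M.IsGalerkinSol X U)
    (hv : v ∈ X) : M.energyNorm (u - U) ≤ Cb * M.energyNorm (u - v) := by
  have he := M.energyNorm_nonneg (u - U)
  have hv' := M.energyNorm_nonneg (u - v)
  have h1 : M.energyNorm (u - U) ^ 2 ≤ Cb * M.energyNorm (u - v) * M.energyNorm (u - U) := by
    have h0 : M.bil (u - U) (v - U) = 0 := by
      rw [M.bil_sub_left, hu, hU.2 _ (X.sub_mem hv hU.1), sub_self]
    have h2 : M.bil (u - U) (u - U) = M.bil (u - U) (u - v) := by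
      rw [← sub_add_sub_cancel u v U, M.bil_add_right, sub_add_sub_cancel, h0, add_zero]
    refine (M.energyNorm_sq_le_bil _).trans ?_
    rw [h2]
    refine (le_abs_self _).trans ((hb _ _).trans (le_of_eq ?_))
    ring
  rcases he.eq_or_lt with h0 | h0
  · rw [← h0]; positivity
  · rw [pow_two] at h1
    exact le_of_mul_le_mul_right h1 h0

namespace AFEMHistory

variable {d : ℕ} {M : ModelProblem d} {p : ℕ} (R : AFEMHistory M p)

lemma succ_le_lbar {ℓ : ℕ} (h : (ℓ : ℕ∞) < R.lbar) : ((ℓ + 1 : ℕ) : ℕ∞) ≤ R.lbar := by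
  rw [Nat.cast_add, Nat.cast_one]
  exact Order.add_one_le_of_lt h

variable [NeZero d]

/-- The error estimator of an iterate. -/
def est (ℓ k : ℕ) : ℝ := M.eta (R.mesh ℓ) (R.u ℓ k)

/-- The error estimator of the final iterate on a level. -/
def finalEst (ℓ : ℕ) : ℝ := R.est ℓ (R.kbar ℓ).toNat

lemma est_nonneg (ℓ k : ℕ) : 0 ≤ R.est ℓ k := M.eta_nonneg _ _

/-- The properties of a run that enter the convergence analysis, with explicit constants; `w` is the
weak solution and `U ℓ` is the Galerkin solution on level `ℓ`. -/
structure RunData (𝒯₀ : Finset (TSimplex d)) (kmax : ℕ) (Cb Cpre Cstab qred Crel a : ℝ)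
    (w : H01 M.Ω) (U : ℕ → H01 M.Ω) : Prop extends R.LevelData kmax Cb Cpre U where
  weakSol : M.IsWeakSol w
  axioms_ : M.Axioms p 𝒯₀ Cstab qred
  Crel_pos : 0 < Crel
  reliability : ∀ ℓ : ℕ, (ℓ : ℕ∞) ≤ R.lbar →
    M.energyNorm (w - U ℓ) ≤ Crel * M.eta (R.mesh ℓ) (U ℓ)
  isRefinement : ∀ ℓ : ℕ, (ℓ : ℕ∞) ≤ R.lbar → IsRefinement 𝒯₀ 𝒯₀ (R.mesh ℓ)
  isRefinement_succ : ∀ ℓ : ℕ, (ℓ : ℕ∞) < R.lbar → IsRefinement 𝒯₀ (R.mesh ℓ) (R.mesh (ℓ + 1))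
  a_lt : a < 1
  reduction : ∀ ℓ : ℕ, (ℓ : ℕ∞) < R.lbar → M.eta (R.mesh (ℓ + 1)) (R.uFinal ℓ) ^ 2 ≤
    a * R.finalEst ℓ ^ 2
  one_le_kbar : ∀ ℓ : ℕ, (ℓ : ℕ∞) ≤ R.lbar → 1 ≤ R.kbar ℓ
  stopping_iff : ∀ ℓ k : ℕ, (ℓ : ℕ∞) ≤ R.lbar → 1 ≤ k → (k : ℕ∞) ≤ R.kbar ℓ →
    (R.resNorm ℓ k ≤ R.lam ℓ * R.est ℓ k ↔ (k : ℕ∞) = R.kbar ℓ)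
  nested_ : ∀ ℓ : ℕ, (ℓ : ℕ∞) < R.lbar → R.u (ℓ + 1) 0 = R.uFinal ℓ
  terminates : R.LevelsTerminate

namespace RunData

variable {R} {𝒯₀ : Finset (TSimplex d)} {kmax : ℕ} {Cb Cpre Cstab qred Crel a : ℝ} {w : H01 M.Ω}
  {U : ℕ → H01 M.Ω} {ℓ : ℕ}

/-- Two iterates on a level differ by at most the sum of their algebraic errors, each controlled by
the earlier residual because residuals do not increase. Stability carries this over to the
estimator. -/
lemma est_le (H : R.RunData 𝒯₀ kmax Cb Cpre Cstab qred Crel a w U) (hℓ : (ℓ : ℕ∞) ≤ R.lbar)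
    {k' k : ℕ} (hk : k' ≤ k) (hb : (k : ℕ∞) ≤ R.kbar ℓ) :
    R.est ℓ k ≤ R.est ℓ k' + 2 * Cstab * Cpre * R.resNorm ℓ k' := by
  have h1 := H.axioms_.eta_le (H.isRefinement ℓ hℓ) (R.u_mem ℓ k) (R.u_mem ℓ k')
  have h2 := M.energyNorm_sub_le (R.u ℓ k) (U ℓ) (R.u ℓ k')
  rw [M.energyNorm_sub_comm (R.u ℓ k) (U ℓ)] at h2
  have h3 := H.energyNorm_sub_le hℓ k
  have h4 := H.energyNorm_sub_le hℓ k'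
  have h5 := mul_le_mul_of_nonneg_left (H.resNorm_antitone hℓ hk hb)
    (zero_le_one.trans H.Cpre_ge)
  have h6 : M.energyNorm (R.u ℓ k - R.u ℓ k') ≤ 2 * Cpre * R.resNorm ℓ k' := by linarith
  have h7 := mul_le_mul_of_nonneg_left h6 H.axioms_.Cstab_pos.le
  rw [est, est]
  linarith

lemma quasiError_le (H : R.RunData 𝒯₀ kmax Cb Cpre Cstab qred Crel a w U)
    (hℓ : (ℓ : ℕ∞) ≤ R.lbar) {k' k : ℕ} (hk : k' ≤ k) (hb : (k : ℕ∞) ≤ R.kbar ℓ) :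
    R.quasiError ℓ k ≤ (1 + 2 * Cstab * Cpre) * R.quasiError ℓ k' := by
  have h1 := H.est_le hℓ hk hb
  have h2 := H.resNorm_antitone hℓ hk hb
  have h3 : 0 ≤ 2 * Cstab * Cpre := by
    have := H.axioms_.Cstab_pos
    have := H.Cpre_ge
    positivity
  have h4 := mul_nonneg h3 (R.est_nonneg ℓ k')
  rw [quasiError_eq, quasiError_eq]
  rw [est] at *
  rw [est] at h1
  linarith

lemma energyNorm_sub_uFinal_le (H : R.RunData 𝒯₀ kmax Cb Cpre Cstab qred Crel a w U)
    (hℓ : (ℓ : ℕ∞) ≤ R.lbar) :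
    M.energyNorm (w - U ℓ) ≤
      Crel * (R.finalEst ℓ + Cstab * M.energyNorm (U ℓ - R.uFinal ℓ)) :=
  (H.reliability ℓ hℓ).trans (mul_le_mul_of_nonneg_left
    (H.axioms_.eta_le (H.isRefinement ℓ hℓ) (H.galerkin ℓ hℓ).1 (R.u_mem ℓ _)) H.Crel_pos.le)

/-- The old final iterate starts the new level. Its estimator does not grow under refinement, and
its distance to the new Galerkin solution is at most 1 + Cb times its total error by Céa's lemma.
Reliability on the old level bounds that total error. -/
lemma quasiError_succ_le (H : R.RunData 𝒯₀ kmax Cb Cpre Cstab qred Crel a w U)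
    (hℓ : (ℓ : ℕ∞) < R.lbar) : R.quasiError (ℓ + 1) 0 ≤
      (1 + Cb * Cpre * ((1 + Cb) * (Crel + Crel * Cstab * Cpre + Cpre))) * R.finalError ℓ := by
  have hs := R.succ_le_lbar hℓ
  have h𝒯 := H.isRefinement_succ ℓ hℓ
  have hCb := H.Cb_ge
  have hCpre := H.Cpre_ge
  have hCstab := H.axioms_.Cstab_pos
  have hCrel := H.Crel_pos
  have hmem : R.uFinal ℓ ∈ R.X ℓ := R.u_mem ℓ _
  set r := R.resNorm ℓ (R.kbar ℓ).toNat with hr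
  have hr0 : 0 ≤ r := R.resNorm_nonneg _ _
  have hη0 : 0 ≤ R.finalEst ℓ := R.est_nonneg _ _
  have hf : R.finalError ℓ = R.finalEst ℓ + r := rfl
  have h1 : M.eta (R.mesh (ℓ + 1)) (R.uFinal ℓ) ≤ R.finalEst ℓ :=
    H.axioms_.eta_refine_le (H.isRefinement ℓ hℓ.le) h𝒯 hmem
  have h2 := H.resNorm_le hs 0
  rw [H.nested_ ℓ hℓ] at h2
  have h3 : M.energyNorm (U ℓ - R.uFinal ℓ) ≤ Cpre * r := H.energyNorm_sub_le hℓ.le _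
  have h4 := H.energyNorm_sub_uFinal_le hℓ.le
  have h5 := M.energyNorm_sub_galerkin_le (zero_le_one.trans hCb) H.bil_le H.weakSol
    (H.galerkin _ hs) (h𝒯.feSpace_le M.Ω p hmem)
  have h6 := M.energyNorm_sub_le (U (ℓ + 1)) w (R.uFinal ℓ)
  rw [M.energyNorm_sub_comm _ w] at h6
  have h7 := M.energyNorm_sub_le w (U ℓ) (R.uFinal ℓ)
  have h8 : M.energyNorm (w - R.uFinal ℓ) ≤
      (Crel + Crel * Cstab * Cpre + Cpre) * R.finalError ℓ := by
    rw [hf]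
    have : Crel * (R.finalEst ℓ + Cstab * M.energyNorm (U ℓ - R.uFinal ℓ)) ≤
        Crel * (R.finalEst ℓ + Cstab * (Cpre * r)) := by gcongr
    have e1 : 0 ≤ Crel * r := by positivity
    have e2 : 0 ≤ Crel * Cstab * Cpre * R.finalEst ℓ := by positivity
    have e3 : 0 ≤ Cpre * R.finalEst ℓ := by positivity
    linarith
  have h9 : R.resNorm (ℓ + 1) 0 ≤ Cb * Cpre *
      ((1 + Cb) * ((Crel + Crel * Cstab * Cpre + Cpre) * R.finalError ℓ)) := by
    refine h2.trans ?_
    gcongr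
    have := mul_le_mul_of_nonneg_left h8 (show 0 ≤ 1 + Cb by linarith)
    linarith
  rw [quasiError_eq, H.nested_ ℓ hℓ]
  linarith

/-- Linear convergence on each level if the solver tolerances are bounded from below. -/
lemma exists_quasiError_le (H : R.RunData 𝒯₀ kmax Cb Cpre Cstab qred Crel a w U) {lam₀ : ℝ}
    (hlam₀ : 0 < lam₀) (hlam : ∀ ℓ : ℕ, (ℓ : ℕ∞) ≤ R.lbar → lam₀ ≤ R.lam ℓ) :
    ∃ D q : ℝ, 0 ≤ D ∧ 0 ≤ q ∧ q < 1 ∧ ∀ ℓ k' k : ℕ, (ℓ : ℕ∞) ≤ R.lbar → k' ≤ k →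
      (k : ℕ∞) ≤ R.kbar ℓ → R.quasiError ℓ k ≤ D * q ^ (k - k') * R.quasiError ℓ k' := by
  obtain ⟨q, D, hq0, hq1, hD, h⟩ := H.exists_resNorm_le
  have hC : 1 ≤ 1 + 2 * Cstab * Cpre := by
    have := H.axioms_.Cstab_pos
    have := H.Cpre_ge
    have : 0 ≤ 2 * Cstab * Cpre := by positivity
    linarith
  set C := 1 + 2 * Cstab * Cpre with hCdef
  set D' := (1 + lam₀⁻¹) * D with hD'
  have hD1 : 1 ≤ D' := by
    have := inv_nonneg.2 hlam₀.le
    nlinarith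
  -- Before termination the stopping test fails, so the estimator is at most lam₀⁻¹ times the
  -- residual. The test is not made for k = 0, but then k' = 0 too.
  have hlt : ∀ ℓ k' k : ℕ, (ℓ : ℕ∞) ≤ R.lbar → k' ≤ k → (k : ℕ∞) < R.kbar ℓ →
      R.quasiError ℓ k ≤ D' * q ^ (k - k') * R.quasiError ℓ k' := by
    intro ℓ k' k hℓ hk hb
    have hH := R.quasiError_nonneg ℓ k'
    rcases Nat.eq_zero_or_pos k with rfl | hk0
    · obtain rfl : k' = 0 := by omega
      simpa using le_mul_of_one_le_left hH hD1
    have h1 : R.lam ℓ * R.est ℓ k < R.resNorm ℓ k := by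
      by_contra! h0
      exact hb.ne ((H.stopping_iff ℓ k hℓ hk0 hb.le).1 h0)
    have h2 : R.est ℓ k ≤ lam₀⁻¹ * R.resNorm ℓ k := by
      rw [← div_eq_inv_mul, le_div_iff₀ hlam₀, mul_comm]
      exact (mul_le_mul_of_nonneg_right (hlam ℓ hℓ) (R.est_nonneg ℓ k)).trans h1.le
    have h3 : R.resNorm ℓ k' ≤ R.quasiError ℓ k' := le_add_of_nonneg_left (R.est_nonneg ℓ k')
    calc R.quasiError ℓ k = R.est ℓ k + R.resNorm ℓ k := rfl
      _ ≤ (1 + lam₀⁻¹) * R.resNorm ℓ k := by linarith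
      _ ≤ (1 + lam₀⁻¹) * (D * q ^ (k - k') * R.quasiError ℓ k') := by
          gcongr
          exact (h ℓ k' k hℓ hk hb.le).trans (by gcongr)
      _ = _ := by rw [hD']; ring
  have hDle : D' ≤ C * D' / q := by
    rw [le_div_iff₀ hq0]
    nlinarith
  -- At the last step the stopping test holds. It is reached from the step before by
  -- quasi-monotonicity with factor C, and dividing by q makes up for the missing contraction.
  refine ⟨C * D' / q, q, by positivity, hq0.le, hq1, fun ℓ k' k hℓ hk hb => ?_⟩
  have hH := R.quasiError_nonneg ℓ k'
  rcases hb.lt_or_eq with hb' | hb'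
  · exact (hlt ℓ k' k hℓ hk hb').trans (by gcongr)
  rcases hk.eq_or_lt with rfl | hk'
  · rw [Nat.sub_self, pow_zero, mul_one]
    exact le_mul_of_one_le_left hH (hD1.trans hDle)
  obtain ⟨m, rfl⟩ := Nat.exists_eq_add_of_lt hk'
  have hm : ((k' + m : ℕ) : ℕ∞) < R.kbar ℓ :=
    lt_of_lt_of_le (by exact_mod_cast Nat.lt_succ_self _) hb
  have h1 := H.quasiError_le hℓ (Nat.le_succ (k' + m)) hb
  have h2 := hlt ℓ k' (k' + m) hℓ (Nat.le_add_right _ _) hm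
  have e1 : k' + m - k' = m := by omega
  have e2 : k' + m + 1 - k' = m + 1 := by omega
  rw [e1] at h2
  rw [e2, pow_succ]
  calc _ ≤ C * (D' * q ^ m * R.quasiError ℓ k') := h1.trans (by gcongr)
    _ = _ := by field_simp

lemma resNorm_final_le (H : R.RunData 𝒯₀ kmax Cb Cpre Cstab qred Crel a w U)
    (hℓ : (ℓ : ℕ∞) < R.lbar) :
    R.resNorm ℓ (R.kbar ℓ).toNat ≤ R.lam ℓ * R.finalEst ℓ := by
  have h1 : ((R.kbar ℓ).toNat : ℕ∞) = R.kbar ℓ := ENat.natCast_toNat (H.terminates.ne_top ℓ hℓ)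
  refine (H.stopping_iff ℓ _ hℓ.le ?_ h1.le).2 h1
  have h2 := H.one_le_kbar ℓ hℓ.le
  rw [← h1] at h2
  exact_mod_cast h2

/-- If the solver tolerances become small enough, the sum of the reciprocals of the final errors is
controlled. -/
lemma exists_sum_inv_le (H : R.RunData 𝒯₀ kmax Cb Cpre Cstab qred Crel a w U)
    (hΩ : Bornology.IsBounded M.Ω) (hlbar : R.lbar = ⊤) (hpos : ∀ ℓ, 0 < R.finalError ℓ)
    (hS0 : ∀ ℓ, 0 ≤ R.S ℓ) (hS : ∀ ℓ, R.S (ℓ + 1) = R.S ℓ + (R.finalError ℓ)⁻¹) :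
    ∃ lam₁ > 0, (∀ᶠ ℓ in atTop, R.lam ℓ ≤ lam₁) →
      ∃ C, ∀ᶠ ℓ in atTop, R.S ℓ ≤ C * (R.finalError ℓ)⁻¹ := by
  have hlt : ∀ ℓ : ℕ, (ℓ : ℕ∞) < R.lbar := fun ℓ => hlbar ▸ ENat.natCast_lt_top ℓ
  have hCpre := zero_lt_one.trans_le H.Cpre_ge
  have hCstab := H.axioms_.Cstab_pos
  have hCrel := H.Crel_pos
  have hs0 := Real.sqrt_nonneg a
  have hs1 : √a < 1 := by
    rw [Real.sqrt_lt' one_pos]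
    linarith [H.a_lt]
  set s := √a with hs
  -- The algebraic error may perturb the estimator by the relative amount κ; this value gives s + κ
  -- ≤ (1 - κ) b, so the reduction factor stays at most b < 1.
  set κ := (1 - s) / 4 with hκ
  set b := (1 + s) / 2 with hb
  have hb1 : b < 1 := by linarith
  -- The constant K comes from Young's inequality for (b η + 2 Cstab δ)². The factor in 2 * Crel
  -- accounts for evaluating the estimator at the computed iterate instead of the Galerkin solution.
  obtain ⟨ε, hε0, hε1, h⟩ := exists_sum_inv_bound_of_reduction (b := b)
    (K := 4 * Cstab ^ 2 / (1 - b)) (R := 2 * Crel) (by linarith) hb1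
    (div_pos (by positivity) (by linarith)) (by positivity)
  -- The bound 1 gives H ≤ 2η for the final quasi-error; the other bound makes Cstab times the
  -- algebraic error at most κη.
  refine ⟨min 1 (κ / (Cstab * Cpre)), lt_min one_pos (div_pos (by linarith) (by positivity)),
    fun hlam => ?_⟩
  have hX : Monotone R.X := monotone_nat_of_le_succ fun ℓ =>
    (H.isRefinement_succ ℓ (hlt ℓ)).feSpace_le M.Ω p
  obtain ⟨L, hL⟩ := eventually_atTop.1 (hlam.and
    (M.eventually_abs_a_le hΩ hX H.weakSol (fun n => H.galerkin n (hlt n).le) hε0))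
  have hη0 : ∀ n, 0 ≤ R.finalEst n := fun n => R.est_nonneg _ _
  have hlam1 : ∀ n ≥ L, R.resNorm n (R.kbar n).toNat ≤ R.finalEst n := fun n hn =>
    (H.resNorm_final_le (hlt n)).trans
      (mul_le_of_le_one_left (hη0 n) ((hL n hn).1.trans (min_le_left _ _)))
  have hUu : ∀ n ≥ L, Cstab * M.energyNorm (U n - R.uFinal n) ≤ κ * R.finalEst n := by
    intro n hn
    have h1 : M.energyNorm (U n - R.uFinal n) ≤ Cpre * R.resNorm n (R.kbar n).toNat :=
      H.energyNorm_sub_le (hlt n).le _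
    have h2 := H.resNorm_final_le (hlt n)
    have h3 := (hL n hn).1.trans (min_le_right _ _)
    rw [le_div_iff₀ (by positivity)] at h3
    calc Cstab * M.energyNorm (U n - R.uFinal n)
        ≤ Cstab * (Cpre * (R.lam n * R.finalEst n)) := by
          gcongr
          exact h1.trans (by gcongr)
      _ = (R.lam n * (Cstab * Cpre)) * R.finalEst n := by ring
      _ ≤ _ := mul_le_mul_of_nonneg_right h3 (hη0 n)
  refine (h R.finalEst (fun n => M.energyNorm (w - U n))
    (fun n => M.energyNorm (U (n + 1) - U n)) R.S R.finalError L hη0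
    (fun n => M.energyNorm_nonneg _) ?_ ?_ ?_ (fun n _ => hS n) (hS0 L) ?_).imp
    fun C hC => eventually_atTop.2 ⟨L, hC⟩
  · intro n hn
    have hmem : R.uFinal n ∈ R.X n := R.u_mem n _
    have hmem' : R.uFinal (n + 1) ∈ R.X (n + 1) := R.u_mem (n + 1) _
    have h1 : R.finalEst (n + 1) ≤ M.eta (R.mesh (n + 1)) (R.uFinal n) +
        Cstab * M.energyNorm (R.uFinal (n + 1) - R.uFinal n) :=
      H.axioms_.eta_le (H.isRefinement (n + 1) (hlt _).le) hmem' (hX n.le_succ hmem)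
    have h2 : M.eta (R.mesh (n + 1)) (R.uFinal n) ≤ s * R.finalEst n := by
      refine abs_le_of_sq_le_sq' ?_ (mul_nonneg hs0 (hη0 n)) |>.2
      rw [mul_pow]
      refine (H.reduction n (hlt n)).trans (mul_le_mul_of_nonneg_right ?_ (sq_nonneg _))
      rcases le_total 0 a with ha | ha
      · exact (Real.sq_sqrt ha).ge
      · exact ha.trans (sq_nonneg _)
    have h3 := M.energyNorm_sub_le (R.uFinal (n + 1)) (U (n + 1)) (R.uFinal n)
    have h4 := M.energyNorm_sub_le (U (n + 1)) (U n) (R.uFinal n)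
    rw [M.energyNorm_sub_comm _ (U (n + 1))] at h3
    have h5 := hUu n hn
    have h6 := hUu (n + 1) (by omega)
    set δ := M.energyNorm (U (n + 1) - U n) with hδ
    have hδ0 : 0 ≤ δ := M.energyNorm_nonneg _
    have h7 : Cstab * M.energyNorm (R.uFinal (n + 1) - R.uFinal n) ≤
        κ * R.finalEst (n + 1) + Cstab * δ + κ * R.finalEst n := by
      have := mul_le_mul_of_nonneg_left (h3.trans (add_le_add_right h4 _)) hCstab.le
      linarith
    have h8 : (1 - κ) * R.finalEst (n + 1) ≤ (s + κ) * R.finalEst n + Cstab * δ := by linarith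
    have h9 : R.finalEst (n + 1) ≤ b * R.finalEst n + 2 * Cstab * δ := by
      have e1 : s + κ ≤ (1 - κ) * b := by rw [hκ, hb]; nlinarith [sq_nonneg (1 - s)]
      have e2 : Cstab * δ ≤ (1 - κ) * (2 * Cstab * δ) := by
        have : 0 ≤ Cstab * δ := by positivity
        have : κ ≤ 1 / 4 := by linarith
        nlinarith
      have e3 := mul_le_mul_of_nonneg_right e1 (hη0 n)
      have e4 : 0 < 1 - κ := by linarith
      refine le_of_mul_le_mul_left (h8.trans ?_) e4
      linarith
    have hb2 : 0 < 1 - b := by linarith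
    refine (pow_le_pow_left₀ (hη0 _) h9 2).trans ?_
    rw [← sub_nonneg]
    have e : b * R.finalEst n ^ 2 + 4 * Cstab ^ 2 / (1 - b) * δ ^ 2
        - (b * R.finalEst n + 2 * Cstab * δ) ^ 2 =
        b / (1 - b) * ((1 - b) * R.finalEst n - 2 * Cstab * δ) ^ 2 := by
      field_simp
      ring
    rw [e]
    have : 0 ≤ b := by linarith
    positivity
  · intro n hn
    refine (H.energyNorm_sub_uFinal_le (hlt n).le).trans ?_
    have h5 := hUu n hn
    have h6 : κ * R.finalEst n ≤ R.finalEst n := mul_le_of_le_one_left (hη0 n) (by linarith)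
    calc _ ≤ Crel * (R.finalEst n + R.finalEst n) := by gcongr; linarith
      _ = _ := by ring
  · intro n hn
    -- The mixed term of the binomial formula is at least -2ε times the product of the two norms,
    -- hence at least -ε times the sum of their squares.
    have h1 := (abs_le.1 (hL n hn).2).1
    have h2 := M.energyNorm_add_sq (w - U (n + 1)) (U (n + 1) - U n)
    rw [sub_add_sub_cancel] at h2
    rw [h2]
    nlinarith [sq_nonneg (M.energyNorm (w - U (n + 1)) - M.energyNorm (U (n + 1) - U n))]
  · intro n hn
    have h1 := hlam1 n hn
    have h2 := R.resNorm_nonneg n (R.kbar n).toNat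
    have h3 : R.finalError n = R.finalEst n + R.resNorm n (R.kbar n).toNat := rfl
    exact ⟨hpos n, by linarith, by linarith⟩

end RunData

end AFEMHistory

end AFEM

namespace AFEM

/-! ### The parameter control -/

/-- In the nested control of the parameters, the update takes place only finitely often, provided
that sufficiently small tolerances control the sums `S`. -/
lemma eventually_no_update {lam C S h : ℕ → ℝ} (hlam0 : 0 < lam 0) (hC0 : 0 < C 0)
    (hh : ∀ n, 0 < h n)
    (hup : ∀ n, 1 ≤ n ∧ S n > C n * (h n)⁻¹ → C (n + 1) = 2 * C n ∧ lam (n + 1) = lam n / 2)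
    (hno : ∀ n, ¬ (1 ≤ n ∧ S n > C n * (h n)⁻¹) → C (n + 1) = C n ∧ lam (n + 1) = lam n)
    (hctrl : ∃ lam₁ > 0, (∀ᶠ n in atTop, lam n ≤ lam₁) → ∃ D, ∀ᶠ n in atTop, S n ≤ D * (h n)⁻¹) :
    ∃ L, ∀ n ≥ L, ¬ (1 ≤ n ∧ S n > C n * (h n)⁻¹) := by
  -- Doubling one parameter and halving the other leaves C · lam invariant, so small tolerances
  -- force large C.
  have hpos : ∀ n, 0 < lam n ∧ lam (n + 1) ≤ lam n ∧ C n * lam n = C 0 * lam 0 := by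
    intro n
    induction n with
    | zero =>
      refine ⟨hlam0, ?_, rfl⟩
      rw [(hno 0 (by simp)).2]
    | succ n ih =>
      have key : ∀ m, 0 < lam m → 0 < lam (m + 1) ∧ lam (m + 1) ≤ lam m ∧
          C (m + 1) * lam (m + 1) = C m * lam m := by
        intro m hm
        by_cases hu : 1 ≤ m ∧ S m > C m * (h m)⁻¹
        · obtain ⟨h1, h2⟩ := hup m hu
          rw [h1, h2]
          exact ⟨by linarith, by linarith, by ring⟩
        · obtain ⟨h1, h2⟩ := hno m hu
          rw [h1, h2]
          exact ⟨hm, le_rfl, rfl⟩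
      obtain ⟨h1, -, h3⟩ := key n ih.1
      exact ⟨h1, (key (n + 1) h1).2.1, h3.trans ih.2.2⟩
  have hanti : Antitone lam := antitone_nat_of_succ_le fun n => (hpos n).2.1
  by_contra! hinf
  have hsmall : ∀ j : ℕ, ∃ N, lam N ≤ lam 0 * (1 / 2) ^ j := by
    intro j
    induction j with
    | zero => exact ⟨0, by simp⟩
    | succ j ih =>
      obtain ⟨N, hN⟩ := ih
      obtain ⟨n, hn, hu⟩ := hinf N
      refine ⟨n + 1, ?_⟩
      rw [(hup n hu).2, pow_succ]
      linarith [hanti hn]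
  have hev : ∀ ε > 0, ∀ᶠ n in atTop, lam n ≤ ε := by
    intro ε hε
    obtain ⟨j, hj⟩ := exists_pow_lt_of_lt_one (div_pos hε hlam0) (show (1 / 2 : ℝ) < 1 by norm_num)
    obtain ⟨N, hN⟩ := hsmall j
    rw [lt_div_iff₀ hlam0] at hj
    exact eventually_atTop.2 ⟨N, fun n hn => (hanti hn).trans (hN.trans (by linarith))⟩
  -- With infinitely many updates lam tends to zero, so S is eventually bounded with a fixed D. As
  -- soon as lam ≤ C 0 * lam 0 / max D 1, the invariant gives C ≥ D, and no further update is
  -- possible.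
  obtain ⟨lam₁, hlam₁, hc⟩ := hctrl
  obtain ⟨D, hD⟩ := hc (hev lam₁ hlam₁)
  have hD1 : 0 < max D 1 := lt_max_of_lt_right one_pos
  obtain ⟨N, hN⟩ := eventually_atTop.1
    (hD.and (hev (C 0 * lam 0 / max D 1) (div_pos (mul_pos hC0 hlam0) hD1)))
  obtain ⟨n, hn, -, hu⟩ := hinf N
  obtain ⟨h1, h2⟩ := hN n hn
  rw [le_div_iff₀ hD1, ← (hpos n).2.2, mul_comm] at h2
  have h3 : max D 1 ≤ C n := le_of_mul_le_mul_right h2 (hpos n).1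
  have h4 := mul_le_mul_of_nonneg_right ((le_max_left D 1).trans h3) (inv_nonneg.2 (hh n).le)
  linarith

namespace AFEMHistory

variable {d : ℕ} [NeZero d] {M : ModelProblem d} {p : ℕ} {R : AFEMHistory M p}
  {𝒯₀ : Finset (TSimplex d)} {θ Cmark Calg lamAlg τ : ℝ} {u₀ : H01 M.Ω} {kmax : ℕ}

namespace IsRun

lemma finalError_nonneg (ℓ : ℕ) : 0 ≤ R.finalError ℓ := R.quasiError_nonneg _ _

/-- A negative tolerance is never met by a nonnegative quasi-error, so only a solver that does not
stop can end the sequence of levels. -/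
lemma levelsTerminate (hR : R.IsRun 𝒯₀ θ Cmark u₀ Calg lamAlg kmax τ) (hτ : τ < 0) :
    R.LevelsTerminate := by
  refine ⟨fun ℓ hℓ => ((hR.terminate ℓ hℓ.le).1 hℓ).1, fun ℓ hℓ => ?_⟩
  by_contra h
  have := (hR.terminate ℓ hℓ.le).2 ⟨h, not_le.2 (hτ.trans_le (finalError_nonneg ℓ))⟩
  exact this.ne hℓ

lemma isRefinement (hR : R.IsRun 𝒯₀ θ Cmark u₀ Calg lamAlg kmax τ) (h𝒯₀ : Conforming 𝒯₀) :
    ∀ ℓ : ℕ, (ℓ : ℕ∞) ≤ R.lbar → IsRefinement 𝒯₀ 𝒯₀ (R.mesh ℓ) := by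
  intro ℓ
  induction ℓ with
  | zero =>
    intro _
    rw [hR.mesh_zero]
    exact IsRefinement.refl_of_conforming h𝒯₀
  | succ ℓ ih =>
    intro hℓ
    have h1 : (ℓ : ℕ∞) < R.lbar := lt_of_lt_of_le (by exact_mod_cast Nat.lt_succ_self ℓ) hℓ
    exact (ih h1.le).trans (hR.refine_ ℓ h1).1.1

lemma S_eq_sum (hR : R.IsRun 𝒯₀ θ Cmark u₀ Calg lamAlg kmax τ) :
    ∀ ℓ : ℕ, (ℓ : ℕ∞) ≤ R.lbar → R.S ℓ = ∑ i ∈ Finset.range ℓ, (R.finalError i)⁻¹ := by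
  intro ℓ
  induction ℓ with
  | zero => intro _; rw [hR.S_zero, Finset.sum_range_zero]
  | succ ℓ ih =>
    intro hℓ
    have h1 : (ℓ : ℕ∞) < R.lbar := lt_of_lt_of_le (by exact_mod_cast Nat.lt_succ_self ℓ) hℓ
    rw [hR.S_succ ℓ h1, ih h1.le, Finset.sum_range_succ]

lemma lam_pos (hR : R.IsRun 𝒯₀ θ Cmark u₀ Calg lamAlg kmax τ) (hlam : 0 < lamAlg) :
    ∀ ℓ : ℕ, (ℓ : ℕ∞) ≤ R.lbar → 0 < R.lam ℓ ∧ ∀ i ≤ ℓ, R.lam ℓ ≤ R.lam i := by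
  intro ℓ
  induction ℓ with
  | zero =>
    intro _
    rw [hR.lam_zero]
    refine ⟨hlam, fun i hi => ?_⟩
    obtain rfl : i = 0 := by omega
    exact hR.lam_zero.ge
  | succ ℓ ih =>
    intro hℓ
    have h1 : (ℓ : ℕ∞) < R.lbar := lt_of_lt_of_le (by exact_mod_cast Nat.lt_succ_self ℓ) hℓ
    obtain ⟨h2, h3⟩ := ih h1.le
    have h4 : 0 < R.lam (ℓ + 1) ∧ R.lam (ℓ + 1) ≤ R.lam ℓ := by
      by_cases hu : 1 ≤ ℓ ∧ R.S ℓ > R.C ℓ * (R.finalError ℓ)⁻¹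
      · rw [(hR.update ℓ h1 hu).2]
        exact ⟨by linarith, by linarith⟩
      · rw [(hR.no_update ℓ h1 hu).2]
        exact ⟨h2, le_rfl⟩
    refine ⟨h4.1, fun i hi => ?_⟩
    rcases hi.eq_or_lt with rfl | hi
    · exact le_rfl
    · exact h4.2.trans (h3 i (by omega))

lemma exists_runData (hR : R.IsRun 𝒯₀ θ Cmark u₀ Calg lamAlg kmax τ)
    (h𝒯₀ : IsTriangulation M.Ω 𝒯₀) (hA1 : M.Stability p 𝒯₀) (hA2 : M.Reduction p 𝒯₀)
    (hA3 : M.Reliability p 𝒯₀) (hθ : 0 < θ) (hkmax : 1 ≤ kmax) (hτ : τ < 0)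
    (hP : R.OptimalPreconditioner) :
    ∃ Cb Cpre Cstab qred Crel a w U, R.RunData 𝒯₀ kmax Cb Cpre Cstab qred Crel a w U := by
  have hΩ := h𝒯₀.isBounded
  obtain ⟨Cb, hCb, hb⟩ := M.exists_abs_bil_le hΩ
  obtain ⟨Cpre, hCpre, hpre⟩ := hP
  obtain ⟨Cstab, qred, hax⟩ := M.exists_axioms hA1 hA2
  obtain ⟨Crel, hCrel, hrel⟩ := hA3
  obtain ⟨w, hw⟩ := M.exists_isWeakSol hΩ
  have hex : ∀ ℓ, ∃ u, M.IsGalerkinSol (R.X ℓ) u := fun ℓ => by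
    have : FiniteDimensional ℝ (R.X ℓ) := (R.basis ℓ).finiteDimensional_of_finite
    exact M.exists_isGalerkinSol hΩ _
  choose U hU using hex
  have href := hR.isRefinement h𝒯₀.1
  refine ⟨Cb, Cpre, Cstab, qred, Crel, 1 - (1 - qred ^ 2) * θ, w, U, ?_⟩
  exact
    { kmax_pos := hkmax
      Cb_ge := hCb
      bil_le := hb
      Cpre_ge := hCpre
      posDef := fun ℓ hℓ => (hpre ℓ hℓ).1
      pre_le := fun ℓ hℓ y => ((hpre ℓ hℓ).2 y).2
      le_pre := fun ℓ hℓ y => by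
        have h := ((hpre ℓ hℓ).2 y).1
        rwa [inv_mul_le_iff₀ (zero_lt_one.trans_le hCpre)] at h
      galerkin := fun ℓ _ => hU ℓ
      gmres := fun ℓ hℓ => by
        obtain ⟨-, -, I, h1, h2, h3⟩ := hR.solve ℓ hℓ
        exact ⟨I, h1, h2, h3⟩
      weakSol := hw
      axioms_ := hax
      Crel_pos := hCrel
      reliability := fun ℓ hℓ => hrel _ (href ℓ hℓ) w (U ℓ) hw (hU ℓ)
      isRefinement := href
      isRefinement_succ := fun ℓ hℓ => (hR.refine_ ℓ hℓ).1.1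
      a_lt := by
        have : 0 < 1 - qred ^ 2 := by nlinarith [hax.qred_pos, hax.qred_lt]
        linarith [mul_pos this hθ]
      reduction := fun ℓ hℓ => hax.estimator_reduction (href ℓ hℓ.le) (hR.refine_ ℓ hℓ).1.1
        (R.u_mem ℓ _) (hR.refine_ ℓ hℓ).1.2 (hR.mark ℓ hℓ).1.2
      one_le_kbar := fun ℓ hℓ => (hR.solve ℓ hℓ).1
      stopping_iff := fun ℓ k hℓ hk hb => (hR.solve ℓ hℓ).2.1 k hk hb
      nested_ := hR.nested
      terminates := hR.levelsTerminate hτ }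

/-- The solver tolerances are bounded from below. -/
lemma exists_lam_ge_and_sum_le (hR : R.IsRun 𝒯₀ θ Cmark u₀ Calg lamAlg kmax τ)
    {Cb Cpre Cstab qred Crel a : ℝ} {w : H01 M.Ω} {U : ℕ → H01 M.Ω}
    (H : R.RunData 𝒯₀ kmax Cb Cpre Cstab qred Crel a w U) (hΩ : Bornology.IsBounded M.Ω)
    (hCalg : 0 < Calg) (hlam : 0 < lamAlg)
    (hpos : ∀ ℓ : ℕ, (ℓ : ℕ∞) < R.lbar → 0 < R.finalError ℓ) :
    (∃ lam₀ > 0, ∀ ℓ : ℕ, (ℓ : ℕ∞) ≤ R.lbar → lam₀ ≤ R.lam ℓ) ∧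
      ∃ C, 0 ≤ C ∧ ∀ ℓ : ℕ, (ℓ : ℕ∞) < R.lbar →
        ∑ i ∈ Finset.range (ℓ + 1), (R.finalError i)⁻¹ ≤ C * (R.finalError ℓ)⁻¹ := by
  classical
  have hmax : ∀ B : ℝ, ∀ L : ℕ, (∀ ℓ ≥ L, (ℓ : ℕ∞) < R.lbar →
      (∑ i ∈ Finset.range (ℓ + 1), (R.finalError i)⁻¹) * R.finalError ℓ ≤ B) →
      ∃ C, 0 ≤ C ∧ ∀ ℓ : ℕ, (ℓ : ℕ∞) < R.lbar →
        ∑ i ∈ Finset.range (ℓ + 1), (R.finalError i)⁻¹ ≤ C * (R.finalError ℓ)⁻¹ := by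
    intro B L h
    obtain ⟨C, hC, hb⟩ := exists_forall_le_of_eventually (L := L) (C := max B 0)
      (a := fun ℓ => if (ℓ : ℕ∞) < R.lbar then
        (∑ i ∈ Finset.range (ℓ + 1), (R.finalError i)⁻¹) * R.finalError ℓ else 0)
      (fun ℓ hℓ => by
        split_ifs with h1
        · exact (h ℓ hℓ h1).trans (le_max_left _ _)
        · exact le_max_right _ _)
    refine ⟨C, hC.le, fun ℓ hℓ => ?_⟩
    have h1 := hb ℓ
    simp only [if_pos hℓ] at h1
    rwa [← div_eq_mul_inv, le_div_iff₀ (hpos ℓ hℓ)]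
  rcases eq_or_ne R.lbar ⊤ with htop | htop
  · have hlt : ∀ ℓ : ℕ, (ℓ : ℕ∞) < R.lbar := fun ℓ => htop ▸ ENat.natCast_lt_top ℓ
    have hpos' : ∀ ℓ, 0 < R.finalError ℓ := fun ℓ => hpos ℓ (hlt ℓ)
    have hS0 : ∀ ℓ, 0 ≤ R.S ℓ := fun ℓ => by
      rw [hR.S_eq_sum ℓ (hlt ℓ).le]
      exact Finset.sum_nonneg fun i _ => inv_nonneg.2 (hpos' i).le
    obtain ⟨L, hL⟩ := eventually_no_update (lam := R.lam) (C := R.C) (S := R.S)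
      (h := R.finalError) (by rw [hR.lam_zero]; exact hlam) (by rw [hR.C_zero]; exact hCalg) hpos'
      (fun n => hR.update n (hlt n)) (fun n => hR.no_update n (hlt n))
      (H.exists_sum_inv_le hΩ htop hpos' hS0 fun ℓ => hR.S_succ ℓ (hlt ℓ))
    have hconst : ∀ n ≥ L, R.C n = R.C L ∧ R.lam n = R.lam L := by
      intro n hn
      induction n, hn using Nat.le_induction with
      | base => exact ⟨rfl, rfl⟩
      | succ n hn ih =>
        obtain ⟨h1, h2⟩ := hR.no_update n (hlt n) (hL n hn)
        exact ⟨h1.trans ih.1, h2.trans ih.2⟩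
    refine ⟨⟨R.lam L, (hR.lam_pos hlam L (hlt L).le).1, fun ℓ _ => ?_⟩, ?_⟩
    · rcases le_total ℓ L with h | h
      · exact (hR.lam_pos hlam L (hlt L).le).2 ℓ h
      · exact (hconst ℓ h).2.ge
    · refine hmax (R.C L + 1) (max L 1) fun ℓ hℓ _ => ?_
      have h1 := hL ℓ ((le_max_left _ _).trans hℓ)
      simp only [(le_max_right L 1).trans hℓ, true_and, not_lt, gt_iff_lt] at h1
      rw [(hconst ℓ ((le_max_left _ _).trans hℓ)).1] at h1
      rw [← hR.S_eq_sum (ℓ + 1) (hlt _).le, hR.S_succ ℓ (hlt ℓ), ← le_div_iff₀ (hpos' ℓ),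
        div_eq_mul_inv]
      linarith
  -- With finitely many levels the last tolerance is the smallest one, and the reciprocal sums take
  -- finitely many values.
  · obtain ⟨m, hm⟩ := ENat.ne_top_iff_exists.1 htop
    refine ⟨⟨R.lam m, (hR.lam_pos hlam m hm.le).1, fun ℓ hℓ => ?_⟩, ?_⟩
    · rw [← hm] at hℓ
      exact (hR.lam_pos hlam m hm.le).2 ℓ (by exact_mod_cast hℓ)
    · refine hmax 0 m fun ℓ hℓ h => ?_
      rw [← hm] at h
      have : ℓ < m := by exact_mod_cast h
      omega

end IsRun

end AFEMHistory

end AFEM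

end

/-! ### Full R-linear convergence -/

theorem theorem5p4 {d : ℕ} [NeZero d] (p : ℕ) (hp : 1 ≤ p)
    (M : ModelProblem d) (𝒯₀ : Finset (TSimplex d))
    (h𝒯₀ : IsTriangulation M.Ω 𝒯₀) (hreg : PiecewiseRegular M 𝒯₀)
    (hA1 : M.Stability p 𝒯₀) (hA2 : M.Reduction p 𝒯₀) (hA3 : M.Reliability p 𝒯₀)
    (θ Cmark Calg lamAlg τ : ℝ) (kmax : ℕ) (u₀ : H01 M.Ω)
    (hθ : 0 < θ) (hθ' : θ ≤ 1) (hCmark : 1 ≤ Cmark) (hCalg : 0 < Calg) (hlam : 0 < lamAlg)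
    (hkmax : 1 ≤ kmax) (hu₀ : u₀ ∈ feSpace M.Ω p 𝒯₀) (hτ : τ < 0)
    (R : AFEMHistory M p) (hR : R.IsRun 𝒯₀ θ Cmark u₀ Calg lamAlg kmax τ)
    (hP : R.OptimalPreconditioner) :
    ∃ qlin Clin : ℝ, 0 < qlin ∧ qlin < 1 ∧ 0 < Clin ∧
      ∀ ℓ k ℓ' k' : ℕ, (ℓ, k) ∈ R.Q → (ℓ', k') ∈ R.Q →
        R.counter (ℓ', k') ≤ R.counter (ℓ, k) →
        R.quasiError ℓ k ≤
          Clin * qlin ^ (R.counter (ℓ, k) - R.counter (ℓ', k')) * R.quasiError ℓ' k' := by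
  obtain ⟨Cb, Cpre, Cstab, qred, Crel, a, w, U, H⟩ :=
    hR.exists_runData h𝒯₀ hA1 hA2 hA3 hθ hkmax hτ hP
  have hCb := zero_le_one.trans H.Cb_ge
  have hCpre := zero_le_one.trans H.Cpre_ge
  have hCstab := H.axioms_.Cstab_pos.le
  have hCrel := H.Crel_pos.le
  refine H.terminates.linear_convergence R.quasiError_nonneg
    (Cout := 1 + Cb * Cpre * ((1 + Cb) * (Crel + Crel * Cstab * Cpre + Cpre))) (by positivity)
    (fun ℓ k hℓ hk h0 => ?_) (fun ℓ hℓ => H.quasiError_succ_le hℓ) fun hpos => ?_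
  · refine le_antisymm ?_ (R.quasiError_nonneg _ _)
    simpa [h0] using H.quasiError_le hℓ (Nat.le_succ k) hk
  · obtain ⟨⟨lam₀, hlam₀, h⟩, hsum⟩ := hR.exists_lam_ge_and_sum_le H h𝒯₀.isBounded hCalg hlam
      fun ℓ hℓ => hpos ℓ _ ⟨hℓ.le, ENat.natCast_toNat_le_self _⟩
    exact ⟨H.exists_quasiError_le hlam₀ h, hsum⟩
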